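/- Write $[x]=x-x^{-1}$ for $x\in\mathbb C\setminus\{0\}$. Let $N\ge 1$, $n=\lfloor N/2\rfloor$, and let $V=\mathbb C^2$ have basis $|{\uparrow}\rangle,|{\downarrow}\rangle$. Let $q\in\{\mathrm e^{2\pi \mathrm i/3},\mathrm e^{-2\pi\mathrm i/3}\}$ and let $\beta,\bar\beta\in\mathbb C$ satisfy $\bar\beta^2\beta^2q^2=1$. *Transfer matrix.* Let $R(z)$ be the operator on $V\otimes V$ acting on the basis $|{\uparrow\uparrow}\rangle,|{\uparrow\downarrow}\rangle,|{\downarrow\uparrow}\rangle,|{\downarrow\downarrow}\rangle$ as $$R(z)=\begin{pmatrix}a&0&0&0\\0&b&c&0\\0&c&b&0\\0&0&0&a\end{pmatrix},\qquad a=\frac{[qz]}{[q/z]},\quad b=\frac{[z]}{[q/z]},\quad c=\frac{[q]}{[q/z]},$$ and let $K(z;\beta)=\mathrm{diag}(1,[\beta z]/[\beta/z])$ on $V$. The transfer matrix of the inhomogeneous six-vertex model on a strip is the operator on $V^{N}=V_1\otimes\cdots\otimes V_N$ given by $$T(z|z_1,\dots,z_N)=\mathrm{tr}_0\Bigl(K_0(qz;\bar\beta)\,R_{0,N}(z/z_N)\cdots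 R_{0,1}(z/z_1)\,K_0(z;\beta)\,R_{0,1}(zz_1)\cdots R_{0,N}(zz_N)\Bigr),$$ where the trace is over an additional copy $V_0$ of $V$, and indices indicate the tensor factors on which an operator acts. *The vector.* Let $z_1,\dots,z_N$ be generic: they are nonzero, and $z_i\notin\{-z_j,\ \pm qz_j,\ \pm q^{-2}z_j^{-1}\}$ for all $1\le i,j\le N$. For $1\le a_1<\dots<a_n\le N$ put $$\Xi_{a_1,\dots,a_n}=\frac{\prod_{1\le i<j\le n}[qw_j/w_i][w_i/w_j][qw_iw_j]\ \prod_{1\le i\le j\le n}[q^2w_iw_j]\ \prod_{i=1}^n[\beta w_i]}{\prod_{i=1}^n\Bigl(\prod_{j=1}^{a_i}[z_j/w_i]\ \prod_{j=a_i}^N[qz_j/w_i]\ \prod_{j=1}^N[q^2w_iz_j]\Bigr)},$$ $$(\Psi_N)_{a_1,\dots,a_n}=(-[q])^n\prod_{1\le i<j\le N}[qz_j/z_i][q^2z_iz_j]\oint\!\cdots\!\oint\prod_{\ell=1}^n\frac{\mathrm dw_\ell}{\pi\mathrm i\,w_\ell}\ \Xi_{a_1,\dots,a_n},$$ where each $w_\ell$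 runs over a finite collection of positively oriented circles bounding pairwise disjoint closed discs whose interiors together contain all the $z_j$, while the closed discs contain none of the points $0,\,-z_j,\,\pm qz_j,\,\pm q^{-2}z_j^{-1}$. Let $$|\Psi_N\rangle=|\Psi_N(z_1,\dots,z_N)\rangle=\sum_{1\le a_1<\cdots<a_n\le N}(\Psi_N)_{a_1,\dots,a_n}\,|\cdots\rangle\in V^N,$$ where $|\cdots\rangle$ is the basis vector with spins $\downarrow$ at the positions $a_1,\dots,a_n$ and $\uparrow$ at all other positions (so $|\Psi_1\rangle=|{\uparrow}\rangle$). **Proposition.** For every such choice of circles, the vector $|\Psi_N\rangle$ is an eigenvector of the transfer matrix, with an explicit eigenvalue: $$T(z|z_1,\dots,z_N)\,|\Psi_N\rangle=\Lambda_N(z)\,|\Psi_N\rangle,\qquad \Lambda_N(z)=-\frac{[q\beta z]}{[q^2\beta z]},$$ for every $z\in\mathbb C\setminus\{0\}$ at which the entries of the matrices are defined, that is, with $[\beta/z]\ne0$, $[q^2\beta z]\neq 0$ and $[qz_j/z]\ne 0$, $[q/(z_jz)]\neq0$ for $j=1,\dots,N$. Moreover $|\Psi_N\rangle\neq0$ whenever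 $[\beta z_j]\ne0$ for all $j$ and $[qz_iz_j]\ne0$ for all $i\ne j$. -/

import Mathlib

namespace SixVertex

/-- The bracket `[z] = z - z⁻¹`. -/
noncomputable def bracket (z : ℂ) : ℂ := z - z⁻¹

/-! ### Spins and operators

The spin space `V = ℂ²` has basis `0 = ↑`, `1 = ↓`.  The canonical basis of `V^{⊗ M}` is indexed by
the spin configurations `Fin M → Fin 2`; vectors are given by their components and operators by
their matrix elements in this basis. -/

/-- Spin configurations on `M` sites, with `0 = ↑` and `1 = ↓`. -/
abbrev Config (M : ℕ) : Type := Fin M → Fin 2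

/-- The operator `A_i` acting as `A` on the tensor factor `i` and as the identity elsewhere. -/
def leg1 {M : ℕ} (A : Matrix (Fin 2) (Fin 2) ℂ) (i : Fin M) : Matrix (Config M) (Config M) ℂ :=
  Matrix.of fun s t => if ∀ k, k ≠ i → s k = t k then A (s i) (t i) else 0

/-- The operator `A_{i,j}` acting as `A` on the tensor factors `i`, `j` (for `i ≠ j`) and as the
identity elsewhere. -/
def leg2 {M : ℕ} (A : Matrix (Fin 2 × Fin 2) (Fin 2 × Fin 2) ℂ) (i j : Fin M) :
    Matrix (Config M) (Config M) ℂ :=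
  Matrix.of fun s t =>
    if ∀ k, k ≠ i → k ≠ j → s k = t k then A (s i, s j) (t i, t j) else 0

/-- The partial trace over the tensor factor `V_0` of `V_0 ⊗ V_1 ⊗ ⋯ ⊗ V_N`. -/
def partialTrace {N : ℕ} (A : Matrix (Config (N + 1)) (Config (N + 1)) ℂ) :
    Matrix (Config N) (Config N) ℂ :=
  Matrix.of fun s t => ∑ a : Fin 2, A (Fin.cons a s) (Fin.cons a t)

/-- The `R`-matrix of the six-vertex model: `a = [qz]/[q/z]` on `↑↑` and `↓↓`, diagonal entries
`b = [z]/[q/z]` and off-diagonal entries `c = [q]/[q/z]` on the span of `↑↓`, `↓↑`. -/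
noncomputable def RMatrix (q z : ℂ) : Matrix (Fin 2 × Fin 2) (Fin 2 × Fin 2) ℂ :=
  Matrix.of fun s t =>
    if s = t then
      if s.1 = s.2 then bracket (q * z) / bracket (q / z) else bracket z / bracket (q / z)
    else if s = t.swap then bracket q / bracket (q / z)
    else 0

/-- The diagonal `K`-matrix `K(z;β) = diag(1, [βz]/[β/z])`. -/
noncomputable def KMatrix (z β : ℂ) : Matrix (Fin 2) (Fin 2) ℂ :=
  Matrix.diagonal ![1, bracket (β * z) / bracket (β / z)]

/-- The transfer matrix `T(w|z_1,…,z_N)` of the inhomogeneous six-vertex model on a strip: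
`tr_0 (K_0(qw;β') R_{0,N}(w/z_N) ⋯ R_{0,1}(w/z_1) K_0(w;β) R_{0,1}(w z_1) ⋯ R_{0,N}(w z_N))`. -/
noncomputable def transferMatrix {N : ℕ} (q β β' : ℂ) (z : Fin N → ℂ) (w : ℂ) :
    Matrix (Config N) (Config N) ℂ :=
  partialTrace
    (leg1 (KMatrix (q * w) β') 0
      * (List.ofFn fun i : Fin N => leg2 (RMatrix q (w / z i)) 0 i.succ).reverse.prod
      * leg1 (KMatrix w β) 0
      * (List.ofFn fun i : Fin N => leg2 (RMatrix q (w * z i)) 0 i.succ).prod)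

/-! ### The vector defined by multiple contour integrals -/

/-- The integrand `Ξ_{a_1,…,a_n}(w_1,…,w_n|z_1,…,z_N)`. -/
noncomputable def Xi {N n : ℕ} (q β : ℂ) (z : Fin N → ℂ) (a : Fin n → Fin N) (w : Fin n → ℂ) : ℂ :=
  ((∏ i, ∏ j ∈ Finset.Ioi i,
        bracket (q * w j / w i) * bracket (w i / w j) * bracket (q * w i * w j))
      * (∏ i, ∏ j ∈ Finset.Ici i, bracket (q ^ 2 * w i * w j))
      * ∏ i, bracket (β * w i))
    / ∏ i, ((∏ j ∈ Finset.Iic (a i), bracket (z j / w i))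
        * (∏ j ∈ Finset.Ici (a i), bracket (q * z j / w i))
        * ∏ j, bracket (q ^ 2 * w i * z j))

/-- A collection of finitely many circles in the complex plane, each positively oriented. -/
structure Contour where
  /-- the number of circles -/
  m : ℕ
  /-- the centres -/
  center : Fin m → ℂ
  /-- the radii -/
  radius : Fin m → ℝ

/-- The circles have positive radii and bound pairwise disjoint closed discs; together they surround
all the points `z_j`, but none of the points `0`, `-z_j`, `±q z_j`, `±q⁻² z_j⁻¹`. -/
structure Contour.Surrounds {N : ℕ} (Γ : Contour) (q : ℂ) (z : Fin N → ℂ) : Prop where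
  radius_pos : ∀ k, 0 < Γ.radius k
  disjoint : ∀ k l, k ≠ l → Disjoint (Metric.closedBall (Γ.center k) (Γ.radius k))
    (Metric.closedBall (Γ.center l) (Γ.radius l))
  inside : ∀ j, ∃ k, z j ∈ Metric.ball (Γ.center k) (Γ.radius k)
  outside : ∀ k, ∀ w ∈ Metric.closedBall (Γ.center k) (Γ.radius k),
    w ≠ 0 ∧ ∀ j, w ≠ -z j ∧ w ≠ q * z j ∧ w ≠ -(q * z j) ∧
      w ≠ (q ^ 2)⁻¹ * (z j)⁻¹ ∧ w ≠ -((q ^ 2)⁻¹ * (z j)⁻¹)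

/-- The multiple integral `∮ ⋯ ∮ ∏ dw_ℓ f(w_1,…,w_n)` in which each variable runs over `Γ`. -/
noncomputable def Contour.multiIntegral (Γ : Contour) {n : ℕ} (f : (Fin n → ℂ) → ℂ) : ℂ :=
  ∑ κ : Fin n → Fin Γ.m, torusIntegral f (fun l => Γ.center (κ l)) (fun l => Γ.radius (κ l))

/-- The component `(Ψ_N)_{a_1,…,a_n}(z_1,…,z_N)`. -/
noncomputable def psiComponent {N n : ℕ} (q β : ℂ) (z : Fin N → ℂ) (Γ : Contour)
    (a : Fin n → Fin N) : ℂ :=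
  (-bracket q) ^ n
    * (∏ i, ∏ j ∈ Finset.Ioi i, bracket (q * z j / z i) * bracket (q ^ 2 * z i * z j))
    * Γ.multiIntegral fun w => (∏ l, 1 / (Real.pi * Complex.I * w l)) * Xi q β z a w

/-- The vector `|Ψ_N(z_1,…,z_N)⟩`: its component along a configuration with exactly `⌊N/2⌋` down
spins, at the positions `a_1 < ⋯ < a_n`, is `(Ψ_N)_{a_1,…,a_n}`, and all others vanish. For `N = 1`
this is `|↑⟩`. -/
noncomputable def psi {N : ℕ} (q β : ℂ) (z : Fin N → ℂ) (Γ : Contour) : Config N → ℂ := fun s =>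
  if h : (Finset.univ.filter fun i => s i = 1).card = N / 2 then
    psiComponent q β z Γ ((Finset.univ.filter fun i => s i = 1).orderEmbOfFin h)
  else 0

/-- The parameters `z_1,…,z_N` are generic: they are nonzero, and none of them is one of the
singularities `-z_j`, `±q z_j`, `±q⁻² z_j⁻¹` that the contour must avoid. -/
def IsGeneric {N : ℕ} (q : ℂ) (z : Fin N → ℂ) : Prop :=
  ∀ i, z i ≠ 0 ∧ ∀ j, z i ≠ -z j ∧ z i ≠ q * z j ∧ z i ≠ -(q * z j) ∧
    z i ≠ (q ^ 2)⁻¹ * (z j)⁻¹ ∧ z i ≠ -((q ^ 2)⁻¹ * (z j)⁻¹)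

/-- Contours as required in the definition of the vector exist exactly for generic parameters. -/
theorem exists_surrounds_iff {N : ℕ} (q : ℂ) (z : Fin N → ℂ) :
    (∃ Γ : Contour, Γ.Surrounds q z) ↔ IsGeneric q z := by
  constructor
  · rintro ⟨Γ, hΓ⟩ i
    obtain ⟨k, hk⟩ := hΓ.inside i
    exact hΓ.outside k _ (Metric.ball_subset_closedBall hk)
  · intro hz
    classical
    let P : Finset ℂ := Finset.univ.image z
    let B : Finset ℂ := {0} ∪ (Finset.univ.image fun j => -z j) ∪
      (Finset.univ.image fun j => q * z j) ∪ (Finset.univ.image fun j => -(q * z j)) ∪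
      (Finset.univ.image fun j => (q ^ 2)⁻¹ * (z j)⁻¹) ∪
      (Finset.univ.image fun j => -((q ^ 2)⁻¹ * (z j)⁻¹))
    have hPB : ∀ p ∈ P, ∀ b ∈ B, p ≠ b := by
      intro p hp b hb
      obtain ⟨i, -, rfl⟩ := Finset.mem_image.1 hp
      obtain ⟨h0, h⟩ := hz i
      simp only [B, Finset.mem_union, Finset.mem_singleton, Finset.mem_image, Finset.mem_univ,
        true_and] at hb
      rcases hb with ((((rfl | ⟨j, rfl⟩) | ⟨j, rfl⟩) | ⟨j, rfl⟩) | ⟨j, rfl⟩) | ⟨j, rfl⟩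
      · exact h0
      · exact (h j).1
      · exact (h j).2.1
      · exact (h j).2.2.1
      · exact (h j).2.2.2.1
      · exact (h j).2.2.2.2
    have hsep : ∃ ε : ℝ, 0 < ε ∧ ∀ p ∈ P, ∀ b ∈ P ∪ B, p ≠ b → ε ≤ dist p b := by
      by_cases hne : ((P ×ˢ (P ∪ B)).filter fun x => x.1 ≠ x.2).Nonempty
      · obtain ⟨x, hx, hmin⟩ := Finset.exists_min_image _ (fun x : ℂ × ℂ => dist x.1 x.2) hne
        refine ⟨dist x.1 x.2, dist_pos.2 (Finset.mem_filter.1 hx).2, fun p hp b hb hpb => ?_⟩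
        exact hmin (p, b) (Finset.mem_filter.2 ⟨Finset.mem_product.2 ⟨hp, hb⟩, hpb⟩)
      · refine ⟨1, one_pos, fun p hp b hb hpb => (hne ⟨(p, b), ?_⟩).elim⟩
        exact Finset.mem_filter.2 ⟨Finset.mem_product.2 ⟨hp, hb⟩, hpb⟩
    obtain ⟨ε, hε, hd⟩ := hsep
    let e := P.equivFin
    have hout : ∀ p ∈ P, ∀ b ∈ B, ∀ w ∈ Metric.closedBall p (ε / 3), w ≠ b := by
      rintro p hp b hb w hw rfl
      have h1 := hd p hp w (Finset.mem_union_right _ hb) (hPB p hp w hb)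
      rw [Metric.mem_closedBall, dist_comm] at hw
      linarith
    refine ⟨⟨P.card, fun k => ((e.symm k : P) : ℂ), fun _ => ε / 3⟩, ?_, ?_, ?_, ?_⟩
    · intro k
      show (0 : ℝ) < ε / 3
      linarith
    · intro k l hkl
      apply Metric.closedBall_disjoint_closedBall
      have hne : ((e.symm k : P) : ℂ) ≠ ((e.symm l : P) : ℂ) := fun h =>
        hkl (e.symm.injective (Subtype.ext h))
      have := hd _ (e.symm k).2 _ (Finset.mem_union_left _ (e.symm l).2) hne
      show ε / 3 + ε / 3 < _
      linarith
    · intro j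
      refine ⟨e ⟨z j, Finset.mem_image_of_mem z (Finset.mem_univ j)⟩, ?_⟩
      simp only [Equiv.symm_apply_apply]
      exact Metric.mem_ball_self (by linarith)
    · intro k w hw
      have h := fun b hb => hout _ (e.symm k).2 b hb w hw
      refine ⟨h _ (by simp [B]), fun j => ⟨h _ ?_, h _ ?_, h _ ?_, h _ ?_, h _ ?_⟩⟩ <;>
        simp only [B, Finset.mem_union, Finset.mem_image, Finset.mem_univ, true_and]
      · exact .inl (.inl (.inl (.inl (.inr ⟨j, rfl⟩))))
      · exact .inl (.inl (.inl (.inr ⟨j, rfl⟩)))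
      · exact .inl (.inl (.inr ⟨j, rfl⟩))
      · exact .inl (.inr ⟨j, rfl⟩)
      · exact .inr ⟨j, rfl⟩

end SixVertex

namespace SixVertex

open Finset

/-! ### Brackets -/

/-! For distinct parameters the contour integral is a sum over residues: every integration variable
sits at one of the nodes `z k`. This sum `amp` satisfies three families of functional relations in
the parameters, and the eigenvalue equation follows from them.

Exchange (`ampVec_swap_of_eq`, `ampVec_swap_of_ne`): exchanging adjacent parameters amounts to
acting with the R-matrix on the two sites. This reduces to a three-term identity for brackets in one
integration variable or, if both sites are down, to an antisymmetry in two of them. Reflection: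
inverting the first or the last parameter amounts to acting with a diagonal matrix on the boundary
site (`ampVec_reflectFirst_up`, `ampVec_reflectFirst_down`, `ampVec_reflectLast_up`,
`ampVec_reflectLast_down`). On the right this is seen on the last integration variable. On the left
it is checked for the components with the down spins as far left as possible, which have explicit
expressions, and propagated by exchange. Both nontrivial cases rest on the Lagrange identity, that
the residues of a rational function decaying fast enough sum to zero. The degree counts are `2 * n ≤
N` on the right and `N ≤ 2 * n + 1` on the left, which together force `n = N / 2`; the relation `q ^
3 = 1` gives `q⁻¹ = q ^ 2`, which makes the functions involved polynomials in the symmetric variable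
`quadVar`.

Fusion (`tendsto_ampVec_snoc_snoc`): when two further parameters `u`, `v` are appended and `u / v`
tends to `q`, the vector for `N + 2` sites tends to a multiple of the vector for `N` sites tensored
with a singlet on the two new sites.

For the eigenvalue equation take `u = w⁻¹` and `v → (q * w)⁻¹`. Moving `w⁻¹` to the left end,
reflecting it and moving `w` back produces all factors of the transfer matrix but the last K-matrix,
acting on the auxiliary half of a singlet. Reflecting `v` on the right and exchanging the two extra
parameters gives the pair `(q * w, w)`, again of ratio `q`, so the result is again read off from the
`N`-site vector. The two opposite-spin components of the singlet yield the two terms of the trace,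
the condition on `β'` supplies the right K-matrix, and the quotient of the fusion factors is the
eigenvalue.

These steps need parameters in general position. Both sides are continuous for fixed circles, so a
deformation `z j * t ^ (j + 1)` with `t → 1` gives the general case. The vector is nonzero because
its component with all down spins to the left is an explicit product (`amp_castLE`). -/

theorem bracket_inv (x : ℂ) : bracket x⁻¹ = -bracket x := by simp [bracket]

theorem bracket_one : bracket 1 = 0 := by simp [bracket]

theorem bracket_neg (x : ℂ) : bracket (-x) = -bracket x := by simp [bracket, inv_neg]; ring

theorem bracket_div_comm (x y : ℂ) : bracket (x / y) = -bracket (y / x) := by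
  rw [← bracket_inv, inv_div]

theorem bracket_ne_zero_iff {x : ℂ} (hx : x ≠ 0) : bracket x ≠ 0 ↔ x ^ 2 ≠ 1 := by
  unfold bracket
  rw [not_iff_not, sub_eq_zero, sq, ← mul_eq_one_iff_eq_inv₀ hx]

/-- The variable `u² / c + c / u²`, in terms of which products of two brackets are differences. -/
noncomputable def quadVar (c u : ℂ) : ℂ := u ^ 2 / c + c / u ^ 2

/-- `quadVar c` is invariant under `u ↦ -u` and `u ↦ c / u`. Through this identity, products of
bracket pairs become polynomials in `quadVar c u`, to which the Lagrange identity applies. -/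
theorem bracket_mul_bracket_eq (c u t : ℂ) (hc : c ≠ 0) (hu : u ≠ 0) (ht : t ≠ 0) :
    bracket (u / t) * bracket (u * t / c) = quadVar c u - quadVar c t := by
  unfold bracket quadVar
  field_simp
  ring

/-- The Lagrange identity: the sum of the residues of a rational function with simple poles at
distinct points that decays at least quadratically at infinity vanishes. -/
theorem sum_prod_sub_div_prod_sub_eq_zero {ι κ : Type*} [DecidableEq ι] (s : Finset ι)
    (t : Finset κ) (x : ι → ℂ) (y : κ → ℂ) (hx : Set.InjOn x s) (hst : t.card + 2 ≤ s.card) :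
    ∑ i ∈ s, (∏ k ∈ t, (x i - y k)) / ∏ j ∈ s.erase i, (x i - x j) = 0 := by
  classical
  set P : Polynomial ℂ := ∏ k ∈ t, (Polynomial.X - Polynomial.C (y k)) with hP
  have hdeg : P.natDegree = t.card := by
    rw [hP, Polynomial.natDegree_prod_of_monic _ _ fun k _ => Polynomial.monic_X_sub_C _]
    simp
  have hPd : P.degree < s.card := by
    refine lt_of_le_of_lt Polynomial.degree_le_natDegree ?_
    rw [hdeg]
    exact_mod_cast (by omega : t.card < s.card)
  -- The sum is the coefficient of degree `s.card - 1` in the interpolation formula for `P`, and `P`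
  -- has smaller degree.
  have h := Lagrange.coeff_eq_sum hx hPd
  rw [Polynomial.coeff_eq_zero_of_natDegree_lt (by rw [hdeg]; omega)] at h
  rw [h]
  refine sum_congr rfl fun i _ => ?_
  simp [hP, Polynomial.eval_prod]

/-! ### Products over ordered pairs -/

/-- The product over all pairs `i < j`. -/
noncomputable def pairProd {n : ℕ} (f : Fin n → Fin n → ℂ) : ℂ := ∏ i, ∏ j ∈ Ioi i, f i j

theorem pairProd_eq_prod_filter {n : ℕ} (f : Fin n → Fin n → ℂ) :
    pairProd f = ∏ p ∈ univ.filter (fun p : Fin n × Fin n => p.1 < p.2), f p.1 p.2 := by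
  unfold pairProd
  rw [prod_finset_product _ univ (fun i => Ioi i)]
  simp

theorem pairProd_mul {n : ℕ} (f g : Fin n → Fin n → ℂ) :
    pairProd (fun i j => f i j * g i j) = pairProd f * pairProd g := by
  simp [pairProd, prod_mul_distrib]

/-- Adjacent transpositions preserve the order of every pair except the transposed one. -/
theorem swap_lt_swap {n : ℕ} {i j : Fin n} (hij : i.val + 1 = j.val) {x y : Fin n} (hxy : x < y)
    (h : ¬(x = i ∧ y = j)) : Equiv.swap i j x < Equiv.swap i j y := by
  simp only [Equiv.swap_apply_def]
  simp only [Fin.ext_iff, Fin.lt_def] at *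
  split_ifs <;> omega

/-- An adjacent transposition permutes all ordered pairs other than `(i, j)` among themselves, so
their factors form a common cofactor `R`. -/
theorem exists_pairProd_swap {n : ℕ} {i j : Fin n} (hij : i.val + 1 = j.val)
    (f : Fin n → Fin n → ℂ) :
    ∃ R, pairProd f = f i j * R ∧
      pairProd (fun x y => f (Equiv.swap i j x) (Equiv.swap i j y)) = f j i * R := by
  have hlt : i < j := by rw [Fin.lt_def]; omega
  have hmem : ((i, j) : Fin n × Fin n) ∈
      univ.filter (fun p : Fin n × Fin n => p.1 < p.2) := by simpa using hlt
  refine ⟨∏ p ∈ (univ.filter (fun p : Fin n × Fin n => p.1 < p.2)).erase (i, j), f p.1 p.2, ?_, ?_⟩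
  · rw [pairProd_eq_prod_filter, mul_prod_erase _ (fun p : Fin n × Fin n => f p.1 p.2) hmem]
  rw [pairProd_eq_prod_filter, ← mul_prod_erase _ _ hmem]
  simp only [Equiv.swap_apply_left, Equiv.swap_apply_right]
  congr 1
  have key : ∀ p ∈ (univ.filter (fun p : Fin n × Fin n => p.1 < p.2)).erase (i, j),
      (Equiv.swap i j p.1, Equiv.swap i j p.2) ∈
        (univ.filter (fun p : Fin n × Fin n => p.1 < p.2)).erase (i, j) := by
    rintro ⟨x, y⟩ h
    simp only [mem_erase, mem_filter, mem_univ, true_and, ne_eq, Prod.mk.injEq] at h ⊢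
    refine ⟨?_, swap_lt_swap hij h.2 h.1⟩
    rintro ⟨hx, hy⟩
    have h1 := h.2
    rw [Equiv.swap_apply_eq_iff, Equiv.swap_apply_left] at hx
    rw [Equiv.swap_apply_eq_iff, Equiv.swap_apply_right] at hy
    subst hx hy
    exact absurd h1 (not_lt.2 hlt.le)
  exact prod_bij' (fun p _ => (Equiv.swap i j p.1, Equiv.swap i j p.2))
    (fun p _ => (Equiv.swap i j p.1, Equiv.swap i j p.2)) key key (by simp) (by simp) (by simp)

/-! ### The vector as a sum over residues -/

/-- Parameters for which all expressions below are defined; the condition is stable under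
permutations of the parameters and under the inversion of any of them. -/
structure IsRegular {N : ℕ} (q : ℂ) (z : Fin N → ℂ) : Prop where
  ne_zero : ∀ i, z i ≠ 0
  mul_ne : ∀ (k : ℕ) (i j), bracket (q ^ k * z i * z j) ≠ 0
  div_ne : ∀ (k : ℕ) (i j), i ≠ j → bracket (q ^ k * z i / z j) ≠ 0

/-- The part of the integrand coupling two integration variables. -/
noncomputable def pairFactor (q x y : ℂ) : ℂ :=
  bracket (q * y / x) * bracket (x / y) * bracket (q * x * y) * bracket (q ^ 2 * x * y)

/-- The part of the integrand depending on one integration variable and symmetric in the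
inhomogeneity parameters. -/
noncomputable def oneFactor {N : ℕ} (q β : ℂ) (z : Fin N → ℂ) (u : ℂ) : ℂ :=
  bracket (q ^ 2 * u * u) * bracket (β * u) / ∏ j, bracket (q ^ 2 * u * z j)

/-- The part of the integrand depending on one integration variable and its site. -/
noncomputable def siteFactor {N : ℕ} (q : ℂ) (z : Fin N → ℂ) (a : Fin N) (u : ℂ) : ℂ :=
  (∏ j ∈ Ioi a, bracket (z j / u)) / ∏ j ∈ Ici a, bracket (q * z j / u)

/-- The residue weight of the node `z k`. -/
noncomputable def nodeWeight {N : ℕ} (z : Fin N → ℂ) (k : Fin N) : ℂ :=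
  (∏ j ∈ univ.erase k, bracket (z j / z k))⁻¹

/-- The sum over the residues at all `n`-tuples of nodes. -/
noncomputable def nodeSum {N n : ℕ} (z : Fin N → ℂ) (g : (Fin n → ℂ) → ℂ) : ℂ :=
  ∑ σ : Fin n → Fin N, (∏ l, nodeWeight z (σ l)) * g (z ∘ σ)

/-- The numerator common to all components. -/
noncomputable def prefactor {N : ℕ} (q : ℂ) (z : Fin N → ℂ) : ℂ :=
  pairProd fun i j => bracket (q * z j / z i) * bracket (q ^ 2 * z i * z j)

/-- The component of the vector at the sites `a`, as a sum over residues. -/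
noncomputable def amp {N n : ℕ} (q β : ℂ) (z : Fin N → ℂ) (a : Fin n → Fin N) : ℂ :=
  bracket q ^ n * prefactor q z * nodeSum z fun w =>
    pairProd (fun i j => pairFactor q (w i) (w j)) *
      ∏ l, (oneFactor q β z (w l) * siteFactor q z (a l) (w l))

/-! ### Exchange relations for adjacent parameters -/

section Exchange

variable {N n : ℕ} {q β : ℂ} {z : Fin N → ℂ} {i j : Fin N}

theorem nodeWeight_comp_perm (e : Equiv.Perm (Fin N)) (z : Fin N → ℂ) (k : Fin N) :
    nodeWeight (z ∘ e) k = nodeWeight z (e k) := by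
  unfold nodeWeight
  congr 1
  refine prod_equiv e ?_ ?_ <;> simp

theorem nodeSum_comp_perm (e : Equiv.Perm (Fin N)) (z : Fin N → ℂ) (g : (Fin n → ℂ) → ℂ) :
    nodeSum (z ∘ e) g = nodeSum z g := by
  unfold nodeSum
  refine Fintype.sum_equiv (Equiv.arrowCongr (Equiv.refl _) e) _ _ fun σ => ?_
  simp only [nodeWeight_comp_perm]
  rfl

theorem nodeSum_congr {g h : (Fin n → ℂ) → ℂ} (H : ∀ σ : Fin n → Fin N, g (z ∘ σ) = h (z ∘ σ)) :
    nodeSum z g = nodeSum z h := by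
  simp [nodeSum, H]

theorem nodeSum_add (g h : (Fin n → ℂ) → ℂ) :
    nodeSum z (fun w => g w + h w) = nodeSum z g + nodeSum z h := by
  simp [nodeSum, mul_add, sum_add_distrib]

theorem nodeSum_const_mul (c : ℂ) (g : (Fin n → ℂ) → ℂ) :
    nodeSum z (fun w => c * g w) = c * nodeSum z g := by
  simp only [nodeSum, mul_sum]
  exact sum_congr rfl fun σ _ => by ring

theorem oneFactor_comp_perm (e : Equiv.Perm (Fin N)) (u : ℂ) :
    oneFactor q β (z ∘ e) u = oneFactor q β z u := by
  unfold oneFactor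
  congr 1
  exact Equiv.prod_comp e fun j => bracket (q ^ 2 * u * z j)

/-- Only the factor of the pair `(i, j)` feels the exchange, and of its two brackets `[q² z_i z_j]`
is symmetric. -/
theorem prefactor_swap (hij : i.val + 1 = j.val) :
    bracket (q * z j / z i) * prefactor q (z ∘ Equiv.swap i j) =
      bracket (q * z i / z j) * prefactor q z := by
  obtain ⟨R, h1, h2⟩ := exists_pairProd_swap hij
    fun x y => bracket (q * z y / z x) * bracket (q ^ 2 * z x * z y)
  simp only [prefactor, Function.comp_apply]
  rw [h1, h2, show q ^ 2 * z j * z i = q ^ 2 * z i * z j by ring]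
  ring

theorem Ioi_eq_insert (hij : i.val + 1 = j.val) : Ioi i = insert j (Ioi j) := by
  ext x; simp only [mem_Ioi, mem_insert, Fin.lt_def, Fin.ext_iff]; omega

theorem Ici_eq_insert (j : Fin N) : Ici j = insert j (Ioi j) := by
  ext x; simp only [mem_Ici, mem_Ioi, mem_insert, Fin.lt_def, Fin.le_def, Fin.ext_iff]; omega

theorem prod_Ioi_adjacent (hij : i.val + 1 = j.val) (f : Fin N → ℂ) :
    ∏ x ∈ Ioi i, f x = f j * ∏ x ∈ Ioi j, f x := by
  rw [Ioi_eq_insert hij, prod_insert (by simp)]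

theorem prod_Ici_eq (j : Fin N) (f : Fin N → ℂ) :
    ∏ x ∈ Ici j, f x = f j * ∏ x ∈ Ioi j, f x := by
  rw [Ici_eq_insert, prod_insert (by simp)]

/-- The contribution to `siteFactor` of the sites to the right of `j`. -/
noncomputable def tailFactor (q : ℂ) (z : Fin N → ℂ) (j : Fin N) (u : ℂ) : ℂ :=
  (∏ x ∈ Ioi j, bracket (z x / u)) / ∏ x ∈ Ioi j, bracket (q * z x / u)

theorem siteFactor_eq (j : Fin N) (u : ℂ) :
    siteFactor q z j u = tailFactor q z j u / bracket (q * z j / u) := by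
  rw [siteFactor, tailFactor, prod_Ici_eq, div_div, mul_comm (bracket (q * z j / u))]

theorem siteFactor_eq_adjacent (hij : i.val + 1 = j.val) (u : ℂ) :
    siteFactor q z i u = tailFactor q z j u * bracket (z j / u) /
      (bracket (q * z i / u) * bracket (q * z j / u)) := by
  rw [siteFactor, tailFactor, prod_Ici_eq, prod_Ioi_adjacent hij, prod_Ioi_adjacent hij]
  rw [← mul_assoc, div_mul_eq_mul_div, div_div, mul_comm (bracket (z j / u)),
    mul_comm (∏ x ∈ Ioi j, bracket (q * z x / u))]

theorem tailFactor_swap (hij : i.val + 1 = j.val) (u : ℂ) :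
    tailFactor q (z ∘ Equiv.swap i j) j u = tailFactor q z j u := by
  have : ∀ x ∈ Ioi j, Equiv.swap i j x = x := by
    intro x hx
    have hx := mem_Ioi.1 hx
    refine Equiv.swap_apply_of_ne_of_ne ?_ hx.ne'
    rintro rfl
    rw [Fin.lt_def] at hx
    omega
  unfold tailFactor
  congr 1 <;> refine prod_congr rfl fun x hx => by simp [this x hx]

/-- The sites `i` and `j` are adjacent and differ from `a`, so both or neither lie to the right of
`a`. -/
theorem siteFactor_swap (hij : i.val + 1 = j.val) {a : Fin N} (hi : a ≠ i) (hj : a ≠ j) (u : ℂ) :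
    siteFactor q (z ∘ Equiv.swap i j) a u = siteFactor q z a u := by
  unfold siteFactor
  congr 1
  · refine prod_equiv (Equiv.swap i j) (fun x => ?_) fun x _ => rfl
    simp only [mem_Ioi, Equiv.swap_apply_def, Fin.lt_def, Fin.ext_iff, ne_eq] at *
    split_ifs <;> omega
  · refine prod_equiv (Equiv.swap i j) (fun x => ?_) fun x _ => rfl
    simp only [mem_Ici, Equiv.swap_apply_def, Fin.le_def, Fin.ext_iff, ne_eq] at *
    split_ifs <;> omega

theorem three_term_left {q x y u : ℂ} (hq : q ≠ 0) (hx : x ≠ 0) (hy : y ≠ 0) (hu : u ≠ 0) :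
    bracket (q * x / y) * bracket (x / u) =
      bracket q * bracket (y / u) + bracket (x / y) * bracket (q * x / u) := by
  unfold bracket
  field_simp
  ring

theorem three_term_right {q x y u : ℂ} (hq : q ≠ 0) (hx : x ≠ 0) (hy : y ≠ 0) (hu : u ≠ 0) :
    bracket (q * x / y) * bracket (q * y / u) =
      bracket q * bracket (q * x / u) + bracket (x / y) * bracket (y / u) := by
  unfold bracket
  field_simp
  ring

theorem IsRegular.q_div_ne (hz : IsRegular q z) (hq1 : bracket q ≠ 0) (i j : Fin N) :
    bracket (q * z i / z j) ≠ 0 := by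
  by_cases h : i = j
  · subst h
    rwa [mul_div_assoc, div_self (hz.ne_zero i), mul_one]
  · simpa using hz.div_ne 1 i j h

/-- Once the common tail to the right of `j` is split off, this is `three_term_left` at `u = z k`.
At the nodes regularity excludes vanishing denominators, and only values at nodes enter `nodeSum`.
-/
theorem siteFactor_exchange_left (hq : q ≠ 0) (hq1 : bracket q ≠ 0) (hz : IsRegular q z)
    (hij : i.val + 1 = j.val) (k : Fin N) :
    bracket (q * z i / z j) * siteFactor q (z ∘ Equiv.swap i j) i (z k) =
      bracket q * siteFactor q z i (z k) + bracket (z i / z j) * siteFactor q z j (z k) := by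
  have h := three_term_left hq (hz.ne_zero i) (hz.ne_zero j) (hz.ne_zero k)
  have hi := hz.q_div_ne hq1 i k
  have hj := hz.q_div_ne hq1 j k
  rw [siteFactor_eq_adjacent hij, siteFactor_eq_adjacent hij, tailFactor_swap hij, siteFactor_eq]
  simp only [Function.comp_apply, Equiv.swap_apply_left, Equiv.swap_apply_right]
  field_simp
  linear_combination tailFactor q z j (z k) * h

theorem siteFactor_exchange_right (hq : q ≠ 0) (hq1 : bracket q ≠ 0) (hz : IsRegular q z)
    (hij : i.val + 1 = j.val) (k : Fin N) :
    bracket (q * z i / z j) * siteFactor q (z ∘ Equiv.swap i j) j (z k) =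
      bracket q * siteFactor q z j (z k) + bracket (z i / z j) * siteFactor q z i (z k) := by
  have h := three_term_right hq (hz.ne_zero i) (hz.ne_zero j) (hz.ne_zero k)
  have hi := hz.q_div_ne hq1 i k
  have hj := hz.q_div_ne hq1 j k
  rw [siteFactor_eq_adjacent hij, siteFactor_eq, tailFactor_swap hij, siteFactor_eq]
  simp only [Function.comp_apply, Equiv.swap_apply_right]
  field_simp
  linear_combination tailFactor q z j (z k) * h

theorem IsRegular.comp_perm (hz : IsRegular q z) (e : Equiv.Perm (Fin N)) :
    IsRegular q (z ∘ e) :=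
  ⟨fun _ => hz.ne_zero _, fun k _ _ => hz.mul_ne k _ _,
    fun k _ _ h => hz.div_ne k _ _ (e.injective.ne h)⟩

variable {a : Fin n → Fin N}

/-- Both sites `i`, `j` up. -/
theorem amp_swap_up_up (hij : i.val + 1 = j.val) (ha : ∀ l, a l ≠ i ∧ a l ≠ j) :
    bracket (q * z j / z i) * amp q β (z ∘ Equiv.swap i j) a =
      bracket (q * z i / z j) * amp q β z a := by
  unfold amp
  rw [nodeSum_comp_perm]
  simp only [oneFactor_comp_perm, siteFactor_swap hij (ha _).1 (ha _).2]
  linear_combination (bracket q ^ n * nodeSum z fun w =>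
    pairProd (fun i j => pairFactor q (w i) (w j)) *
      ∏ l, (oneFactor q β z (w l) * siteFactor q z (a l) (w l))) * prefactor_swap (q := q) (z := z) hij

/-- A relation between site factors at one integration variable gives a relation between the
components. -/
theorem amp_swap_of_siteFactor (hij : i.val + 1 = j.val) {k : Fin n} {b : Fin N}
    (ha : ∀ l, l ≠ k → a l ≠ i ∧ a l ≠ j)
    (H : ∀ x, bracket (q * z i / z j) * siteFactor q (z ∘ Equiv.swap i j) (a k) (z x) =
      bracket q * siteFactor q z (a k) (z x) + bracket (z i / z j) * siteFactor q z b (z x)) :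
    bracket (q * z j / z i) * amp q β (z ∘ Equiv.swap i j) a =
      bracket q * amp q β z a + bracket (z i / z j) * amp q β z (Function.update a k b) := by
  have key : bracket (q * z i / z j) * nodeSum z (fun w =>
      pairProd (fun i j => pairFactor q (w i) (w j)) *
        ∏ l, (oneFactor q β (z ∘ Equiv.swap i j) (w l) *
          siteFactor q (z ∘ Equiv.swap i j) (a l) (w l))) =
      bracket q * nodeSum z (fun w => pairProd (fun i j => pairFactor q (w i) (w j)) *
        ∏ l, (oneFactor q β z (w l) * siteFactor q z (a l) (w l))) +
      bracket (z i / z j) * nodeSum z (fun w => pairProd (fun i j => pairFactor q (w i) (w j)) *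
        ∏ l, (oneFactor q β z (w l) * siteFactor q z (Function.update a k b l) (w l))) := by
    simp only [← nodeSum_const_mul]
    rw [← nodeSum_add]
    refine nodeSum_congr fun σ => ?_
    simp only [oneFactor_comp_perm]
    rw [← mul_prod_erase univ _ (mem_univ k), ← mul_prod_erase univ _ (mem_univ k),
      ← mul_prod_erase univ _ (mem_univ k)]
    have h1 : ∏ l ∈ univ.erase k, (oneFactor q β z ((z ∘ σ) l) *
        siteFactor q (z ∘ Equiv.swap i j) (a l) ((z ∘ σ) l)) =
        ∏ l ∈ univ.erase k, (oneFactor q β z ((z ∘ σ) l) * siteFactor q z (a l) ((z ∘ σ) l)) :=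
      prod_congr rfl fun l hl => by
        rw [siteFactor_swap hij (ha l (ne_of_mem_erase hl)).1 (ha l (ne_of_mem_erase hl)).2]
    have h2 : ∏ l ∈ univ.erase k, (oneFactor q β z ((z ∘ σ) l) *
        siteFactor q z (Function.update a k b l) ((z ∘ σ) l)) =
        ∏ l ∈ univ.erase k, (oneFactor q β z ((z ∘ σ) l) * siteFactor q z (a l) ((z ∘ σ) l)) :=
      prod_congr rfl fun l hl => by rw [Function.update_of_ne (ne_of_mem_erase hl)]
    rw [h1, h2, Function.update_self]
    have h := H (σ k)
    simp only [Function.comp_apply] at h ⊢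
    linear_combination (pairProd (fun i j => pairFactor q (z (σ i)) (z (σ j))) *
      oneFactor q β z (z (σ k)) * ∏ l ∈ univ.erase k, (oneFactor q β z (z (σ l)) *
        siteFactor q z (a l) (z (σ l)))) * h
  unfold amp
  rw [nodeSum_comp_perm]
  have hp := prefactor_swap (q := q) (z := z) hij
  generalize nodeSum z (fun w =>
      pairProd (fun i j => pairFactor q (w i) (w j)) *
        ∏ l, (oneFactor q β (z ∘ Equiv.swap i j) (w l) *
          siteFactor q (z ∘ Equiv.swap i j) (a l) (w l))) = S at key ⊢
  -- The prefactor turns `[q z_j / z_i]` into `[q z_i / z_j]`, the coefficient with which `key`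
  -- starts.
  linear_combination bracket q ^ n * S * hp + bracket q ^ n * prefactor q z * key

theorem amp_swap_down_up (hq : q ≠ 0) (hq1 : bracket q ≠ 0) (hz : IsRegular q z)
    (hij : i.val + 1 = j.val) {k : Fin n} (hk : a k = i)
    (ha : ∀ l, l ≠ k → a l ≠ i ∧ a l ≠ j) :
    bracket (q * z j / z i) * amp q β (z ∘ Equiv.swap i j) a =
      bracket q * amp q β z a + bracket (z i / z j) * amp q β z (Function.update a k j) := by
  refine amp_swap_of_siteFactor hij ha fun x => ?_
  rw [hk]
  exact siteFactor_exchange_left hq hq1 hz hij x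

theorem amp_swap_up_down (hq : q ≠ 0) (hq1 : bracket q ≠ 0) (hz : IsRegular q z)
    (hij : i.val + 1 = j.val) {k : Fin n} (hk : a k = j)
    (ha : ∀ l, l ≠ k → a l ≠ i ∧ a l ≠ j) :
    bracket (q * z j / z i) * amp q β (z ∘ Equiv.swap i j) a =
      bracket q * amp q β z a + bracket (z i / z j) * amp q β z (Function.update a k i) := by
  refine amp_swap_of_siteFactor hij ha fun x => ?_
  rw [hk]
  exact siteFactor_exchange_right hq hq1 hz hij x

theorem pairFactor_self (q x : ℂ) : pairFactor q x x = 0 := by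
  by_cases h : x = 0
  · simp [pairFactor, bracket, h]
  · simp [pairFactor, div_self h, bracket_one]

/-- Relabelling two summation variables preserves the node weights, so twice the sum is a sum of
zeros. -/
theorem nodeSum_eq_zero_of_antisymm {k k' : Fin n} (g : (Fin n → ℂ) → ℂ)
    (H : ∀ σ : Fin n → Fin N, g (z ∘ σ) + g ((z ∘ σ) ∘ Equiv.swap k k') = 0) :
    nodeSum z g = 0 := by
  have h : nodeSum z g = nodeSum z fun w => g (w ∘ Equiv.swap k k') := by
    unfold nodeSum
    refine Fintype.sum_equiv (Equiv.arrowCongr (Equiv.swap k k') (Equiv.refl _)) _ _ fun σ => ?_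
    have h1 : (Equiv.arrowCongr (Equiv.swap k k') (Equiv.refl _)) σ = σ ∘ Equiv.swap k k' := by
      ext; simp [Equiv.arrowCongr]
    rw [h1]
    congr 1
    · exact (Equiv.prod_comp (Equiv.swap k k') fun l => nodeWeight z (σ l)).symm
    · congr 1
      ext l
      simp
  have h2 : nodeSum z g + nodeSum z g = 0 := by
    nth_rewrite 2 [h]
    rw [← nodeSum_add]
    simp [nodeSum, H]
  simpa using h2

/-- With both sites down the summands are not invariant one by one; invariance appears only after
symmetrising over the two integration variables. In `pairFactor` the bracket `[x / y]` is
antisymmetric and the two product brackets are symmetric; `h0` states that what remains is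
symmetric. -/
theorem siteFactor_exchange_both (hq : q ≠ 0) (hq1 : bracket q ≠ 0) (hz : IsRegular q z)
    (hij : i.val + 1 = j.val) (x y : Fin N) :
    pairFactor q (z x) (z y) * (siteFactor q (z ∘ Equiv.swap i j) i (z x) *
          siteFactor q (z ∘ Equiv.swap i j) j (z y) -
        siteFactor q z i (z x) * siteFactor q z j (z y)) +
      pairFactor q (z y) (z x) * (siteFactor q (z ∘ Equiv.swap i j) i (z y) *
          siteFactor q (z ∘ Equiv.swap i j) j (z x) -
        siteFactor q z i (z y) * siteFactor q z j (z x)) = 0 := by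
  have hix := hz.q_div_ne hq1 i x
  have hjx := hz.q_div_ne hq1 j x
  have hiy := hz.q_div_ne hq1 i y
  have hjy := hz.q_div_ne hq1 j y
  simp only [siteFactor_eq_adjacent hij, tailFactor_swap hij, siteFactor_eq]
  simp only [Function.comp_apply, Equiv.swap_apply_left, Equiv.swap_apply_right]
  have h0 : bracket (q * z y / z x) * (bracket (z i / z x) * bracket (q * z j / z y) -
        bracket (z j / z x) * bracket (q * z i / z y)) =
      bracket (q * z x / z y) * (bracket (z i / z y) * bracket (q * z j / z x) -
        bracket (z j / z y) * bracket (q * z i / z x)) := by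
    have := hz.ne_zero i
    have := hz.ne_zero j
    have := hz.ne_zero x
    have := hz.ne_zero y
    unfold bracket
    field_simp
    ring
  unfold pairFactor
  rw [bracket_div_comm (z y) (z x), show q * z y * z x = q * z x * z y by ring,
    show q ^ 2 * z y * z x = q ^ 2 * z x * z y by ring]
  field_simp
  linear_combination (bracket (z x / z y) * bracket (q * z y * z x) *
    bracket (q ^ 2 * z y * z x) * tailFactor q z j (z x) * tailFactor q z j (z y)) * h0

/-- Both sites `i`, `j` down. -/
theorem amp_swap_down_down (hq : q ≠ 0) (hq1 : bracket q ≠ 0) (hz : IsRegular q z)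
    (hij : i.val + 1 = j.val) {k k' : Fin n} (hkk : k.val + 1 = k'.val) (hk : a k = i)
    (hk' : a k' = j) (ha : ∀ l, l ≠ k → l ≠ k' → a l ≠ i ∧ a l ≠ j) :
    bracket (q * z j / z i) * amp q β (z ∘ Equiv.swap i j) a =
      bracket (q * z i / z j) * amp q β z a := by
  have key : nodeSum z (fun w =>
      pairProd (fun i j => pairFactor q (w i) (w j)) *
        ∏ l, (oneFactor q β (z ∘ Equiv.swap i j) (w l) *
          siteFactor q (z ∘ Equiv.swap i j) (a l) (w l))) =
      nodeSum z (fun w => pairProd (fun i j => pairFactor q (w i) (w j)) *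
        ∏ l, (oneFactor q β z (w l) * siteFactor q z (a l) (w l))) := by
    rw [← sub_eq_zero, sub_eq_add_neg, ← neg_one_mul, ← nodeSum_const_mul, ← nodeSum_add]
    refine nodeSum_eq_zero_of_antisymm (k := k) (k' := k') _ fun σ => ?_
    have hne : k ≠ k' := by rintro rfl; omega
    have hsplit : ∀ f : Fin n → ℂ, ∏ l, f l = f k * f k' * ∏ l ∈ (univ.erase k).erase k', f l := by
      intro f
      rw [mul_assoc, mul_prod_erase _ _ (mem_erase.2 ⟨hne.symm, mem_univ k'⟩),
        mul_prod_erase _ _ (mem_univ k)]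
    have hrest : ∀ w : Fin n → ℂ, ∏ l ∈ (univ.erase k).erase k', (oneFactor q β z (w l) *
          siteFactor q (z ∘ Equiv.swap i j) (a l) (w l)) =
        ∏ l ∈ (univ.erase k).erase k', (oneFactor q β z (w l) * siteFactor q z (a l) (w l)) := by
      refine fun w => prod_congr rfl fun l hl => ?_
      simp only [mem_erase, mem_univ, and_true] at hl
      rw [siteFactor_swap hij (ha l hl.2 hl.1).1 (ha l hl.2 hl.1).2]
    have hrest' : ∏ l ∈ (univ.erase k).erase k', (oneFactor q β z (z (σ (Equiv.swap k k' l))) *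
          siteFactor q z (a l) (z (σ (Equiv.swap k k' l)))) =
        ∏ l ∈ (univ.erase k).erase k',
          (oneFactor q β z (z (σ l)) * siteFactor q z (a l) (z (σ l))) := by
      refine prod_congr rfl fun l hl => ?_
      simp only [mem_erase, mem_univ, and_true] at hl
      rw [Equiv.swap_apply_of_ne_of_ne hl.2 hl.1]
    obtain ⟨R, h1, h2⟩ := exists_pairProd_swap hkk fun x y => pairFactor q (z (σ x)) (z (σ y))
    simp only [oneFactor_comp_perm, hsplit, hrest, Function.comp_apply, Equiv.swap_apply_left,
      Equiv.swap_apply_right, hrest', h1, h2, hk, hk']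
    have h0 := siteFactor_exchange_both hq hq1 hz hij (σ k) (σ k')
    linear_combination (R * (oneFactor q β z (z (σ k)) * oneFactor q β z (z (σ k'))) *
      ∏ l ∈ (univ.erase k).erase k',
          (oneFactor q β z (z (σ l)) * siteFactor q z (a l) (z (σ l)))) * h0
  unfold amp
  rw [nodeSum_comp_perm, key]
  linear_combination (bracket q ^ n * nodeSum z fun w =>
    pairProd (fun i j => pairFactor q (w i) (w j)) *
      ∏ l, (oneFactor q β z (w l) * siteFactor q z (a l) (w l))) * prefactor_swap (q := q) (z := z) hij

end Exchange
end SixVertex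

namespace SixVertex

open Finset

/-! ### Reflection of the last parameter -/

section LastSite

variable {N n m : ℕ} {q β : ℂ}

theorem ne_zero_of_pow_three (hq3 : q ^ 3 = 1) : q ≠ 0 := by
  rintro rfl
  norm_num at hq3

/-- Since `q ^ 3 = 1`, the inverse of `q ^ k` is `q ^ (2 * k)`: inverting a variable stays within
brackets of the same kind. -/
theorem bracket_pow_inv_eq (hq3 : q ^ 3 = 1) (k : ℕ) (s : ℂ) :
    bracket (q ^ k * s⁻¹) = -bracket (q ^ (2 * k) * s) := by
  rw [← bracket_inv, mul_inv]
  congr 2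
  have h0 := ne_zero_of_pow_three hq3
  rw [← mul_eq_one_iff_eq_inv₀ (pow_ne_zero _ h0), ← pow_add, show k + 2 * k = 3 * k by ring, pow_mul,
    hq3, one_pow]

/-- Inverting one parameter interchanges the conditions on products and on quotients. As these are
imposed for every power of `q`, the passage from `k` to `2 * k` is harmless. -/
theorem IsRegular.update_inv {z : Fin N → ℂ} (hz : IsRegular q z) (hq3 : q ^ 3 = 1) (i : Fin N) :
    IsRegular q (Function.update z i (z i)⁻¹) := by
  have hm : ∀ k a b, bracket (q ^ k * (z a * z b)⁻¹) ≠ 0 := fun k a b => by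
    rw [bracket_pow_inv_eq hq3, neg_ne_zero, ← mul_assoc]
    exact hz.mul_ne _ _ _
  refine ⟨fun j => ?_, fun k a b => ?_, fun k a b hab => ?_⟩
  · by_cases h : j = i
    · subst h; simpa using hz.ne_zero j
    · simpa [h] using hz.ne_zero j
  · by_cases ha : a = i <;> by_cases hb : b = i
    · subst ha
      have := hm k a a
      rw [mul_inv, ← mul_assoc] at this
      simpa [hb] using this
    · subst ha
      have := hz.div_ne k b a hb
      simp only [Function.update_self, ne_eq, hb, not_false_eq_true, Function.update_of_ne]
      rwa [mul_right_comm, ← div_eq_mul_inv]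
    · subst hb
      have := hz.div_ne k a b ha
      simp only [Function.update_self, ne_eq, ha, not_false_eq_true, Function.update_of_ne]
      rwa [← div_eq_mul_inv]
    · simpa [ha, hb] using hz.mul_ne k a b
  · by_cases ha : a = i <;> by_cases hb : b = i
    · exact absurd (ha.trans hb.symm) hab
    · subst ha
      have := hm k a b
      rw [mul_inv, ← mul_assoc] at this
      simpa [hb, div_eq_mul_inv] using this
    · subst hb
      have := hz.mul_ne k a b
      simpa [ha, div_eq_mul_inv] using this
    · simpa [ha, hb] using hz.div_ne k a b hab

theorem prod_erase_castSucc (f : Fin (N + 1) → ℂ) (k : Fin N) :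
    ∏ j ∈ univ.erase k.castSucc, f j = (∏ j ∈ univ.erase k, f j.castSucc) * f (Fin.last N) := by
  rw [Fin.univ_castSuccEmb, erase_cons_of_ne _ (Fin.castSucc_lt_last k).ne', prod_cons, mul_comm]
  congr 1
  rw [← Fin.coe_castSuccEmb, ← map_erase, prod_map]

theorem prod_erase_last (f : Fin (N + 1) → ℂ) :
    ∏ j ∈ univ.erase (Fin.last N), f j = ∏ j, f (Fin.castSucc j) := by
  rw [Fin.univ_castSuccEmb, erase_cons, prod_map]
  rfl

theorem Ioi_castSucc_eq (k : Fin N) :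
    Ioi k.castSucc = cons (Fin.last N) ((Ioi k).map Fin.castSuccEmb) (by simp) := by
  ext x
  induction x using Fin.lastCases <;> simp [Fin.castSucc_lt_last, Fin.le_last]

theorem Ici_castSucc_eq (k : Fin N) :
    Ici k.castSucc = cons (Fin.last N) ((Ici k).map Fin.castSuccEmb) (by simp) := by
  ext x
  induction x using Fin.lastCases <;> simp [Fin.le_last]

theorem prod_Ioi_castSucc (f : Fin (N + 1) → ℂ) (k : Fin N) :
    ∏ j ∈ Ioi k.castSucc, f j = (∏ j ∈ Ioi k, f j.castSucc) * f (Fin.last N) := by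
  rw [Ioi_castSucc_eq, prod_cons, prod_map, mul_comm]
  rfl

theorem prod_Ici_castSucc (f : Fin (N + 1) → ℂ) (k : Fin N) :
    ∏ j ∈ Ici k.castSucc, f j = (∏ j ∈ Ici k, f j.castSucc) * f (Fin.last N) := by
  rw [Ici_castSucc_eq, prod_cons, prod_map, mul_comm]
  rfl

theorem pairProd_castSucc (f : Fin (n + 1) → Fin (n + 1) → ℂ) :
    pairProd f = pairProd (fun i j => f i.castSucc j.castSucc) *
      ∏ i : Fin n, f i.castSucc (Fin.last n) := by
  unfold pairProd
  rw [Fin.prod_univ_castSucc]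
  have : (Ioi (Fin.last n)) = ∅ := by ext x; simp [Fin.le_last]
  simp [this, prod_Ioi_castSucc, prod_mul_distrib]

/-- Appending the parameter `y` to `x`. -/
abbrev snocParam (x : Fin N → ℂ) (y : ℂ) : Fin (N + 1) → ℂ := Fin.snoc (α := fun _ => ℂ) x y

theorem nodeWeight_snoc_castSucc (x : Fin N → ℂ) (y : ℂ) (k : Fin N) :
    nodeWeight (snocParam x y) k.castSucc = nodeWeight x k * (bracket (y / x k))⁻¹ := by
  simp [nodeWeight, prod_erase_castSucc, mul_comm]

theorem nodeWeight_snoc_last (x : Fin N → ℂ) (y : ℂ) :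
    nodeWeight (snocParam x y) (Fin.last N) = (∏ j, bracket (x j / y))⁻¹ := by
  simp [nodeWeight, prod_erase_last]

theorem siteFactor_snoc_castSucc (x : Fin N → ℂ) (y : ℂ) (k : Fin N) (u : ℂ) :
    siteFactor q (snocParam x y) k.castSucc u =
      siteFactor q x k u * (bracket (y / u) / bracket (q * y / u)) := by
  simp [siteFactor, prod_Ioi_castSucc, prod_Ici_castSucc, div_mul_div_comm]

theorem siteFactor_snoc_last (x : Fin N → ℂ) (y u : ℂ) :
    siteFactor q (snocParam x y) (Fin.last N) u = (bracket (q * y / u))⁻¹ := by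
  have h1 : (Ioi (Fin.last N)) = ∅ := by ext x; simp [Fin.le_last]
  have h2 : (Ici (Fin.last N)) = {Fin.last N} := by ext x; simp
  simp [siteFactor, h1, h2]

theorem oneFactor_snoc (x : Fin N → ℂ) (y u : ℂ) :
    oneFactor q β (snocParam x y) u = oneFactor q β x u / bracket (q ^ 2 * u * y) := by
  simp [oneFactor, Fin.prod_univ_castSucc, div_div]

theorem prefactor_snoc (x : Fin N → ℂ) (y : ℂ) :
    prefactor q (snocParam x y) =
      prefactor q x * ∏ i, (bracket (q * y / x i) * bracket (q ^ 2 * x i * y)) := by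
  simp [prefactor, pairProd_castSucc]

/-- Each bracket becomes the negative of the other one under `y ↦ y⁻¹`, and the two signs cancel. -/
theorem bracket_pair_inv (hq3 : q ^ 3 = 1) (y u : ℂ) :
    bracket (q * y⁻¹ / u) * bracket (q ^ 2 * u * y⁻¹) =
      bracket (q * y / u) * bracket (q ^ 2 * u * y) := by
  have h1 := bracket_pow_inv_eq hq3 1 (y * u)
  have h2 := bracket_pow_inv_eq hq3 2 (y / u)
  have e1 : q ^ 1 * (y * u)⁻¹ = q * y⁻¹ / u := by
    rw [mul_inv, pow_one, div_eq_mul_inv, mul_assoc]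
  have e2 : q ^ 2 * (y / u)⁻¹ = q ^ 2 * u * y⁻¹ := by
    rw [inv_div, div_eq_mul_inv, mul_assoc]
  have e3 : q ^ (2 * 1) * (y * u) = q ^ 2 * u * y := by ring
  have e4 : q ^ (2 * 2) * (y / u) = q * y / u := by
    rw [show q ^ (2 * 2) = q ^ 3 * q by ring, hq3]; ring
  rw [e1, e3] at h1
  rw [e2, e4] at h2
  rw [h1, h2]
  ring

theorem prefactor_snoc_inv (hq3 : q ^ 3 = 1) (x : Fin N → ℂ) (y : ℂ) :
    prefactor q (snocParam x y⁻¹) = prefactor q (snocParam x y) := by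
  simp only [prefactor_snoc, bracket_pair_inv hq3]

/-- The numerator contains `[z_k / z_k]`. Hence the variable of a down spin at the site `a` only
visits nodes `z k` with `k ≤ a`; this triangularity drives all evaluations below. -/
theorem siteFactor_eq_zero {z : Fin N → ℂ} {a k : Fin N} (hz : z k ≠ 0) (h : a < k) :
    siteFactor q z a (z k) = 0 := by
  unfold siteFactor
  rw [prod_eq_zero (mem_Ioi.2 h) (by rw [div_self hz, bracket_one]), zero_div]

/-- The zero `[y / x_k]` of the site factor cancels the same bracket in the node weight, so `y`
survives only in the combination that `bracket_pair_inv` shows to be invariant. -/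
theorem nodeTerm_snoc_castSucc {x : Fin N → ℂ} {y : ℂ} (hz : IsRegular q (snocParam x y))
    (b k : Fin N) :
    nodeWeight (snocParam x y) k.castSucc * (oneFactor q β (snocParam x y) (x k) *
        siteFactor q (snocParam x y) b.castSucc (x k)) =
      nodeWeight x k * (oneFactor q β x (x k) * siteFactor q x b (x k) *
        (bracket (q * y / x k) * bracket (q ^ 2 * x k * y))⁻¹) := by
  have h1 := hz.div_ne 0 (Fin.last N) k.castSucc (Fin.castSucc_lt_last _).ne'
  simp only [pow_zero, one_mul, Fin.snoc_last, Fin.snoc_castSucc] at h1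
  rw [nodeWeight_snoc_castSucc, siteFactor_snoc_castSucc, oneFactor_snoc, mul_inv,
    div_eq_mul_inv (oneFactor q β x (x k)), div_eq_mul_inv (bracket (y / x k))]
  linear_combination (nodeWeight x k * oneFactor q β x (x k) *
    siteFactor q x b (x k) * (bracket (q * y / x k))⁻¹ *
    (bracket (q ^ 2 * x k * y))⁻¹) * mul_inv_cancel₀ h1

/-- If no down spin sits at the last site, then only the other nodes contribute. -/
theorem nodeSum_snoc_castSucc (x : Fin N → ℂ) (y : ℂ) (hz : IsRegular q (snocParam x y))
    (b : Fin n → Fin N) (G : (Fin n → ℂ) → ℂ) :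
    (nodeSum (snocParam x y) fun w => G w * ∏ l, (oneFactor q β (snocParam x y) (w l) *
        siteFactor q (snocParam x y) (b l).castSucc (w l))) =
      nodeSum x fun w => G w * ∏ l, (oneFactor q β x (w l) * siteFactor q x (b l) (w l) *
        (bracket (q * y / w l) * bracket (q ^ 2 * w l * y))⁻¹) := by
  unfold nodeSum
  symm
  refine Fintype.sum_of_injective (fun (τ : Fin n → Fin N) l => (τ l).castSucc) ?_ _ _ ?_ ?_
  · intro τ τ' h
    ext l
    have := congrFun h l
    simpa [Fin.ext_iff] using this
  · intro σ hσ
    obtain ⟨l, hl⟩ : ∃ l, σ l = Fin.last N := by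
      by_contra! h
      exact hσ ⟨fun l => (σ l).castPred (h l), by ext l; simp⟩
    refine mul_eq_zero_of_right _ (mul_eq_zero_of_right _ (prod_eq_zero (mem_univ l) ?_))
    rw [Function.comp_apply, siteFactor_eq_zero (hz.ne_zero _), mul_zero]
    rw [hl]
    exact Fin.castSucc_lt_last _
  · intro τ
    have hsn : (snocParam x y ∘ fun l => (τ l).castSucc) = x ∘ τ := by ext l; simp
    simp only [hsn]
    rw [mul_left_comm, mul_left_comm (∏ l, nodeWeight (snocParam x y) (τ l).castSucc),
      ← prod_mul_distrib, ← prod_mul_distrib]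
    congr 1
    exact prod_congr rfl fun l _ => (nodeTerm_snoc_castSucc hz _ _).symm

theorem amp_snoc_castSucc (x : Fin N → ℂ) (y : ℂ) (hz : IsRegular q (snocParam x y))
    (b : Fin n → Fin N) :
    amp q β (snocParam x y) (fun l => (b l).castSucc) =
      bracket q ^ n * prefactor q (snocParam x y) * nodeSum x fun w =>
        pairProd (fun i j => pairFactor q (w i) (w j)) *
          ∏ l, (oneFactor q β x (w l) * siteFactor q x (b l) (w l) *
            (bracket (q * y / w l) * bracket (q ^ 2 * w l * y))⁻¹) := by
  rw [amp, nodeSum_snoc_castSucc x y hz b]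

/-- In `amp_snoc_castSucc` the last parameter occurs only in the prefactor and in bracket pairs, all
invariant under its inversion. -/
theorem amp_reflect_last_up (hq3 : q ^ 3 = 1) (x : Fin N → ℂ) (y : ℂ)
    (hz : IsRegular q (snocParam x y)) (hz' : IsRegular q (snocParam x y⁻¹)) (b : Fin n → Fin N) :
    amp q β (snocParam x y⁻¹) (fun l => (b l).castSucc) =
      amp q β (snocParam x y) (fun l => (b l).castSucc) := by
  rw [amp_snoc_castSucc _ _ hz, amp_snoc_castSucc _ _ hz', prefactor_snoc_inv hq3]
  simp only [bracket_pair_inv hq3]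

/-- If the last down spin sits at the last site, then only its integration variable can be the
last node. -/
theorem nodeSum_snoc_last (x : Fin N → ℂ) (y : ℂ) (hz : IsRegular q (snocParam x y))
    (b : Fin m → Fin N) (G : (Fin (m + 1) → ℂ) → ℂ) :
    (nodeSum (snocParam x y) fun w => G w * ∏ l, (oneFactor q β (snocParam x y) (w l) *
        siteFactor q (snocParam x y) (Fin.snoc (α := fun _ => Fin (N + 1))
          (fun l => (b l).castSucc) (Fin.last N) l) (w l))) =
      nodeSum x fun w =>
        (∏ l, (oneFactor q β x (w l) * siteFactor q x (b l) (w l) *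
          (bracket (q * y / w l) * bracket (q ^ 2 * w l * y))⁻¹)) *
        ∑ k, nodeWeight (snocParam x y) k * oneFactor q β (snocParam x y) (snocParam x y k) *
          (bracket (q * y / snocParam x y k))⁻¹ * G (snocParam w (snocParam x y k)) := by
  unfold nodeSum
  symm
  simp only [mul_sum]
  rw [← sum_product']
  refine Fintype.sum_of_injective (fun (p : (Fin m → Fin N) × Fin (N + 1)) =>
    Fin.snoc (α := fun _ => Fin (N + 1)) (fun l => (p.1 l).castSucc) p.2) ?_ _ _ ?_ ?_
  · rintro ⟨τ, k⟩ ⟨τ', k'⟩ h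
    simp only at h
    rw [Fin.snoc_inj] at h
    refine Prod.ext ?_ h.2
    ext l
    have := congrFun h.1 l
    simpa [Fin.ext_iff] using this
  · intro σ hσ
    obtain ⟨l, hl⟩ : ∃ l : Fin m, σ l.castSucc = Fin.last N := by
      by_contra! h
      refine hσ ⟨(fun l => (σ l.castSucc).castPred (h l), σ (Fin.last m)), ?_⟩
      ext l
      induction l using Fin.lastCases <;> simp
    refine mul_eq_zero_of_right _ (mul_eq_zero_of_right _ (prod_eq_zero (mem_univ l.castSucc) ?_))
    rw [Function.comp_apply, siteFactor_eq_zero (hz.ne_zero _), mul_zero]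
    rw [hl, Fin.snoc_castSucc]
    exact Fin.castSucc_lt_last _
  · rintro ⟨τ, k⟩
    have hsn : snocParam x y ∘ Fin.snoc (α := fun _ => Fin (N + 1)) (fun l => (τ l).castSucc) k =
        snocParam (x ∘ τ) (snocParam x y k) := by
      ext l
      induction l using Fin.lastCases <;> simp
    simp only [hsn, Fin.prod_univ_castSucc, Function.comp_apply, Fin.snoc_castSucc,
      Fin.snoc_last]
    have key : (∏ l, nodeWeight (snocParam x y) (τ l).castSucc) *
        ∏ l, (oneFactor q β (snocParam x y) (x (τ l)) *
          siteFactor q (snocParam x y) (b l).castSucc (x (τ l))) =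
        (∏ l, nodeWeight x (τ l)) * ∏ l, (oneFactor q β x (x (τ l)) *
          siteFactor q x (b l) (x (τ l)) *
            (bracket (q * y / x (τ l)) * bracket (q ^ 2 * x (τ l) * y))⁻¹) := by
      rw [← prod_mul_distrib, ← prod_mul_distrib]
      exact prod_congr rfl fun l _ => nodeTerm_snoc_castSucc hz _ _
    rw [siteFactor_snoc_last]
    linear_combination (-G (snocParam (x ∘ τ) (snocParam x y k)) *
      nodeWeight (snocParam x y) k *
      oneFactor q β (snocParam x y) (snocParam x y k) * (bracket (q * y / snocParam x y k))⁻¹) * key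

/-- Apart from invariant factors, the dependence on `y` is concentrated in the inner sum over the
position `k` of the last integration variable, later called `lastSum`. -/
theorem amp_snoc_last (x : Fin N → ℂ) (y : ℂ) (hz : IsRegular q (snocParam x y))
    (b : Fin m → Fin N) :
    amp q β (snocParam x y) (Fin.snoc (α := fun _ => Fin (N + 1)) (fun l => (b l).castSucc)
        (Fin.last N)) =
      bracket q ^ (m + 1) * prefactor q (snocParam x y) * nodeSum x fun w =>
        pairProd (fun i j => pairFactor q (w i) (w j)) *
          (∏ l, (oneFactor q β x (w l) * siteFactor q x (b l) (w l) *
            (bracket (q * y / w l) * bracket (q ^ 2 * w l * y))⁻¹)) *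
          ∑ k, nodeWeight (snocParam x y) k * oneFactor q β (snocParam x y) (snocParam x y k) *
            (bracket (q * y / snocParam x y k))⁻¹ *
            ∏ i, pairFactor q (w i) (snocParam x y k) := by
  rw [amp, nodeSum_snoc_last x y hz b]
  congr 1
  refine nodeSum_congr fun σ => ?_
  simp only [pairProd_castSucc, Fin.snoc_castSucc, Fin.snoc_last, mul_sum]
  exact sum_congr rfl fun k _ => by ring

end LastSite
end SixVertex

namespace SixVertex

open Finset

/-! ### Reflection of the last parameter when the last site is down -/

section LastSite

variable {N n m : ℕ} {q β : ℂ}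

theorem sum_prod_sub_div_prod_sub_eq_zero' {ι κ : Type*} [DecidableEq ι] (s : Finset ι)
    (t : Finset κ) (x : ι → ℂ) (y : κ → ℂ) (hx : Set.InjOn x s) (hst : t.card + 2 ≤ s.card) :
    ∑ i ∈ s, (∏ k ∈ t, (y k - x i)) / ∏ j ∈ s.erase i, (x j - x i) = 0 := by
  have h := sum_prod_sub_div_prod_sub_eq_zero s t (fun i => -x i) (fun k => -y k)
    (fun a ha b hb hab => hx ha hb (neg_injective hab)) hst
  simpa only [neg_sub_neg] using h

/-- The Lagrange identity with two distinguished nodes. -/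
theorem sum_two_extra_nodes {κ : Type*} (t : Finset κ) (X : Fin N → ℂ) (Y : κ → ℂ) (A B : ℂ)
    (hX : Function.Injective X) (hA : ∀ i, X i ≠ A) (hB : ∀ i, X i ≠ B) (hAB : A ≠ B)
    (ht : t.card ≤ N) :
    ∑ i, (∏ k ∈ t, (Y k - X i)) / ((∏ j ∈ univ.erase i, (X j - X i)) * (A - X i) * (B - X i)) +
      (∏ k ∈ t, (Y k - A)) / ((∏ j, (X j - A)) * (B - A)) +
      (∏ k ∈ t, (Y k - B)) / ((∏ j, (X j - B)) * (A - B)) = 0 := by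
  have h := sum_prod_sub_div_prod_sub_eq_zero' (univ : Finset (Fin (N + 2))) t
    (snocParam (snocParam X A) B) Y ?_ (by simpa using ht)
  · rw [Fin.sum_univ_castSucc, Fin.sum_univ_castSucc] at h
    simpa only [prod_erase_last, prod_erase_castSucc, Fin.snoc_castSucc, Fin.snoc_last,
      Fin.prod_univ_castSucc] using h
  · refine Function.Injective.injOn fun a b => ?_
    induction a using Fin.lastCases with
    | last =>
      induction b using Fin.lastCases with
      | last => simp
      | cast b =>
        induction b using Fin.lastCases with
        | last => simpa using fun h => (hAB h.symm).elim
        | cast b => simpa using fun h => (hB b h.symm).elim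
    | cast a =>
      induction b using Fin.lastCases with
      | last =>
        induction a using Fin.lastCases with
        | last => simpa using fun h => (hAB h).elim
        | cast a => simpa using fun h => (hB a h).elim
      | cast b =>
        induction a using Fin.lastCases with
        | last =>
          induction b using Fin.lastCases with
          | last => simp
          | cast b => simpa using fun h => (hA b h.symm).elim
        | cast a =>
          induction b using Fin.lastCases with
          | last => simpa using fun h => (hA a h).elim
          | cast b => simpa using fun h => hX h

/-- The four brackets group as `[w/u][q²wu]` and `[qu/w][qwu]`, each a difference of values of
`quadVar q` because `q⁻¹ = q ^ 2`. So `pairFactor` is quadratic in `quadVar q u`, with zeros at `w`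
and `w / q`. -/
theorem quadVar_sub_eq_pairFactor (hq3 : q ^ 3 = 1) {w u : ℂ} (hw : w ≠ 0) (hu : u ≠ 0) :
    pairFactor q w u = -((quadVar q w - quadVar q u) * (quadVar q (w / q) - quadVar q u)) := by
  have hq := ne_zero_of_pow_three hq3
  have h1 := bracket_mul_bracket_eq q u w hq hu hw
  have h2 := bracket_mul_bracket_eq q u (w / q) hq hu (div_ne_zero hw hq)
  have e1 : u * w / q = q ^ 2 * w * u := by
    rw [div_eq_iff hq]; linear_combination (-(u * w)) * hq3
  have e2 : u / (w / q) = q * u / w := by rw [div_div_eq_mul_div, mul_comm]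
  have e3 : u * (w / q) / q = q * w * u := by
    rw [div_eq_iff hq, ← mul_div_assoc, div_eq_iff hq]; linear_combination (-(u * w)) * hq3
  rw [e1] at h1
  rw [e2, e3] at h2
  rw [pairFactor, bracket_div_comm w u]
  linear_combination (-bracket (q * u / w) * bracket (q * w * u)) * h1 -
    (quadVar q u - quadVar q w) * h2

theorem quadVar_sub (hq3 : q ^ 3 = 1) {w u : ℂ} (hw : w ≠ 0) (hu : u ≠ 0) :
    quadVar q w - quadVar q u = bracket (w / u) * bracket (q ^ 2 * u * w) := by
  have hq := ne_zero_of_pow_three hq3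
  rw [← bracket_mul_bracket_eq q w u hq hw hu]
  congr 2
  rw [div_eq_iff hq]
  linear_combination (-(u * w)) * hq3

/-- The sum over the last integration variable when the last site is down. -/
noncomputable def lastSum (q β : ℂ) (x : Fin N → ℂ) (w : Fin m → ℂ) (y : ℂ) : ℂ :=
  ∑ k, nodeWeight (snocParam x y) k * oneFactor q β (snocParam x y) (snocParam x y k) *
    (bracket (q * y / snocParam x y k))⁻¹ * ∏ i, pairFactor q (w i) (snocParam x y k)

/-- With both brackets `[βu]` and `[qβ/u]` present the product has degree `2 * m + 1` in `quadVar q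
u`. Only `[βu]` occurs in `lastSum`; the second one is what the reflection relation contributes. -/
theorem prod_quadVar_nodes (hq3 : q ^ 3 = 1) (hβ : β ≠ 0) (w : Fin m → ℂ) (hw : ∀ i, w i ≠ 0)
    {u : ℂ} (hu : u ≠ 0) :
    (∏ i, pairFactor q (w i) u) * (bracket (β * u) * bracket (q * β / u)) = (-1) ^ m *
      ∏ t : Option (Fin m ⊕ Fin m), (Option.elim t (quadVar q β⁻¹)
        (Sum.elim (fun i => quadVar q (w i)) fun i => quadVar q (w i / q)) - quadVar q u) := by
  have hq := ne_zero_of_pow_three hq3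
  rw [Fintype.prod_option, Fintype.prod_sum_type]
  simp only [Option.elim_none, Option.elim_some, Sum.elim_inl, Sum.elim_inr,
    quadVar_sub_eq_pairFactor hq3 (hw _) hu, prod_neg, prod_mul_distrib, card_univ,
    Fintype.card_fin]
  have h1 : quadVar q β⁻¹ - quadVar q u = bracket (β * u) * bracket (q * β / u) := by
    rw [← neg_sub, ← bracket_mul_bracket_eq q u β⁻¹ hq hu (inv_ne_zero hβ), div_inv_eq_mul,
      mul_comm u β, ← mul_neg]
    congr 1
    rw [← bracket_inv, inv_div, ← div_eq_mul_inv, div_div_eq_mul_div]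
  rw [h1]
  ring

theorem bracket_q_inv_div (hq3 : q ^ 3 = 1) (y u : ℂ) :
    bracket (q * y⁻¹ / u) = -bracket (q ^ 2 * u * y) := by
  have h1 := bracket_pow_inv_eq hq3 1 (y * u)
  have e1 : q ^ 1 * (y * u)⁻¹ = q * y⁻¹ / u := by
    rw [mul_inv, pow_one, div_eq_mul_inv, mul_assoc]
  have e3 : q ^ (2 * 1) * (y * u) = q ^ 2 * u * y := by ring
  rwa [e1, e3] at h1

theorem bracket_sq (hq3 : q ^ 3 = 1) : bracket (q ^ 2) = -bracket q := by
  have := bracket_pow_inv_eq hq3 2 1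
  rw [inv_one, mul_one, mul_one, show q ^ (2 * 2) = q ^ 3 * q by ring, hq3, one_mul] at this
  exact this

/-- The numerator `[q²u²]` of `oneFactor` cancels the denominator factor belonging to the node
itself; the node weight and the other denominators pair up to differences of `quadVar q`. -/
theorem lastSum_eq (hq3 : q ^ 3 = 1) {x : Fin N → ℂ} {y : ℂ}
    (hz : IsRegular q (snocParam x y)) (w : Fin m → ℂ) :
    lastSum q β x w y = ∑ k, bracket (β * x k) * (∏ i, pairFactor q (w i) (x k)) /
      ((∏ j ∈ univ.erase k, (quadVar q (x j) - quadVar q (x k))) *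
        (quadVar q y - quadVar q (x k)) * bracket (q * y / x k)) +
      bracket (β * y) * (∏ i, pairFactor q (w i) y) /
        ((∏ j, (quadVar q (x j) - quadVar q y)) * bracket q) := by
  have hx0 : ∀ k, x k ≠ 0 := fun k => by simpa using hz.ne_zero k.castSucc
  have hy0 : y ≠ 0 := by simpa using hz.ne_zero (Fin.last N)
  unfold lastSum
  rw [Fin.sum_univ_castSucc]
  congr 1
  · refine sum_congr rfl fun k _ => ?_
    have hk : bracket (q ^ 2 * x k * x k) ≠ 0 := by
      simpa using hz.mul_ne 2 k.castSucc k.castSucc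
    simp only [Fin.snoc_castSucc]
    rw [nodeWeight_snoc_castSucc, oneFactor_snoc, nodeWeight, oneFactor,
      ← mul_prod_erase univ _ (mem_univ k), quadVar_sub hq3 hy0 (hx0 k)]
    simp only [quadVar_sub hq3 (hx0 _) (hx0 k), prod_mul_distrib]
    rw [mul_div_mul_left _ _ hk]
    simp only [div_eq_mul_inv, mul_inv]
    ring
  · have hy : bracket (q ^ 2 * y * y) ≠ 0 := by
      simpa using hz.mul_ne 2 (Fin.last N) (Fin.last N)
    simp only [Fin.snoc_last]
    rw [nodeWeight_snoc_last, oneFactor_snoc, oneFactor, mul_div_cancel_right₀ _ hy0]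
    simp only [quadVar_sub hq3 (hx0 _) hy0, prod_mul_distrib]
    simp only [div_eq_mul_inv, mul_inv]
    linear_combination ((∏ j, bracket (x j * y⁻¹))⁻¹ * bracket (β * y) *
      (∏ j, bracket (q ^ 2 * y * x j))⁻¹ * (bracket q)⁻¹ * ∏ i, pairFactor q (w i) y) *
      mul_inv_cancel₀ hy

/-- The difference of the two sides is, up to a nonzero factor, the Lagrange sum over the nodes `x
k`, `y` and `y⁻¹` in the variable `quadVar q`. The degree `2 * m + 1` against `N + 2` nodes is where
`hm` enters. -/
theorem lastSum_reflect (hq1 : bracket q ≠ 0) (hq3 : q ^ 3 = 1) (hβ : β ≠ 0) {x : Fin N → ℂ}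
    {y : ℂ} (hz : IsRegular q (snocParam x y)) (hz' : IsRegular q (snocParam x y⁻¹))
    (w : Fin m → ℂ) (hw : ∀ i, w i ≠ 0) (hm : 2 * m + 1 ≤ N) :
    bracket (q * β * y) * lastSum q β x w y⁻¹ = bracket (q * β / y) * lastSum q β x w y := by
  have hq := ne_zero_of_pow_three hq3
  have hx0 : ∀ k, x k ≠ 0 := fun k => by simpa using hz.ne_zero k.castSucc
  have hy0 : y ≠ 0 := by simpa using hz.ne_zero (Fin.last N)
  have hne : ∀ {u v : ℂ}, bracket (u / v) ≠ 0 → bracket (q ^ 2 * v * u) ≠ 0 → u ≠ 0 → v ≠ 0 →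
      quadVar q u - quadVar q v ≠ 0 := fun h1 h2 h3 h4 => by
    rw [quadVar_sub hq3 h3 h4]
    exact mul_ne_zero h1 h2
  have hXX : ∀ i j, i ≠ j → quadVar q (x i) - quadVar q (x j) ≠ 0 := fun i j hij =>
    hne (by simpa using hz.div_ne 0 i.castSucc j.castSucc (by simpa using hij))
      (by simpa using hz.mul_ne 2 j.castSucc i.castSucc) (hx0 i) (hx0 j)
  have hA : ∀ i, quadVar q y - quadVar q (x i) ≠ 0 := fun i =>
    hne (by simpa using hz.div_ne 0 (Fin.last N) i.castSucc (Fin.castSucc_lt_last _).ne')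
      (by simpa using hz.mul_ne 2 i.castSucc (Fin.last N)) hy0 (hx0 i)
  have hB : ∀ i, quadVar q y⁻¹ - quadVar q (x i) ≠ 0 := fun i =>
    hne (by simpa using hz'.div_ne 0 (Fin.last N) i.castSucc (Fin.castSucc_lt_last _).ne')
      (by simpa using hz'.mul_ne 2 i.castSucc (Fin.last N)) (inv_ne_zero hy0) (hx0 i)
  have hy2 : bracket (y * y) ≠ 0 := by simpa using hz.mul_ne 0 (Fin.last N) (Fin.last N)
  have hAB : quadVar q y - quadVar q y⁻¹ = -(bracket (y * y) * bracket q) := by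
    rw [quadVar_sub hq3 hy0 (inv_ne_zero hy0), inv_mul_cancel_right₀ hy0, bracket_sq hq3,
      div_inv_eq_mul, mul_neg]
  have hL := sum_two_extra_nodes (univ : Finset (Option (Fin m ⊕ Fin m))) (fun i => quadVar q (x i))
    (fun t => Option.elim t (quadVar q β⁻¹)
        (Sum.elim (fun i => quadVar q (w i)) fun i => quadVar q (w i / q)))
    (quadVar q y) (quadVar q y⁻¹) (fun i j h => by
      by_contra hij
      exact hXX i j hij (sub_eq_zero.2 h)) (fun i h => hA i (sub_eq_zero.2 h.symm))
    (fun i h => hB i (sub_eq_zero.2 h.symm)) (by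
      rw [← sub_ne_zero, hAB]
      exact neg_ne_zero.2 (mul_ne_zero hy2 hq1)) (by simp; omega)
  have hP : ∀ u, u ≠ 0 → ∏ t : Option (Fin m ⊕ Fin m), (Option.elim t (quadVar q β⁻¹)
        (Sum.elim (fun i => quadVar q (w i)) fun i => quadVar q (w i / q)) - quadVar q u) =
      (-1) ^ m * ((∏ i, pairFactor q (w i) u) * (bracket (β * u) * bracket (q * β / u))) := by
    intro u hu
    rw [prod_quadVar_nodes hq3 hβ w hw hu, ← mul_assoc, ← mul_pow]
    simp
  simp only [hP _ (hx0 _), hP _ hy0, hP _ (inv_ne_zero hy0)] at hL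
  rw [hAB, ← neg_sub (quadVar q y) (quadVar q y⁻¹), hAB, neg_neg] at hL
  rw [lastSum_eq hq3 hz, lastSum_eq hq3 hz', mul_add, mul_add, mul_sum, mul_sum]
  -- At a common node `x k` the two sides differ by a multiple of the Lagrange summand; the
  -- three-term identity `hcore` creates the missing bracket `[qβ/x_k]`.
  have hterm : ∀ k, bracket (q * β * y) * (bracket (β * x k) * (∏ i, pairFactor q (w i) (x k)) /
      ((∏ j ∈ univ.erase k, (quadVar q (x j) - quadVar q (x k))) *
        (quadVar q y⁻¹ - quadVar q (x k)) * bracket (q * y⁻¹ / x k))) =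
      bracket (q * β / y) * (bracket (β * x k) * (∏ i, pairFactor q (w i) (x k)) /
      ((∏ j ∈ univ.erase k, (quadVar q (x j) - quadVar q (x k))) *
        (quadVar q y - quadVar q (x k)) * bracket (q * y / x k))) -
      bracket (y * y) * (-1) ^ m * ((-1) ^ m * ((∏ i, pairFactor q (w i) (x k)) *
        (bracket (β * x k) * bracket (q * β / x k))) /
        ((∏ j ∈ univ.erase k, (quadVar q (x j) - quadVar q (x k))) *
        (quadVar q y - quadVar q (x k)) * (quadVar q y⁻¹ - quadVar q (x k)))) := by
    intro k
    have hD : ∏ j ∈ univ.erase k, (quadVar q (x j) - quadVar q (x k)) ≠ 0 :=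
      prod_ne_zero_iff.2 fun j hj => hXX j k (ne_of_mem_erase hj)
    have hA' := quadVar_sub hq3 hy0 (hx0 k)
    have hB' := quadVar_sub hq3 (inv_ne_zero hy0) (hx0 k)
    have e1 := bracket_q_inv_div hq3 y (x k)
    have e2 := bracket_q_inv_div hq3 y⁻¹ (x k)
    rw [inv_inv] at e2
    have hcore : bracket (q * β * y) * bracket (y / x k) -
        bracket (q * β / y) * bracket (y⁻¹ / x k) = bracket (y * y) * bracket (q * β / x k) := by
      have := hx0 k
      unfold bracket
      field_simp
      ring
    have nA := hA k
    have nB := hB k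
    have hs : ((-1 : ℂ) ^ m) * (-1) ^ m = 1 := by rw [← mul_pow]; simp
    rw [hA'] at nA ⊢
    rw [hB'] at nB ⊢
    rw [e1, e2]
    obtain ⟨na, nb⟩ := mul_ne_zero_iff.1 nA
    obtain ⟨nc, nd⟩ := mul_ne_zero_iff.1 nB
    generalize bracket (q ^ 2 * x k * y) = b at *
    generalize bracket (q ^ 2 * x k * y⁻¹) = d at *
    generalize bracket (y / x k) = a at *
    generalize bracket (y⁻¹ / x k) = c at *
    generalize ((-1 : ℂ) ^ m) = s at *
    generalize (∏ j ∈ univ.erase k, (quadVar q (x j) - quadVar q (x k))) = D at *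
    generalize (∏ i, pairFactor q (w i) (x k)) = P at *
    generalize bracket (β * x k) = f at *
    generalize bracket (q * β / x k) = g at *
    generalize bracket (y * y) = r at *
    generalize bracket (q * β * y) = s1 at *
    generalize bracket (q * β / y) = s2 at *
    have hsum : s1 * (f * P / (D * (c * d) * -b)) - (s2 * (f * P / (D * (a * b) * -d)) -
        r * s * (s * (P * (f * g)) / (D * (a * b) * (c * d)))) =
        f * P / (D * a * b * c * d) * (-(s1 * a) + s2 * c + s * s * r * g) := by
      field_simp
      ring
    rw [← sub_eq_zero, hsum, hs]
    linear_combination (-(f * P / (D * a * b * c * d))) * hcore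
  simp only [hterm, sum_sub_distrib, ← mul_sum]
  have hs : ((-1 : ℂ) ^ m) * (-1) ^ m = 1 := by rw [← mul_pow]; simp
  have hU : ∀ s f P g D r t : ℂ, s * (P * (f * g)) / (D * (r * t)) =
      s * g * (f * P / (D * t)) / r := fun s f P g D r t => by
    simp only [div_eq_mul_inv, mul_inv]; ring
  rw [div_inv_eq_mul, ← neg_mul, hU, hU] at hL
  -- The Lagrange summands at `y` and `y⁻¹` are, up to a common factor and the sign `s`, the
  -- contributions of the last node to the two sides.
  have aux : ∀ S1 S2 U U' s g1 g2 r : ℂ, S2 + s * g2 * U / r + s * g1 * U' / -r = 0 →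
      s * s = 1 → r ≠ 0 → g2 * S1 - r * s * S2 + g1 * U' = g2 * S1 + g2 * U := by
    intro S1 S2 U U' s g1 g2 r h hs hr
    field_simp at h
    linear_combination (-s) * h + (g2 * U - g1 * U') * hs
  exact aux _ _ _ _ _ _ _ _ hL hs hy2

/-- Reflection of the last parameter when the last site is down. -/
theorem amp_reflect_last_down (hq1 : bracket q ≠ 0) (hq3 : q ^ 3 = 1) (hβ : β ≠ 0) (x : Fin N → ℂ)
    (y : ℂ) (hz : IsRegular q (snocParam x y)) (hz' : IsRegular q (snocParam x y⁻¹))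
    (hm : 2 * m + 1 ≤ N) (b : Fin m → Fin N) :
    bracket (q * β * y) * amp q β (snocParam x y⁻¹)
        (Fin.snoc (α := fun _ => Fin (N + 1)) (fun l => (b l).castSucc) (Fin.last N)) =
      bracket (q * β / y) * amp q β (snocParam x y)
        (Fin.snoc (α := fun _ => Fin (N + 1)) (fun l => (b l).castSucc) (Fin.last N)) := by
  rw [amp_snoc_last _ _ hz, amp_snoc_last _ _ hz', prefactor_snoc_inv hq3]
  simp only [bracket_pair_inv hq3]
  rw [mul_left_comm, mul_left_comm (bracket (q * β / y))]
  congr 1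
  rw [← nodeSum_const_mul, ← nodeSum_const_mul]
  refine nodeSum_congr fun σ => ?_
  rw [mul_left_comm, mul_left_comm (bracket (q * β / y))]
  congr 1
  exact lastSum_reflect hq1 hq3 hβ hz hz' (x ∘ σ) (fun i => by
    simpa using hz.ne_zero (σ i).castSucc) hm

end LastSite
end SixVertex

namespace SixVertex

open Finset

/-! ### The component with all down spins to the left -/

section Product

variable {N n : ℕ} {q β : ℂ} {z : Fin N → ℂ}

theorem prod_erase_eq_pairProd (f : Fin N → Fin N → ℂ) :
    ∏ i, ∏ j ∈ univ.erase i, f i j = pairProd fun i j => f i j * f j i := by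
  have h : ∀ i : Fin N, univ.erase i = Iio i ∪ Ioi i := fun i => by
    ext j; simp [lt_or_lt_iff_ne]
  have hd : ∀ i : Fin N, Disjoint (Iio i) (Ioi i) := fun i => by
    rw [disjoint_left]; intro j; simp only [mem_Iio, mem_Ioi]; exact fun h => not_lt.2 h.le
  simp only [h, prod_union (hd _), prod_mul_distrib, pairProd]
  rw [mul_comm]
  congr 1
  exact prod_comm' (by simp)

theorem prod_castLE (h : n ≤ N) (f : Fin N → ℂ) :
    ∏ l : Fin n, f (Fin.castLE h l) = ∏ i : Fin N, if i.val < n then f i else 1 := by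
  rw [← prod_filter]
  refine prod_bij (fun l _ => Fin.castLE h l) (by simp) (by simp) (fun i hi => ?_) (by simp)
  exact ⟨⟨i, by simpa using hi⟩, by simp, by ext; simp⟩

theorem pairProd_castLE (h : n ≤ N) (f : Fin N → Fin N → ℂ) :
    pairProd (fun i j : Fin n => f (Fin.castLE h i) (Fin.castLE h j)) =
      pairProd fun i j => if j.val < n then f i j else 1 := by
  rw [pairProd_eq_prod_filter, pairProd_eq_prod_filter, ← prod_filter, filter_filter]
  refine prod_bij (fun p _ => (Fin.castLE h p.1, Fin.castLE h p.2)) ?_ ?_ ?_ (by simp)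
  · rintro ⟨i, j⟩ hp
    simpa using hp
  · rintro ⟨i, j⟩ _ ⟨i', j'⟩ _ hp
    rw [Prod.mk.injEq] at hp ⊢
    exact ⟨Fin.castLE_injective h hp.1, Fin.castLE_injective h hp.2⟩
  · rintro ⟨i, j⟩ hp
    simp only [mem_filter, mem_univ, true_and] at hp
    refine ⟨(⟨i, lt_trans (Fin.lt_def.1 hp.1) hp.2⟩, ⟨j, hp.2⟩), ?_, by ext <;> simp⟩
    exact mem_filter.2 ⟨mem_univ _, Fin.lt_def.2 (Fin.lt_def.1 hp.1)⟩

/-- By strong induction all smaller values are already taken. This is what makes the triangular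
residue sum collapse to one term. -/
theorem eq_of_injective_of_le {σ : Fin n → ℕ} (hσ : Function.Injective σ) (h : ∀ l, σ l ≤ l.val)
    (l : Fin n) : σ l = l.val := by
  obtain ⟨l, hl⟩ := l
  induction l using Nat.strong_induction_on with
  | _ l ih =>
    rcases (h ⟨l, hl⟩).lt_or_eq with hlt | heq
    · have h1 := ih _ hlt (lt_trans hlt hl)
      have h2 := congrArg Fin.val (hσ h1)
      simp only at h2 hlt
      omega
    · exact heq

theorem pairProd_eq_zero {f : Fin n → Fin n → ℂ} {i j : Fin n} (hij : i < j) (h : f i j = 0) :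
    pairProd f = 0 :=
  prod_eq_zero (mem_univ i) (prod_eq_zero (mem_Ioi.2 hij) h)

theorem pairProd_pairFactor_eq_zero {w : Fin n → ℂ} (hw : ¬Function.Injective w) :
    pairProd (fun i j => pairFactor q (w i) (w j)) = 0 := by
  simp only [Function.Injective, not_forall] at hw
  obtain ⟨i, j, h, hij⟩ := hw
  rcases lt_or_gt_of_ne hij with hlt | hlt
  · exact pairProd_eq_zero hlt (by rw [h, pairFactor_self])
  · exact pairProd_eq_zero hlt (by rw [h, pairFactor_self])

/-- The value of the component whose down spins are the `n` leftmost ones. -/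
noncomputable def leftProduct (q β : ℂ) (z : Fin N → ℂ) (n : ℕ) : ℂ :=
  (∏ i : Fin N, if i.val < n then bracket (β * z i) else 1) *
    pairProd fun i j =>
      if j.val < n then bracket (q * z j / z i) * bracket (q * z i * z j)
      else if i.val < n then 1 else bracket (q * z j / z i) * bracket (q ^ 2 * z i * z j)

/-- The component with all down spins to the left has a product form. -/
theorem amp_castLE (hq1 : bracket q ≠ 0) (hz : IsRegular q z) (h : n ≤ N) :
    amp q β z (Fin.castLE h) = leftProduct q β z n := by
  have hsum : nodeSum z (fun w => pairProd (fun i j => pairFactor q (w i) (w j)) *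
      ∏ l, (oneFactor q β z (w l) * siteFactor q z (Fin.castLE h l) (w l))) =
      (∏ l : Fin n, nodeWeight z (Fin.castLE h l)) *
        (pairProd (fun i j : Fin n => pairFactor q (z (Fin.castLE h i)) (z (Fin.castLE h j))) *
        ∏ l : Fin n, (oneFactor q β z (z (Fin.castLE h l)) *
          siteFactor q z (Fin.castLE h l) (z (Fin.castLE h l)))) := by
    unfold nodeSum
    rw [sum_eq_single (Fin.castLE h)]
    · rfl
    -- A tuple of nodes other than the identity either repeats a node, which `pairFactor`
    -- annihilates, or has `l < σ l` for some `l`, which the site factor annihilates.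
    · intro σ _ hσ
      by_cases hinj : Function.Injective σ
      · obtain ⟨l, hl⟩ : ∃ l, Fin.castLE h l < σ l := by
          by_contra! hle
          refine hσ (funext fun l => Fin.ext ?_)
          exact eq_of_injective_of_le (σ := fun l => (σ l).val)
            (fun a b hab => hinj (Fin.ext hab)) (fun l => Fin.le_def.1 (hle l)) l
        refine mul_eq_zero_of_right _ (mul_eq_zero_of_right _ (prod_eq_zero (mem_univ l) ?_))
        rw [Function.comp_apply, siteFactor_eq_zero (hz.ne_zero _) hl, mul_zero]
      · refine mul_eq_zero_of_right _ (mul_eq_zero_of_left (pairProd_pairFactor_eq_zero ?_) _)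
        exact fun hi => hinj (Function.Injective.of_comp hi)
    · simp
  rw [amp, hsum, prod_mul_distrib, prod_castLE h (nodeWeight z),
    prod_castLE h (fun i => oneFactor q β z (z i)),
    prod_castLE h (fun i => siteFactor q z i (z i)),
    pairProd_castLE h fun i j => pairFactor q (z i) (z j)]
  -- All one-variable products are distributed over the pairs `i < j`, so that the claim can be
  -- checked pair by pair according to how many of `i`, `j` are less than `n`.
  have e1 : ∏ i : Fin N, (if i.val < n then nodeWeight z i else 1) =
      pairProd fun i j => (if i.val < n then (bracket (z j / z i))⁻¹ else 1) *
        (if j.val < n then (bracket (z i / z j))⁻¹ else 1) := by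
    rw [← prod_erase_eq_pairProd fun i j => if i.val < n then (bracket (z j / z i))⁻¹ else 1]
    refine prod_congr rfl fun i _ => ?_
    split_ifs
    · simp [nodeWeight]
    · simp
  have e2 : ∏ i : Fin N, (if i.val < n then oneFactor q β z (z i) else 1) =
      (∏ i : Fin N, if i.val < n then bracket (β * z i) else 1) *
      pairProd fun i j => (if i.val < n then (bracket (q ^ 2 * z i * z j))⁻¹ else 1) *
        (if j.val < n then (bracket (q ^ 2 * z j * z i))⁻¹ else 1) := by
    rw [← prod_erase_eq_pairProd fun i j => if i.val < n then (bracket (q ^ 2 * z i * z j))⁻¹ else 1,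
      ← prod_mul_distrib]
    refine prod_congr rfl fun i _ => ?_
    split_ifs
    · rw [oneFactor, ← mul_prod_erase univ _ (mem_univ i), mul_div_mul_left _ _ (hz.mul_ne 2 i i),
        prod_inv_distrib, div_eq_mul_inv]
    · simp
  have e3 : ∏ i : Fin N, (if i.val < n then siteFactor q z i (z i) else 1) =
      (bracket q ^ n)⁻¹ * pairProd fun i j =>
        if i.val < n then bracket (z j / z i) / bracket (q * z j / z i) else 1 := by
    have : (bracket q ^ n)⁻¹ = ∏ i : Fin N, if i.val < n then (bracket q)⁻¹ else 1 := by
      rw [← prod_castLE h]; simp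
    rw [this, pairProd, ← prod_mul_distrib]
    refine prod_congr rfl fun i _ => ?_
    split_ifs
    · rw [siteFactor, prod_Ici_eq, prod_div_distrib, mul_div_assoc, div_self (hz.ne_zero i), mul_one,
        div_eq_mul_inv, mul_inv, div_eq_mul_inv]
      ring
    · simp
  rw [e1, e2, e3, prefactor, leftProduct]
  have hn := pow_ne_zero n hq1
  have comb : ∀ (A B P1 P2 P3 P4 P5 : ℂ), A ≠ 0 →
      A * P1 * (P2 * (P3 * (B * P4 * (A⁻¹ * P5)))) = B * (P1 * P2 * P3 * P4 * P5) := by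
    intros; field_simp
  rw [comb _ _ _ _ _ _ _ hn]
  congr 1
  simp only [← pairProd_mul]
  unfold pairProd
  refine prod_congr rfl fun i _ => prod_congr rfl fun j hj => ?_
  have hij := mem_Ioi.1 hj
  have hlt := Fin.lt_def.1 hij
  have d1 : bracket (z j / z i) ≠ 0 := by simpa using hz.div_ne 0 j i hij.ne'
  have d2 : bracket (z i / z j) ≠ 0 := by simpa using hz.div_ne 0 i j hij.ne
  have d3 := hz.q_div_ne hq1 j i
  have d4 := hz.mul_ne 2 i j
  beta_reduce
  rw [show q ^ 2 * z j * z i = q ^ 2 * z i * z j by ring]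
  unfold pairFactor
  generalize bracket (q ^ 2 * z i * z j) = b4 at *
  generalize bracket (q * z i * z j) = b5 at *
  generalize bracket (q * z j / z i) = b3 at *
  generalize bracket (z i / z j) = b2 at *
  generalize bracket (z j / z i) = b1 at *
  by_cases hj' : j.val < n
  · have hi' : i.val < n := by omega
    simp only [hj', hi', if_true]
    field_simp
  · by_cases hi' : i.val < n
    · simp only [hj', hi', if_true, if_false]
      field_simp
    · simp only [hj', hi', if_false]
      ring

end Product
end SixVertex

namespace SixVertex

open Finset

/-! ### Components with one up spin among the leftmost sites -/

section OneUp

variable {N n : ℕ} {q β : ℂ} {z : Fin N → ℂ}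

theorem pairProd_ite_right (c : Fin N) (g : Fin N → ℂ) :
    pairProd (fun i j => if j = c then g i else 1) = ∏ i ∈ Iio c, g i := by
  unfold pairProd
  simp only [prod_ite_eq', mem_Ioi]
  rw [← prod_filter]
  exact prod_congr (by ext; simp) fun _ _ => rfl

theorem pairProd_ite_left (c : Fin N) (g : Fin N → ℂ) :
    pairProd (fun i j => if i = c then g j else 1) = ∏ j ∈ Ioi c, g j := by
  unfold pairProd
  rw [prod_eq_single c]
  · simp
  · intro b _ hb
    simp [hb]
  · simp

/-- Passing from `n` to `n + 1` changes only the factors of the pairs containing the site `c`. This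
converts `amp_castLE` into the base case of `amp_skipSite`. -/
theorem leftProduct_succ (c : Fin N) :
    leftProduct q β z c.val * (bracket (β * z c) *
        ∏ i ∈ Iio c, (bracket (q * z c / z i) * bracket (q * z i * z c))) =
      leftProduct q β z (c.val + 1) *
        ∏ j ∈ Ioi c, (bracket (q * z j / z c) * bracket (q ^ 2 * z c * z j)) := by
  unfold leftProduct
  rw [← pairProd_ite_right c, ← pairProd_ite_left c]
  have h1 : ∏ i : Fin N, (if i.val < c.val + 1 then bracket (β * z i) else 1) =
      (∏ i : Fin N, if i.val < c.val then bracket (β * z i) else 1) * bracket (β * z c) := by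
    have : bracket (β * z c) = ∏ i : Fin N, if i = c then bracket (β * z i) else 1 := by simp
    rw [this, ← prod_mul_distrib]
    refine prod_congr rfl fun i _ => ?_
    by_cases hi : i = c
    · subst hi; simp
    · have : i.val ≠ c.val := fun h => hi (Fin.ext h)
      by_cases h2 : i.val < c.val
      · simp [hi, h2, h2.trans]
      · simp [hi, h2, show ¬ i.val < c.val + 1 by omega]
  rw [h1, mul_mul_mul_comm, ← pairProd_mul, mul_assoc _ (pairProd _) (pairProd _), ← pairProd_mul]
  congr 1
  unfold pairProd
  refine prod_congr rfl fun i _ => prod_congr rfl fun j hj => ?_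
  have hlt := Fin.lt_def.1 (mem_Ioi.1 hj)
  beta_reduce
  rcases lt_trichotomy j c with h | h | h
  · have := Fin.lt_def.1 h
    simp [h.ne, show i ≠ c from fun e => by subst e; omega, this,
      show j.val < c.val + 1 by omega]
  · subst h
    simp [show i ≠ j from fun e => by subst e; omega, hlt]
  · have h' := Fin.lt_def.1 h
    rcases lt_trichotomy i c with g | g | g
    · have g' := Fin.lt_def.1 g
      simp [h.ne', g.ne, show ¬ j.val < c.val by omega, show ¬ j.val < c.val + 1 by omega, g',
        show i.val < c.val + 1 by omega]
    · subst g
      simp [h.ne', show ¬ j.val < i.val by omega, show ¬ j.val < i.val + 1 by omega]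
    · have g' := Fin.lt_def.1 g
      simp [h.ne', g.ne', show ¬ j.val < c.val by omega, show ¬ j.val < c.val + 1 by omega,
        show ¬ i.val < c.val by omega, show ¬ i.val < c.val + 1 by omega]

/-- The sites `0, …, n` with the site `p` left out. -/
def skipSite (h : n < N) (p : ℕ) : Fin n → Fin N := fun l =>
  ⟨if l.val < p then l.val else l.val + 1, by split_ifs <;> omega⟩

/-- The first `n + 1` parameters. -/
def headParam (h : n < N) (z : Fin N → ℂ) : Fin (n + 1) → ℂ := fun l => z (Fin.castLE h l)

/-- The contribution of the parameters beyond the first `n + 1`. -/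
noncomputable def tailFun (q β : ℂ) (z : Fin N → ℂ) (n : ℕ) (u : ℂ) : ℂ :=
  (∏ j ∈ univ.filter (fun j : Fin N => n < j.val),
    (bracket (q * z j / u) * bracket (q ^ 2 * u * z j))) / bracket (β * u)

/-- The weight of the parameter `y k` of the up spin among the down spins. -/
noncomputable def upWeight (q : ℂ) (y : Fin (n + 1) → ℂ) (k : Fin (n + 1)) : ℂ :=
  (∏ j ∈ univ.erase k,
    (bracket (y k / y j) * bracket (q * y k / y j) * bracket (q * y j * y k)))⁻¹

/-- The dependence on the position of the up spin among the down spins. -/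
noncomputable def upFactor (q : ℂ) (y : Fin (n + 1) → ℂ) (p : ℕ) (u : ℂ) : ℂ :=
  ∏ i, if i.val < p then bracket (u / y i) else if i.val = p then 1 else bracket (q * u / y i)

/-- The sum over the parameter attached to an up spin at the site `p` among `n` down spins. -/
noncomputable def upSum (q β : ℂ) (h : n < N) (z : Fin N → ℂ) (p : ℕ) : ℂ :=
  ∑ k, tailFun q β z n (headParam h z k) * upWeight q (headParam h z) k *
    upFactor q (headParam h z) p (headParam h z k)

theorem upWeight_comp_perm (e : Equiv.Perm (Fin (n + 1))) (y : Fin (n + 1) → ℂ)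
    (k : Fin (n + 1)) : upWeight q (y ∘ e) k = upWeight q y (e k) := by
  unfold upWeight
  congr 1
  refine prod_equiv e ?_ ?_ <;> simp

theorem prod_Iio_eq (h : n < N) (g : Fin N → ℂ) :
    ∏ i ∈ Iio (⟨n, h⟩ : Fin N), g i = ∏ l : Fin n, g (Fin.castLE h.le l) := by
  rw [prod_castLE, ← prod_filter]
  exact prod_congr (by ext; simp [Fin.lt_def]) fun _ _ => rfl

/-- For `p = n` every summand of `upSum` with `k < n` contains `[y_k / y_k] = 0`; the remaining one
is the ratio of products supplied by `leftProduct_succ`. -/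
theorem amp_skipSite_last (hq1 : bracket q ≠ 0) (hz : IsRegular q z) (h : n < N)
    (hβ : ∀ i, bracket (β * z i) ≠ 0) :
    amp q β z (skipSite h n) = leftProduct q β z (n + 1) * upSum q β h z n := by
  have h1 : skipSite h n = Fin.castLE h.le := by
    ext l; simp [skipSite, l.2]
  have h2 : upSum q β h z n = tailFun q β z n (z ⟨n, h⟩) *
      (∏ i ∈ Iio (⟨n, h⟩ : Fin N), (bracket (q * z ⟨n, h⟩ / z i) *
        bracket (q * z i * z ⟨n, h⟩)))⁻¹ := by
    unfold upSum
    have hlast : headParam h z (Fin.last n) = z ⟨n, h⟩ := rfl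
    rw [sum_eq_single (Fin.last n), hlast]
    · rw [mul_assoc]
      congr 1
      rw [upWeight, upFactor, prod_erase_last, Fin.prod_univ_castSucc]
      simp only [Fin.val_castSucc, Fin.is_lt, if_true, Fin.val_last, lt_irrefl, if_false, mul_one,
        hlast]
      have h3 : ∀ i : Fin n, bracket (z ⟨n, h⟩ / headParam h z i.castSucc) ≠ 0 := fun i => by
        have : (⟨n, h⟩ : Fin N) ≠ Fin.castLE h i.castSucc := fun e => by
          have := congrArg Fin.val e
          simp at this
          omega
        have h0 := hz.div_ne 0 _ _ this
        rwa [pow_zero, one_mul] at h0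
      rw [prod_Iio_eq h]
      simp only [prod_mul_distrib, mul_inv, mul_assoc]
      have h6 : ∏ i : Fin n, bracket (z ⟨n, h⟩ / headParam h z i.castSucc) ≠ 0 :=
        prod_ne_zero_iff.2 fun i _ => h3 i
      rw [mul_comm, mul_assoc, mul_assoc, mul_inv_cancel₀ h6, mul_one]
      rfl
    · intro k _ hk
      refine mul_eq_zero_of_right _ (prod_eq_zero (mem_univ k) ?_)
      have hk' : k.val < n := by
        have := k.2
        have : k.val ≠ n := fun e => hk (Fin.ext e)
        omega
      rw [if_pos hk', div_self (show headParam h z k ≠ 0 from hz.ne_zero _), bracket_one]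
    · simp
  have h4 := leftProduct_succ (q := q) (β := β) (z := z) ⟨n, h⟩
  have hne : ∏ i ∈ Iio (⟨n, h⟩ : Fin N), (bracket (q * z ⟨n, h⟩ / z i) *
        bracket (q * z i * z ⟨n, h⟩)) ≠ 0 :=
    prod_ne_zero_iff.2 fun i _ => mul_ne_zero (hz.q_div_ne hq1 _ _) (by simpa using hz.mul_ne 1 i ⟨n, h⟩)
  have h5 : univ.filter (fun j : Fin N => n < j.val) = Ioi ⟨n, h⟩ := by
    ext j; simp [Fin.lt_def]
  rw [h1, amp_castLE hq1 hz, h2, tailFun, h5]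
  have := hβ ⟨n, h⟩
  simp only at h4
  generalize leftProduct q β z n = A at *
  generalize leftProduct q β z (n + 1) = B at *
  generalize bracket (β * z ⟨n, h⟩) = b at *
  generalize ∏ i ∈ Iio (⟨n, h⟩ : Fin N), (bracket (q * z ⟨n, h⟩ / z i) *
    bracket (q * z i * z ⟨n, h⟩)) = C at *
  generalize ∏ j ∈ Ioi (⟨n, h⟩ : Fin N), (bracket (q * z j / z ⟨n, h⟩) *
    bracket (q ^ 2 * z ⟨n, h⟩ * z j)) = D at *
  field_simp
  linear_combination h4

/-- Both sites lie among the first `n + 1`, so only the bracket `[q z_j / z_i]` is not symmetric.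
`leftProduct` thus drops out of the exchange relation, which becomes a relation for `upSum` alone.
-/
theorem leftProduct_swap {i j : Fin N} (hij : i.val + 1 = j.val) (hj : j.val ≤ n) :
    bracket (q * z j / z i) * leftProduct q β (z ∘ Equiv.swap i j) (n + 1) =
      bracket (q * z i / z j) * leftProduct q β z (n + 1) := by
  have hsw : ∀ x : Fin N, (Equiv.swap i j x).val < n + 1 ↔ x.val < n + 1 := fun x => by
    simp only [Equiv.swap_apply_def, Fin.ext_iff]
    split_ifs <;> omega
  obtain ⟨R, h1, h2⟩ := exists_pairProd_swap hij fun x y =>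
      if y.val < n + 1 then bracket (q * z y / z x) * bracket (q * z x * z y)
      else if x.val < n + 1 then 1 else bracket (q * z y / z x) * bracket (q ^ 2 * z x * z y)
  have h3 : ∏ x : Fin N, (if x.val < n + 1 then bracket (β * z (Equiv.swap i j x)) else 1) =
      ∏ x : Fin N, if x.val < n + 1 then bracket (β * z x) else 1 := by
    have := Equiv.prod_comp (M := ℂ) (Equiv.swap i j) fun x : Fin N =>
      if x.val < n + 1 then bracket (β * z x) else 1
    simpa only [hsw] using this
  simp only [hsw, show j.val < n + 1 by omega, show i.val < n + 1 by omega, if_true] at h1 h2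
  unfold leftProduct
  simp only [Function.comp_apply]
  rw [h3, h1, h2, show q * z j * z i = q * z i * z j by ring]
  ring

/-- Only the factors at `i` and `j` change, and they satisfy a three-term identity of the same form
as the exchange relation for a down and an up spin. -/
theorem upFactor_step (hq : q ≠ 0) {y : Fin (n + 1) → ℂ} (hy : ∀ i, y i ≠ 0) {i j : Fin (n + 1)}
    (hij : i.val + 1 = j.val) {u : ℂ} (hu : u ≠ 0) :
    bracket (q * y i / y j) * upFactor q (y ∘ Equiv.swap i j) (i.val + 1) u =
      bracket q * upFactor q y (i.val + 1) u + bracket (y i / y j) * upFactor q y i.val u := by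
  have hne : j ≠ i := by rintro rfl; omega
  have hsplit : ∀ f : Fin (n + 1) → ℂ,
      ∏ l, f l = f i * f j * ∏ l ∈ (univ.erase i).erase j, f l := by
    intro f
    rw [mul_assoc, mul_prod_erase _ _ (mem_erase.2 ⟨hne, mem_univ j⟩),
      mul_prod_erase _ _ (mem_univ i)]
  have hrest : ∀ y' : Fin (n + 1) → ℂ, (∀ l, l ≠ i → l ≠ j → y' l = y l) →
      ∏ l ∈ (univ.erase i).erase j, (if l.val < i.val + 1 then bracket (u / y' l) else
        if l.val = i.val + 1 then 1 else bracket (q * u / y' l)) =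
      ∏ l ∈ (univ.erase i).erase j, (if l.val < i.val then bracket (u / y l) else
        if l.val = i.val then 1 else bracket (q * u / y l)) := by
    intro y' h
    refine prod_congr rfl fun l hl => ?_
    simp only [mem_erase, mem_univ, and_true] at hl
    have h1 : l.val ≠ i.val := fun e => hl.2 (Fin.ext e)
    have h2 : l.val ≠ i.val + 1 := fun e => hl.1 (Fin.ext (e.trans hij))
    rw [h l hl.2 hl.1]
    by_cases h3 : l.val < i.val
    · simp [h3, show l.val < i.val + 1 by omega]
    · simp [h3, h1, h2, show ¬ l.val < i.val + 1 by omega]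
  unfold upFactor
  rw [hsplit, hsplit, hsplit, hrest (y ∘ Equiv.swap i j) fun l hi hj => by
    simp [Equiv.swap_apply_of_ne_of_ne hi hj], hrest y fun _ _ _ => rfl]
  simp only [← hij, Function.comp_apply, Equiv.swap_apply_left, Equiv.swap_apply_right,
    lt_irrefl, if_true, if_false, Nat.lt_succ_self, show ¬ i.val + 1 < i.val by omega,
    show i.val + 1 ≠ i.val by omega]
  have hcore : bracket (q * y i / y j) * bracket (u / y j) =
      bracket q * bracket (u / y i) + bracket (y i / y j) * bracket (q * u / y j) := by
    have := hy i
    have := hy j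
    unfold bracket
    field_simp
    ring
  linear_combination (∏ l ∈ (univ.erase i).erase j, (if l.val < i.val then bracket (u / y l) else
        if l.val = i.val then 1 else bracket (q * u / y l))) * hcore

/-- The components with one up spin among the `n + 1` leftmost spins. -/
theorem amp_skipSite (hq : q ≠ 0) (hq1 : bracket q ≠ 0) (hz : IsRegular q z) (h : n < N)
    (hβ : ∀ i, bracket (β * z i) ≠ 0) (p : ℕ) (hp : p ≤ n) :
    amp q β z (skipSite h p) = leftProduct q β z (n + 1) * upSum q β h z p := by
  -- The exchange relation at the sites `p`, `p + 1` determines the component with the up spin at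
  -- `p` from the one with the up spin at `p + 1`, for `z` and for the exchanged parameters; hence
  -- the generalisation over `z`.
  induction hp using Nat.decreasingInduction generalizing z with
  | self => exact amp_skipSite_last hq1 hz h hβ
  | of_succ p hp ih =>
    have hp : p < n := hp
    set i : Fin N := ⟨p, by omega⟩ with hi
    set j : Fin N := ⟨p + 1, by omega⟩ with hj
    have hij : i.val + 1 = j.val := rfl
    have hex := amp_swap_down_up (β := β) (a := skipSite h (p + 1)) (k := ⟨p, hp⟩) hq hq1 hz hij
      (by ext; simp [skipSite, hi]) (fun l hl => by
        have hl' : l.val ≠ p := fun e => hl (Fin.ext e)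
        simp only [skipSite, hi, hj, ne_eq, Fin.ext_iff]
        split_ifs <;> omega)
    have hupd : Function.update (skipSite h (p + 1)) ⟨p, hp⟩ j = skipSite h p := by
      ext l
      by_cases hl : l = ⟨p, hp⟩
      · subst hl; simp [skipSite, hj]
      · have hl' : l.val ≠ p := fun e => hl (Fin.ext e)
        simp only [Function.update_of_ne hl, skipSite]
        split_ifs <;> omega
    rw [hupd, ih hz hβ, ih (hz.comp_perm _) fun _ => hβ _, ← mul_assoc,
      leftProduct_swap hij (by simp [hj]; omega)] at hex
    have hhead : headParam h (z ∘ Equiv.swap i j) =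
        headParam h z ∘ Equiv.swap (⟨p, by omega⟩ : Fin (n + 1)) ⟨p + 1, by omega⟩ := by
      ext l
      simp only [headParam, Function.comp_apply]
      congr 1
      ext
      simp only [Equiv.swap_apply_def, hi, hj, Fin.ext_iff, Fin.val_castLE]
      split_ifs <;> simp
    have htail : ∀ u, tailFun q β (z ∘ Equiv.swap i j) n u = tailFun q β z n u := fun u => by
      unfold tailFun
      congr 1
      refine prod_congr rfl fun x hx => ?_
      simp only [mem_filter, mem_univ, true_and] at hx
      rw [Function.comp_apply, Equiv.swap_apply_of_ne_of_ne] <;>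
      · rintro rfl
        simp [hi, hj] at hx
        omega
    have hsum : bracket (q * z i / z j) * upSum q β h (z ∘ Equiv.swap i j) (p + 1) =
        bracket q * upSum q β h z (p + 1) + bracket (z i / z j) * upSum q β h z p := by
      unfold upSum
      simp only [hhead, htail, upWeight_comp_perm, Function.comp_apply]
      rw [Equiv.sum_comp (Equiv.swap (⟨p, by omega⟩ : Fin (n + 1)) ⟨p + 1, by omega⟩) fun k =>
        tailFun q β z n (headParam h z k) * upWeight q (headParam h z) k *
          upFactor q (headParam h z ∘ Equiv.swap (⟨p, by omega⟩ : Fin (n + 1)) ⟨p + 1, by omega⟩)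
            (p + 1) (headParam h z k), mul_sum, mul_sum, mul_sum, ← sum_add_distrib]
      refine sum_congr rfl fun k _ => ?_
      have h0 := upFactor_step (q := q) (y := headParam h z) (i := ⟨p, by omega⟩)
        (j := ⟨p + 1, by omega⟩) hq (fun _ => hz.ne_zero _) rfl (u := headParam h z k)
        (hz.ne_zero _)
      have hyi : headParam h z ⟨p, by omega⟩ = z i := rfl
      have hyj : headParam h z ⟨p + 1, by omega⟩ = z j := rfl
      rw [hyi, hyj] at h0
      linear_combination (tailFun q β z n (headParam h z k) * upWeight q (headParam h z) k) * h0
    have hx : bracket (z i / z j) ≠ 0 := by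
      simpa using hz.div_ne 0 i j (fun e => by simp [hi, hj] at e)
    refine mul_left_cancel₀ hx ?_
    linear_combination -hex + leftProduct q β z (n + 1) * hsum

end OneUp
end SixVertex

namespace SixVertex

open Finset

/-! ### Reflection of the first parameter -/

section FirstSite

variable {N n : ℕ} {q β : ℂ}

theorem erase_zero_eq : (univ : Finset (Fin (n + 1))).erase 0 = univ.map (Fin.succEmb n) := by
  ext i
  induction i using Fin.cases <;> simp

theorem erase_succ_eq (k : Fin n) :
    (univ : Finset (Fin (n + 1))).erase k.succ =
      cons 0 ((univ.erase k).map (Fin.succEmb n)) (by simp) := by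
  ext i
  induction i using Fin.cases <;> simp [Fin.succ_ne_zero, eq_comm]

theorem prod_erase_zero (f : Fin (n + 1) → ℂ) :
    ∏ j ∈ univ.erase 0, f j = ∏ j : Fin n, f j.succ := by
  rw [erase_zero_eq, prod_map]
  rfl

theorem prod_erase_succ (f : Fin (n + 1) → ℂ) (k : Fin n) :
    ∏ j ∈ univ.erase k.succ, f j = f 0 * ∏ j ∈ univ.erase k, f j.succ := by
  rw [erase_succ_eq, prod_cons, prod_map]
  rfl

/-- Inverting the first parameter. -/
noncomputable def reflectFirst (z : Fin (N + 1) → ℂ) : Fin (N + 1) → ℂ :=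
  Function.update z 0 (z 0)⁻¹

variable {z : Fin (N + 1) → ℂ}

theorem reflectFirst_zero (z : Fin (N + 1) → ℂ) : reflectFirst z 0 = (z 0)⁻¹ := by
  simp [reflectFirst]

theorem reflectFirst_of_ne (z : Fin (N + 1) → ℂ) {i : Fin (N + 1)} (hi : i ≠ 0) :
    reflectFirst z i = z i := by
  simp [reflectFirst, hi]

theorem IsRegular.reflectFirst (hz : IsRegular q z) (hq3 : q ^ 3 = 1) :
    IsRegular q (reflectFirst z) :=
  hz.update_inv hq3 0

/-- The part of `leftProduct` that is invariant under the inversion of the first parameter. -/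
theorem exists_leftProduct_eq (hn : 0 < n) (z : Fin (N + 1) → ℂ) :
    ∃ C, leftProduct q β z n = bracket (β * z 0) * C ∧
      leftProduct q β (reflectFirst z) n = bracket (β / z 0) * C := by
  have hs : ∀ i : Fin N, reflectFirst z i.succ = z i.succ := fun i =>
    reflectFirst_of_ne z (Fin.succ_ne_zero i)
  have h0 := reflectFirst_zero z
  have hp : pairProd (fun i j => if j.val < n then
        bracket (q * reflectFirst z j / reflectFirst z i) *
          bracket (q * reflectFirst z i * reflectFirst z j)
      else if i.val < n then 1 else bracket (q * reflectFirst z j / reflectFirst z i) *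
          bracket (q ^ 2 * reflectFirst z i * reflectFirst z j)) =
      pairProd (fun i j => if j.val < n then bracket (q * z j / z i) * bracket (q * z i * z j)
      else if i.val < n then 1 else
        bracket (q * z j / z i) * bracket (q ^ 2 * z i * z j)) := by
    unfold pairProd
    refine prod_congr rfl fun i _ => prod_congr rfl fun j hj => ?_
    have hlt := mem_Ioi.1 hj
    obtain ⟨j, rfl⟩ := Fin.exists_succ_eq.2 (Fin.ne_zero_of_lt hlt)
    induction i using Fin.cases with
    | zero =>
      beta_reduce
      rw [h0, hs]
      simp only [Fin.val_zero, hn, if_true]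
      split_ifs
      -- Inverting `z 0` interchanges the two brackets of the pair `(0, j)`.
      · rw [show q * z j.succ / (z 0)⁻¹ = q * z 0 * z j.succ by rw [div_inv_eq_mul]; ring,
          show q * (z 0)⁻¹ * z j.succ = q * z j.succ / z 0 by ring, mul_comm]
      · rfl
    | succ i => beta_reduce; rw [hs, hs]
  refine ⟨(∏ i : Fin N, if i.succ.val < n then bracket (β * z i.succ) else 1) *
    pairProd (fun i j => if j.val < n then bracket (q * z j / z i) * bracket (q * z i * z j)
      else if i.val < n then 1 else
        bracket (q * z j / z i) * bracket (q ^ 2 * z i * z j)), ?_, ?_⟩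
  · unfold leftProduct
    rw [Fin.prod_univ_succ]
    simp only [Fin.val_zero, hn, if_true]
    rw [mul_assoc]
  · unfold leftProduct
    rw [hp, Fin.prod_univ_succ, h0]
    simp only [hs, Fin.val_zero, hn, if_true]
    rw [mul_assoc, ← div_eq_mul_inv]

/-- The choice `c = q ^ 2` turns `1 / c` into `q`, which fits the brackets `[q u w]` occurring at
the left boundary. -/
theorem quadVar_sub_sq (hq3 : q ^ 3 = 1) {w u : ℂ} (hw : w ≠ 0) (hu : u ≠ 0) :
    quadVar (q ^ 2) w - quadVar (q ^ 2) u = bracket (w / u) * bracket (q * u * w) := by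
  have hq := ne_zero_of_pow_three hq3
  rw [← bracket_mul_bracket_eq (q ^ 2) w u (pow_ne_zero 2 hq) hw hu]
  congr 2
  rw [div_eq_iff (pow_ne_zero 2 hq)]
  linear_combination (-(u * w)) * hq3

/-- The numerator is a polynomial in `quadVar (q ^ 2) u` with zeros at `q * z j`; its degree is the
number `N - n` of sites beyond the first `n + 1`. -/
theorem tailFun_eq (hq3 : q ^ 3 = 1) {u : ℂ} (hz : ∀ i, z i ≠ 0) (hu : u ≠ 0) :
    tailFun q β z n u = (∏ j ∈ univ.filter (fun j : Fin (N + 1) => n < j.val),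
      (quadVar (q ^ 2) (q * z j) - quadVar (q ^ 2) u)) / bracket (β * u) := by
  have hq := ne_zero_of_pow_three hq3
  unfold tailFun
  congr 1
  refine prod_congr rfl fun j _ => ?_
  rw [quadVar_sub_sq hq3 (mul_ne_zero hq (hz j)) hu]
  congr 2
  ring

/-- The sum over the parameter of the up spin, as a sum over one distinguished and `n` other
parameters. -/
theorem upSum_zero_eq (hq1 : bracket q ≠ 0) (hq3 : q ^ 3 = 1) (h : n < N + 1)
    (hz : IsRegular q z) (hβ : bracket (β * z 0) ≠ 0) (x : Fin n → ℂ)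
    (hx : ∀ k, x k = z (Fin.castLE h k.succ)) (T : ℂ → ℂ)
    (hT : ∀ u, T u = ∏ j ∈ univ.filter (fun j : Fin (N + 1) => n < j.val),
      (quadVar (q ^ 2) (q * z j) - quadVar (q ^ 2) u)) :
    bracket (β * z 0) * upSum q β h z 0 =
      T (z 0) / (∏ j, (quadVar (q ^ 2) (z 0) - quadVar (q ^ 2) (x j))) +
      ∑ k, T (x k) / (∏ j ∈ univ.erase k, (quadVar (q ^ 2) (x k) - quadVar (q ^ 2) (x j))) *
        (bracket q / bracket (β * x k)) * (bracket (β * z 0) /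
          (bracket (q * x k / z 0) * (quadVar (q ^ 2) (x k) - quadVar (q ^ 2) (z 0)))) := by
  have hx0 : ∀ k, x k ≠ 0 := fun k => by rw [hx]; exact hz.ne_zero _
  have hz0 := hz.ne_zero 0
  unfold upSum
  have hh0 : headParam h z 0 = z 0 := rfl
  have hhs : ∀ k : Fin n, headParam h z k.succ = x k := fun k => (hx k).symm
  have hsep : ∀ k l : Fin (n + 1), bracket (q * headParam h z k / headParam h z l) ≠ 0 := fun k l =>
    hz.q_div_ne hq1 _ _
  rw [Fin.sum_univ_succ, mul_add, mul_sum]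
  congr 1
  · rw [upWeight, upFactor, prod_erase_zero, Fin.prod_univ_succ, hh0,
      tailFun_eq hq3 hz.ne_zero hz0, ← hT]
    simp only [hhs, Fin.val_zero, lt_irrefl, if_false, if_true, Fin.val_succ, Nat.not_lt_zero,
      Nat.succ_ne_zero, one_mul]
    simp only [quadVar_sub_sq hq3 hz0 (hx0 _), prod_mul_distrib, mul_inv]
    have : ∏ j, bracket (q * z 0 / x j) ≠ 0 := prod_ne_zero_iff.2 fun j _ => by
      have := hsep 0 j.succ
      rwa [hh0, hhs] at this
    generalize ∏ j, bracket (q * z 0 / x j) = a at *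
    generalize ∏ j, bracket (z 0 / x j) = b at *
    generalize ∏ j, bracket (q * x j * z 0) = c at *
    simp only [div_eq_mul_inv, mul_inv]
    have e1 := mul_inv_cancel₀ this
    have e2 := mul_inv_cancel₀ hβ
    generalize bracket (β * z 0) = d at *
    linear_combination (T (z 0) * b⁻¹ * c⁻¹ * d * d⁻¹) * e1 + (T (z 0) * b⁻¹ * c⁻¹) * e2
  · refine sum_congr rfl fun k _ => ?_
    rw [upWeight, upFactor, prod_erase_succ, Fin.prod_univ_succ,
      ← mul_prod_erase univ _ (mem_univ k)]
    simp only [hh0, hhs, Fin.val_zero, lt_irrefl, if_false, if_true, Fin.val_succ, Nat.not_lt_zero,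
      Nat.succ_ne_zero, one_mul]
    rw [tailFun_eq hq3 hz.ne_zero (hx0 k), ← hT, mul_div_assoc q (x k) (x k), div_self (hx0 k),
      mul_one, quadVar_sub_sq hq3 (hx0 k) hz0]
    simp only [quadVar_sub_sq hq3 (hx0 k) (hx0 _), prod_mul_distrib, mul_inv]
    have : ∏ j ∈ univ.erase k, bracket (q * x k / x j) ≠ 0 := prod_ne_zero_iff.2 fun j _ => by
      have := hsep k.succ j.succ
      rwa [hhs, hhs] at this
    generalize ∏ j ∈ univ.erase k, bracket (q * x k / x j) = a at *
    generalize ∏ j ∈ univ.erase k, bracket (x k / x j) = b at *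
    generalize ∏ j ∈ univ.erase k, bracket (q * x j * x k) = c at *
    generalize bracket (x k / z 0) = d at *
    generalize bracket (q * x k / z 0) = e at *
    generalize bracket (q * z 0 * x k) = f at *
    simp only [div_eq_mul_inv, mul_inv]
    have e1 := mul_inv_cancel₀ this
    linear_combination (bracket (β * z 0) * (T (x k) * (bracket (β * x k))⁻¹ *
      d⁻¹ * e⁻¹ * f⁻¹ * b⁻¹ * c⁻¹ * bracket q)) * e1

/-- As on the right, the difference of the two sides is a Lagrange sum, now in `quadVar (q ^ 2)`
over the `n` nodes `x k` together with `z 0` and its inverse. The degree condition `N - n ≤ n` is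
the hypothesis `hN`. -/
theorem upSum_reflectFirst (hq1 : bracket q ≠ 0) (hq3 : q ^ 3 = 1) (h : n < N + 1)
    (hz : IsRegular q z) (hβ : ∀ i, bracket (β * z i) ≠ 0) (hβ' : bracket (β / z 0) ≠ 0)
    (hN : N ≤ 2 * n) :
    bracket (β / z 0) * upSum q β h (reflectFirst z) 0 = bracket (β * z 0) * upSum q β h z 0 := by
  have hz' := hz.reflectFirst hq3
  have hr0 := reflectFirst_zero z
  have hrs : ∀ i : Fin (N + 1), i ≠ 0 → reflectFirst z i = z i := fun i hi =>
    reflectFirst_of_ne z hi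
  set x : Fin n → ℂ := fun k => z (Fin.castLE h k.succ) with hx
  have hxne : ∀ k : Fin n, Fin.castLE h k.succ ≠ 0 := fun k e => by
    have := congrArg Fin.val e
    simp at this
  set t := univ.filter (fun j : Fin (N + 1) => n < j.val) with ht
  set T : ℂ → ℂ := fun u => ∏ j ∈ t, (quadVar (q ^ 2) (q * z j) - quadVar (q ^ 2) u) with hT
  have hT' : ∀ u, T u = ∏ j ∈ t,
      (quadVar (q ^ 2) (q * reflectFirst z j) - quadVar (q ^ 2) u) := fun u => by
    refine prod_congr rfl fun j hj => ?_
    rw [hrs j]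
    rintro rfl
    simp [ht] at hj
  have e1 := upSum_zero_eq hq1 hq3 h hz (hβ 0) x (fun _ => rfl) T fun _ => rfl
  have e2 := upSum_zero_eq (β := β) hq1 hq3 h hz' (by rwa [hr0, ← div_eq_mul_inv]) x
    (fun k => (hrs _ (hxne k)).symm) T hT'
  rw [hr0, ← div_eq_mul_inv] at e2
  rw [e1, e2]
  have hx0 : ∀ k, x k ≠ 0 := fun k => hz.ne_zero _
  have hz0 := hz.ne_zero 0
  have hne : ∀ {u v : ℂ}, bracket (u / v) ≠ 0 → bracket (q * v * u) ≠ 0 → u ≠ 0 → v ≠ 0 →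
      quadVar (q ^ 2) u - quadVar (q ^ 2) v ≠ 0 := fun h1 h2 h3 h4 => by
    rw [quadVar_sub_sq hq3 h3 h4]
    exact mul_ne_zero h1 h2
  have hXX : ∀ i j, i ≠ j → quadVar (q ^ 2) (x i) - quadVar (q ^ 2) (x j) ≠ 0 := fun i j hij => by
    refine hne ?_ ?_ (hx0 i) (hx0 j)
    · have := hz.div_ne 0 (Fin.castLE h i.succ) (Fin.castLE h j.succ) (by simpa using hij)
      rwa [pow_zero, one_mul] at this
    · have := hz.mul_ne 1 (Fin.castLE h j.succ) (Fin.castLE h i.succ)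
      rwa [pow_one] at this
  have hA : ∀ i, quadVar (q ^ 2) (x i) - quadVar (q ^ 2) (z 0) ≠ 0 := fun i => by
    refine hne ?_ ?_ (hx0 i) hz0
    · have := hz.div_ne 0 (Fin.castLE h i.succ) 0 (hxne i)
      rwa [pow_zero, one_mul] at this
    · have := hz.mul_ne 1 0 (Fin.castLE h i.succ)
      rwa [pow_one] at this
  have hB : ∀ i, quadVar (q ^ 2) (x i) - quadVar (q ^ 2) (z 0)⁻¹ ≠ 0 := fun i => by
    refine hne ?_ ?_ (hx0 i) (inv_ne_zero hz0)
    · have := hz'.div_ne 0 (Fin.castLE h i.succ) 0 (hxne i)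
      rwa [hr0, hrs _ (hxne i), pow_zero, one_mul] at this
    · have := hz'.mul_ne 1 0 (Fin.castLE h i.succ)
      rwa [hr0, hrs _ (hxne i), pow_one] at this
  have hz2 : bracket (z 0 * z 0) ≠ 0 := by simpa using hz.mul_ne 0 0 0
  have hAB : quadVar (q ^ 2) (z 0) - quadVar (q ^ 2) (z 0)⁻¹ = bracket (z 0 * z 0) * bracket q := by
    rw [quadVar_sub_sq hq3 hz0 (inv_ne_zero hz0), inv_mul_cancel_right₀ hz0, div_inv_eq_mul]
  -- The nodes are negated because `upSum_zero_eq` has the differences in the opposite order.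
  have hL := sum_two_extra_nodes t (fun i => -quadVar (q ^ 2) (x i))
    (fun j => -quadVar (q ^ 2) (q * z j)) (-quadVar (q ^ 2) (z 0)) (-quadVar (q ^ 2) (z 0)⁻¹)
    (fun i j h => by
      by_contra hij
      exact hXX i j hij (sub_eq_zero.2 (neg_injective h)))
    (fun i h => hA i (sub_eq_zero.2 (neg_injective h)))
    (fun i h => hB i (sub_eq_zero.2 (neg_injective h))) (by
      intro h
      have h1 := sub_eq_zero.2 (neg_injective h)
      rw [hAB] at h1
      exact mul_ne_zero hz2 hq1 h1) (by
      have : t = Ioi ⟨n, h⟩ := by ext j; simp [ht, Fin.lt_def]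
      rw [this, Fin.card_Ioi]
      simp only
      omega)
  have hTn : ∀ u, ∏ j ∈ t, (quadVar (q ^ 2) u - quadVar (q ^ 2) (q * z j)) =
      (-1) ^ t.card * T u := fun u => by
    rw [hT, ← prod_const, ← prod_mul_distrib]
    exact prod_congr rfl fun j _ => by ring
  simp only [neg_sub_neg, hTn, mul_div_assoc, ← mul_sum, ← mul_add] at hL
  have hL := (mul_eq_zero.1 hL).resolve_left (pow_ne_zero _ (by norm_num))
  rw [hAB, ← neg_sub (quadVar (q ^ 2) (z 0)), hAB] at hL
  -- The identity `hcore` produces a factor `[βx_k]` that cancels the one in the denominator,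
  -- leaving a polynomial numerator as the Lagrange identity requires.
  have hterm : ∀ k, T (x k) / (∏ j ∈ univ.erase k, (quadVar (q ^ 2) (x k) - quadVar (q ^ 2) (x j))) *
        (bracket q / bracket (β * x k)) * (bracket (β * z 0) /
          (bracket (q * x k / z 0) * (quadVar (q ^ 2) (x k) - quadVar (q ^ 2) (z 0)))) =
      T (x k) / (∏ j ∈ univ.erase k, (quadVar (q ^ 2) (x k) - quadVar (q ^ 2) (x j))) *
        (bracket q / bracket (β * x k)) * (bracket (β / z 0) /
          (bracket (q * x k / (z 0)⁻¹) * (quadVar (q ^ 2) (x k) - quadVar (q ^ 2) (z 0)⁻¹))) +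
      bracket (z 0 * z 0) * bracket q * (T (x k) /
        ((∏ j ∈ univ.erase k, (quadVar (q ^ 2) (x k) - quadVar (q ^ 2) (x j))) *
          (quadVar (q ^ 2) (x k) - quadVar (q ^ 2) (z 0)) *
          (quadVar (q ^ 2) (x k) - quadVar (q ^ 2) (z 0)⁻¹))) := by
    intro k
    have hcore : bracket (β * z 0) * bracket (x k / (z 0)⁻¹) -
        bracket (β / z 0) * bracket (x k / z 0) = bracket (β * x k) * bracket (z 0 * z 0) := by
      have := hx0 k
      rcases eq_or_ne β 0 with rfl | hβ0
      · simp [bracket]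
      unfold bracket
      field_simp
      ring
    have nA := hA k
    have nB := hB k
    have nβ := hβ (Fin.castLE h k.succ)
    change bracket (β * x k) ≠ 0 at nβ
    have hD : (∏ j ∈ univ.erase k, (quadVar (q ^ 2) (x k) - quadVar (q ^ 2) (x j))) ≠ 0 :=
      prod_ne_zero_iff.2 fun j hj => hXX k j (ne_of_mem_erase hj).symm
    rw [quadVar_sub_sq hq3 (hx0 k) hz0] at nA ⊢
    rw [quadVar_sub_sq hq3 (hx0 k) (inv_ne_zero hz0)] at nB ⊢
    have e3 : q * x k / (z 0)⁻¹ = q * z 0 * x k := by rw [div_inv_eq_mul]; ring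
    have e4 : q * (z 0)⁻¹ * x k = q * x k / z 0 := by rw [div_eq_mul_inv]; ring
    rw [e4] at nB
    rw [e3, e4]
    obtain ⟨na, nb⟩ := mul_ne_zero_iff.1 nA
    obtain ⟨nc, nd⟩ := mul_ne_zero_iff.1 nB
    generalize bracket (q * z 0 * x k) = b at *
    generalize bracket (q * x k / z 0) = d at *
    generalize bracket (x k / z 0) = a at *
    generalize bracket (x k / (z 0)⁻¹) = c at *
    generalize ∏ j ∈ univ.erase k, (quadVar (q ^ 2) (x k) - quadVar (q ^ 2) (x j)) = D at *
    generalize bracket (β * x k) = f at *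
    generalize bracket (β * z 0) = s1 at *
    generalize bracket (β / z 0) = s2 at *
    generalize bracket (z 0 * z 0) = r at *
    field_simp
    linear_combination (T (x k)) * hcore
  simp only [hterm, sum_add_distrib, ← mul_sum]
  generalize (∏ j, (quadVar (q ^ 2) (z 0) - quadVar (q ^ 2) (x j))) = D1 at *
  generalize (∏ j, (quadVar (q ^ 2) (z 0)⁻¹ - quadVar (q ^ 2) (x j))) = D2 at *
  have hr : bracket (z 0 * z 0) * bracket q ≠ 0 := mul_ne_zero hz2 hq1
  have aux : ∀ S1 S2 U V D1 D2 r : ℂ, r ≠ 0 → S2 + U / (D1 * r) + V / (D2 * -r) = 0 →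
      V / D2 + S1 = U / D1 + (S1 + r * S2) := by
    intro S1 S2 U V D1 D2 r hr h
    have h' : S2 + U / D1 / r - V / D2 / r = 0 := by
      rw [← h]; simp only [div_eq_mul_inv, mul_inv, inv_neg]; ring
    field_simp at h'
    linear_combination -h'
  exact aux _ _ _ _ _ _ _ hr hL

/-- Inversion of `z 0` multiplies `leftProduct` by `[β/z_0] / [βz_0]` and `upSum` by the reciprocal.
-/
theorem amp_skipSite_zero_reflectFirst (hq1 : bracket q ≠ 0) (hq3 : q ^ 3 = 1) (h : n < N + 1)
    (hz : IsRegular q z) (hβ : ∀ i, bracket (β * z i) ≠ 0) (hβ' : bracket (β / z 0) ≠ 0)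
    (hN : N ≤ 2 * n) :
    amp q β (reflectFirst z) (skipSite h 0) = amp q β z (skipSite h 0) := by
  have hq := ne_zero_of_pow_three hq3
  rw [amp_skipSite hq hq1 hz h hβ 0 (Nat.zero_le _),
    amp_skipSite hq hq1 (hz.reflectFirst hq3) h (fun i => ?_) 0 (Nat.zero_le _)]
  · obtain ⟨C, h1, h2⟩ := exists_leftProduct_eq (q := q) (β := β) (Nat.succ_pos n) z
    rw [h1, h2]
    linear_combination C * upSum_reflectFirst hq1 hq3 h hz hβ hβ' hN
  · by_cases hi : i = 0
    · subst hi
      rwa [reflectFirst_zero, ← div_eq_mul_inv]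
    · rw [reflectFirst_of_ne z hi]
      exact hβ i

theorem amp_castLE_reflectFirst (hq1 : bracket q ≠ 0) (hq3 : q ^ 3 = 1) (h : n ≤ N + 1)
    (hn : 0 < n) (hz : IsRegular q z) :
    bracket (β * z 0) * amp q β (reflectFirst z) (Fin.castLE h) =
      bracket (β / z 0) * amp q β z (Fin.castLE h) := by
  rw [amp_castLE hq1 hz, amp_castLE hq1 (hz.reflectFirst hq3)]
  obtain ⟨C, h1, h2⟩ := exists_leftProduct_eq (q := q) (β := β) hn z
  rw [h1, h2]
  ring

end FirstSite
end SixVertex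

namespace SixVertex

open Finset

/-! ### Propagation of the left reflection to all components -/

section FirstSite

variable {N n : ℕ} {q β : ℂ} {z : Fin (N + 1) → ℂ}

theorem reflectFirst_comp_swap {i j : Fin (N + 1)} (hi : i ≠ 0) (hj : j ≠ 0) :
    reflectFirst (z ∘ Equiv.swap i j) = reflectFirst z ∘ Equiv.swap i j := by
  have h0 : Equiv.swap i j 0 = 0 := Equiv.swap_apply_of_ne_of_ne hi.symm hj.symm
  funext k
  by_cases hk : k = 0
  · subst hk
    simp [reflectFirst_zero, h0]
  · have hk' : Equiv.swap i j k ≠ 0 := fun e => hk ((Equiv.swap i j).injective (e.trans h0.symm))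
    rw [reflectFirst_of_ne _ hk, Function.comp_apply, Function.comp_apply,
      reflectFirst_of_ne _ hk']

/-- A relation under the reflection of the first parameter propagates from the component whose down
spins are as far to the left as possible to all others with the same first spin. -/
theorem amp_reflectFirst_of_base (hq1 : bracket q ≠ 0) (hq3 : q ^ 3 = 1) {e : Fin n → Fin (N + 1)}
    {s : ℕ} (he : ∀ l, (e l).val = l.val + s) (c₁ c₂ : ℂ → ℂ)
    (base : ∀ z : Fin (N + 1) → ℂ, IsRegular q z → (∀ i, bracket (β * z i) ≠ 0) →
      bracket (β / z 0) ≠ 0 →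
      c₁ (z 0) * amp q β (reflectFirst z) e = c₂ (z 0) * amp q β z e)
    (a : Fin n → Fin (N + 1)) (ha : StrictMono a) (hs : ∀ l, l.val + s ≤ (a l).val)
    (h0 : ∀ l : Fin n, s = 0 → l.val = 0 → (a l).val = 0) (hz : IsRegular q z)
    (hβ : ∀ i, bracket (β * z i) ≠ 0) (hβ' : bracket (β / z 0) ≠ 0) :
    c₁ (z 0) * amp q β (reflectFirst z) a = c₂ (z 0) * amp q β z a := by
  have hq := ne_zero_of_pow_three hq3
  -- Induction on the sum of the positions of the down spins, for all parameters at once because the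
  -- exchange relation involves exchanged parameters.
  induction hm : ∑ l, (a l).val using Nat.strong_induction_on generalizing a z with
  | _ m ih =>
    by_cases hall : ∀ l, (a l).val = l.val + s
    · rw [show a = e from funext fun l => Fin.ext ((hall l).trans (he l).symm)]
      exact base z hz hβ hβ'
    simp only [not_forall] at hall
    obtain ⟨l, hl, hmin⟩ := (wellFounded_lt (α := Fin n)).has_min
      {l | (a l).val ≠ l.val + s} hall
    have hl' : l.val + s < (a l).val := lt_of_le_of_ne (hs l) (Ne.symm hl)
    have hlt : ∀ l' < l, (a l').val = l'.val + s := fun l' h => by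
      by_contra hne
      exact hmin l' hne h
    -- The displaced spin and its left neighbour both avoid the site `0`, so exchanging their
    -- parameters commutes with the reflection. For `s = 0` this uses that the first down spin stays
    -- at the site `0`.
    have h2 : 2 ≤ (a l).val := by
      by_contra hc
      have : s = 0 := by omega
      have := h0 l this (by omega)
      omega
    set j := a l with hj
    set i : Fin (N + 1) := ⟨j.val - 1, by omega⟩ with hi
    have hij : i.val + 1 = j.val := by simp [hi]; omega
    set b := Function.update a l i with hb
    have hbl : b l = i := by simp [hb]
    have hbne : ∀ l', l' ≠ l → b l' = a l' := fun l' h => by simp [hb, h]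
    have hbs : ∀ l', l' ≠ l → (l' < l ∧ (b l').val < i.val) ∨ (l < l' ∧ j.val < (b l').val) := by
      intro l' h
      rw [hbne l' h]
      rcases lt_or_gt_of_ne h with h1 | h1
      · left
        have := hlt l' h1
        have := Fin.lt_def.1 h1
        exact ⟨h1, by omega⟩
      · right
        exact ⟨h1, Fin.lt_def.1 (ha h1)⟩
    have hbmono : StrictMono b := by
      intro x y hxy
      rw [Fin.lt_def]
      by_cases hx : x = l
      · subst hx
        have hy := hbs y hxy.ne'
        rw [hbl]
        rcases hy with hy | hy
        · exact absurd hy.1 (not_lt.2 hxy.le)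
        · omega
      · by_cases hy : y = l
        · subst hy
          have hx := hbs x hx
          rw [hbl]
          rcases hx with hx | hx
          · omega
          · exact absurd hx.1 (not_lt.2 hxy.le)
        · rw [hbne x hx, hbne y hy]
          exact Fin.lt_def.1 (ha hxy)
    have hsum : ∑ l, (b l).val < m := by
      rw [← hm]
      refine sum_lt_sum (fun l' _ => ?_) ⟨l, mem_univ l, ?_⟩
      · by_cases h : l' = l
        · subst h; rw [hbl]; omega
        · rw [hbne l' h]
      · rw [hbl]; omega
    have hb1 : ∀ l', l'.val + s ≤ (b l').val := fun l' => by
      by_cases h : l' = l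
      · subst h; rw [hbl]; omega
      · rw [hbne l' h]; exact hs l'
    have hb0 : ∀ l' : Fin n, s = 0 → l'.val = 0 → (b l').val = 0 := fun l' h3 h4 => by
      by_cases h : l' = l
      · subst h
        have := h0 l' h3 h4
        omega
      · rw [hbne l' h]; exact h0 l' h3 h4
    have hi0 : i ≠ 0 := fun e => by
      have := congrArg Fin.val e
      simp only [Fin.val_zero] at this
      omega
    have hj0 : j ≠ 0 := fun e => by
      have := congrArg Fin.val e
      simp only [Fin.val_zero] at this
      omega
    have hba : Function.update b l j = a := by simp [hb, hj]
    have hbij : ∀ l', l' ≠ l → b l' ≠ i ∧ b l' ≠ j := fun l' h => by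
      have := hbs l' h
      simp only [ne_eq, Fin.ext_iff]
      omega
    -- `b` is `a` with one down spin moved a step to the left; the exchange relation for `b`
    -- expresses `a` through `b`, before and after the reflection alike.
    have e1 := amp_swap_down_up (β := β) hq hq1 hz hij hbl hbij
    have e2 := amp_swap_down_up (β := β) hq hq1 (hz.reflectFirst hq3) hij hbl hbij
    rw [hba] at e1 e2
    rw [← reflectFirst_comp_swap hi0 hj0, reflectFirst_of_ne z hi0, reflectFirst_of_ne z hj0] at e2
    have i1 := ih _ hsum b hbmono hb1 hb0 hz hβ hβ' rfl
    have hsw0 : (z ∘ Equiv.swap i j) 0 = z 0 := by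
      rw [Function.comp_apply, Equiv.swap_apply_of_ne_of_ne hi0.symm hj0.symm]
    have i2 := ih _ hsum b hbmono hb1 hb0 (hz.comp_perm (Equiv.swap i j)) (fun _ => hβ _)
      (by rwa [hsw0]) rfl
    rw [hsw0] at i2
    have hx : bracket (z i / z j) ≠ 0 := by
      simpa using hz.div_ne 0 i j (fun e => by
        have := congrArg Fin.val e
        omega)
    refine mul_left_cancel₀ hx ?_
    linear_combination bracket (q * z j / z i) * i2 - bracket q * i1 - c₁ (z 0) * e2 + c₂ (z 0) * e1

/-- The base component has its down spins at the sites `1, …, n`, hence the offset `s = 1`. -/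
theorem amp_reflectFirst_up (hq1 : bracket q ≠ 0) (hq3 : q ^ 3 = 1) (hn : n < N + 1)
    (hN : N ≤ 2 * n) (a : Fin n → Fin (N + 1)) (ha : StrictMono a) (ha0 : ∀ l, a l ≠ 0)
    (hz : IsRegular q z) (hβ : ∀ i, bracket (β * z i) ≠ 0) (hβ' : bracket (β / z 0) ≠ 0) :
    amp q β (reflectFirst z) a = amp q β z a := by
  have h := amp_reflectFirst_of_base (e := skipSite hn 0) (s := 1) hq1 hq3 (fun l => by
    simp [skipSite]) (fun _ => 1) (fun _ => 1) (fun z hz hβ hβ' => by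
      simpa using amp_skipSite_zero_reflectFirst hq1 hq3 hn hz hβ hβ' hN) a ha (fun l => ?_)
      (fun l h => by omega) hz hβ hβ'
  · simpa using h
  · obtain ⟨l, hl⟩ := l
    induction l with
    | zero =>
      have := ha0 ⟨0, hl⟩
      rw [ne_eq, Fin.ext_iff] at this
      simp only [Fin.val_zero] at this ⊢
      omega
    | succ l ih =>
      have h1 := ih (by omega)
      have h2 := Fin.lt_def.1 (ha (show (⟨l, by omega⟩ : Fin n) < ⟨l + 1, hl⟩ by simp [Fin.lt_def]))
      simp only at h1 ⊢
      omega

/-- The base component has its down spins at the sites `0, …, n - 1`, hence the offset `s = 0`. -/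
theorem amp_reflectFirst_down (hq1 : bracket q ≠ 0) (hq3 : q ^ 3 = 1)
    (a : Fin n → Fin (N + 1)) (ha : StrictMono a) {l₀ : Fin n} (ha0 : a l₀ = 0)
    (hz : IsRegular q z) (hβ : ∀ i, bracket (β * z i) ≠ 0) (hβ' : bracket (β / z 0) ≠ 0) :
    bracket (β * z 0) * amp q β (reflectFirst z) a = bracket (β / z 0) * amp q β z a := by
  have hn : n ≤ N + 1 := by simpa using Fintype.card_le_of_injective a ha.injective
  refine amp_reflectFirst_of_base (e := Fin.castLE hn) (s := 0) hq1 hq3 (fun l => by simp)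
    (fun x => bracket (β * x)) (fun x => bracket (β / x)) (fun z hz _ _ =>
      amp_castLE_reflectFirst hq1 hq3 hn (Fin.pos l₀) hz) a ha (fun l => ?_) (fun l _ hl => ?_)
      hz hβ hβ'
  · obtain ⟨l, hl⟩ := l
    induction l with
    | zero => simp
    | succ l ih =>
      have h1 := ih (by omega)
      have h2 := Fin.lt_def.1 (ha (show (⟨l, by omega⟩ : Fin n) < ⟨l + 1, hl⟩ by simp [Fin.lt_def]))
      simp only at h1 ⊢
      omega
  · have h1 : a l ≤ a l₀ := ha.monotone (by rw [Fin.le_def]; omega)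
    rw [ha0, Fin.le_zero_iff] at h1
    simp [h1]

end FirstSite

/-! ### The vector in the basis of spin configurations -/

section Vec

variable {N n : ℕ} {q β : ℂ} {z : Fin N → ℂ}

/-- The vector with `n` down spins whose components are the sums over residues. -/
noncomputable def ampVec (n : ℕ) (q β : ℂ) (z : Fin N → ℂ) : Config N → ℂ := fun s =>
  if h : (univ.filter fun i => s i = 1).card = n then
    amp q β z ((univ.filter fun i => s i = 1).orderEmbOfFin h)
  else 0

/-- The down spins of `s` are at the sites `a_1 < ⋯ < a_n`. -/
def IsSites (a : Fin n → Fin N) (s : Config N) : Prop :=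
  StrictMono a ∧ ∀ i, s i = 1 ↔ ∃ l, a l = i

theorem exists_isSites_iff {s : Config N} :
    (∃ a : Fin n → Fin N, IsSites a s) ↔ (univ.filter fun i => s i = 1).card = n := by
  constructor
  · rintro ⟨a, ha, hs⟩
    have : (univ.filter fun i => s i = 1) = univ.image a := by
      ext i; simp [hs]
    rw [this, card_image_of_injective _ ha.injective]
    simp
  · intro h
    refine ⟨_, ((univ.filter fun i => s i = 1).orderEmbOfFin h).strictMono, fun i => ?_⟩
    have := Set.ext_iff.1 (range_orderEmbOfFin (univ.filter fun i => s i = 1) h) i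
    simp only [Set.mem_range, coe_filter, mem_univ, true_and, Set.mem_ofPred_eq] at this
    exact this.symm

theorem ampVec_of_isSites {a : Fin n → Fin N} {s : Config N} (h : IsSites a s) :
    ampVec n q β z s = amp q β z a := by
  have hc := exists_isSites_iff.1 ⟨a, h⟩
  rw [ampVec, dif_pos hc]
  congr 1
  exact (orderEmbOfFin_unique hc (fun l => by simp [h.2]) h.1).symm

theorem ampVec_eq_zero {s : Config N} (h : (univ.filter fun i => s i = 1).card ≠ n) :
    ampVec n q β z s = 0 := dif_neg h

theorem card_filter_comp_perm (s : Config N) (e : Equiv.Perm (Fin N)) :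
    (univ.filter fun i => (s ∘ e) i = 1).card = (univ.filter fun i => s i = 1).card := by
  refine card_bij (fun i _ => e i) (by simp) (by simp) fun i hi => ⟨e.symm i, ?_, by simp⟩
  simpa using hi

theorem eq_zero_of_ne_one {x : Fin 2} (h : x ≠ 1) : x = 0 := by omega

variable {i j : Fin N}

/-- Together with `ampVec_swap_of_ne` this is the action of the R-matrix, composed with the
permutation of the two sites, with the common denominator cleared. -/
theorem ampVec_swap_of_eq (hq : q ≠ 0) (hq1 : bracket q ≠ 0) (hz : IsRegular q z)
    (hij : i.val + 1 = j.val) {s : Config N} (hs : s i = s j) :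
    bracket (q * z j / z i) * ampVec n q β (z ∘ Equiv.swap i j) s =
      bracket (q * z i / z j) * ampVec n q β z s := by
  by_cases hc : (univ.filter fun i => s i = 1).card = n
  swap
  · rw [ampVec_eq_zero hc, ampVec_eq_zero hc, mul_zero, mul_zero]
  obtain ⟨a, ha⟩ := exists_isSites_iff.2 hc
  rw [ampVec_of_isSites ha, ampVec_of_isSites ha]
  by_cases hi : s i = 1
  · obtain ⟨k, hk⟩ := (ha.2 i).1 hi
    obtain ⟨k', hk'⟩ := (ha.2 j).1 (hs ▸ hi)
    have hkk : k < k' := by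
      rw [← ha.1.lt_iff_lt, hk, hk', Fin.lt_def]; omega
    refine amp_swap_down_down hq hq1 hz hij ?_ hk hk' fun l hl hl' => ?_
    · by_contra hne
      -- Otherwise a further down spin would sit strictly between the adjacent sites `i` and `j`.
      have hlt : k.val + 1 < k'.val := by
        have := Fin.lt_def.1 hkk
        omega
      have h1 := ha.1 (show k < ⟨k.val + 1, by omega⟩ by simp [Fin.lt_def])
      have h2 := ha.1 (show (⟨k.val + 1, by omega⟩ : Fin n) < k' from Fin.lt_def.2 hlt)
      rw [hk, Fin.lt_def] at h1
      rw [hk', Fin.lt_def] at h2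
      omega
    · rw [← hk, ← hk']
      exact ⟨ha.1.injective.ne hl, ha.1.injective.ne hl'⟩
  · refine amp_swap_up_up hij fun l => ⟨?_, ?_⟩
    · rintro rfl
      exact hi ((ha.2 _).2 ⟨l, rfl⟩)
    · rintro rfl
      exact hi (hs.trans ((ha.2 _).2 ⟨l, rfl⟩))

theorem ampVec_swap_of_ne (hq : q ≠ 0) (hq1 : bracket q ≠ 0) (hz : IsRegular q z)
    (hij : i.val + 1 = j.val) {s : Config N} (hs : s i ≠ s j) :
    bracket (q * z j / z i) * ampVec n q β (z ∘ Equiv.swap i j) s =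
      bracket q * ampVec n q β z s + bracket (z i / z j) * ampVec n q β z (s ∘ Equiv.swap i j) := by
  by_cases hc : (univ.filter fun i => s i = 1).card = n
  swap
  · have hc' : (univ.filter fun x => (s ∘ Equiv.swap i j) x = 1).card ≠ n := by
      rwa [card_filter_comp_perm]
    rw [ampVec_eq_zero hc, ampVec_eq_zero hc, ampVec_eq_zero hc']
    ring
  obtain ⟨a, ha⟩ := exists_isSites_iff.2 hc
  have hijne : i ≠ j := fun e => by rw [e] at hij; omega
  by_cases hi : s i = 1
  · have hj : s j ≠ 1 := fun h => hs (hi.trans h.symm)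
    obtain ⟨k, hk⟩ := (ha.2 i).1 hi
    have haj : ∀ l, a l ≠ j := fun l e => hj ((ha.2 j).2 ⟨l, e⟩)
    have hne : ∀ l, l ≠ k → a l ≠ i := fun l hl => hk ▸ ha.1.injective.ne hl
    have hsites : IsSites (Function.update a k j) (s ∘ Equiv.swap i j) := by
      constructor
      · intro x y hxy
        have h1 := ha.1 hxy
        by_cases hx : x = k
        · subst hx
          rw [Function.update_self, Function.update_of_ne hxy.ne']
          rw [hk] at h1
          have h2 := haj y
          rw [ne_eq, Fin.ext_iff] at h2
          rw [Fin.lt_def] at h1 ⊢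
          omega
        · by_cases hy : y = k
          · subst hy
            rw [Function.update_self, Function.update_of_ne hx]
            rw [hk] at h1
            rw [Fin.lt_def] at h1 ⊢
            omega
          · rwa [Function.update_of_ne hx, Function.update_of_ne hy]
      · intro x
        rw [Function.comp_apply, ha.2]
        constructor
        · rintro ⟨l, hl⟩
          by_cases hlk : l = k
          · subst hlk
            refine ⟨l, ?_⟩
            rw [Function.update_self]
            exact (Equiv.swap i j).injective
              ((Equiv.swap_apply_right i j).trans (hk.symm.trans hl))
          · refine ⟨l, ?_⟩
            rw [Function.update_of_ne hlk]
            have := (Equiv.swap_apply_of_ne_of_ne (hne l hlk) (haj l)).trans hl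
            exact (Equiv.swap i j).injective this
        · rintro ⟨l, hl⟩
          by_cases hlk : l = k
          · subst hlk
            rw [Function.update_self] at hl
            exact ⟨l, by rw [← hl, Equiv.swap_apply_right, hk]⟩
          · rw [Function.update_of_ne hlk] at hl
            exact ⟨l, by rw [← hl, Equiv.swap_apply_of_ne_of_ne (hne l hlk) (haj l)]⟩
    rw [ampVec_of_isSites ha, ampVec_of_isSites ha, ampVec_of_isSites hsites]
    exact amp_swap_down_up hq hq1 hz hij hk fun l hl => ⟨hne l hl, haj l⟩
  · have hj : s j = 1 := by
      by_contra hj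
      exact hs ((eq_zero_of_ne_one hi).trans (eq_zero_of_ne_one hj).symm)
    obtain ⟨k, hk⟩ := (ha.2 j).1 hj
    have hai : ∀ l, a l ≠ i := fun l e => hi ((ha.2 i).2 ⟨l, e⟩)
    have hne : ∀ l, l ≠ k → a l ≠ j := fun l hl => hk ▸ ha.1.injective.ne hl
    have hsites : IsSites (Function.update a k i) (s ∘ Equiv.swap i j) := by
      constructor
      · intro x y hxy
        have h1 := ha.1 hxy
        by_cases hx : x = k
        · subst hx
          rw [Function.update_self, Function.update_of_ne hxy.ne']
          rw [hk] at h1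
          rw [Fin.lt_def] at h1 ⊢
          omega
        · by_cases hy : y = k
          · subst hy
            rw [Function.update_self, Function.update_of_ne hx]
            rw [hk] at h1
            have h2 := hai x
            rw [ne_eq, Fin.ext_iff] at h2
            rw [Fin.lt_def] at h1 ⊢
            omega
          · rwa [Function.update_of_ne hx, Function.update_of_ne hy]
      · intro x
        rw [Function.comp_apply, ha.2]
        constructor
        · rintro ⟨l, hl⟩
          by_cases hlk : l = k
          · subst hlk
            refine ⟨l, ?_⟩
            rw [Function.update_self]
            exact (Equiv.swap i j).injective
              ((Equiv.swap_apply_left i j).trans (hk.symm.trans hl))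
          · refine ⟨l, ?_⟩
            rw [Function.update_of_ne hlk]
            have := (Equiv.swap_apply_of_ne_of_ne (hai l) (hne l hlk)).trans hl
            exact (Equiv.swap i j).injective this
        · rintro ⟨l, hl⟩
          by_cases hlk : l = k
          · subst hlk
            rw [Function.update_self] at hl
            exact ⟨l, by rw [← hl, Equiv.swap_apply_left, hk]⟩
          · rw [Function.update_of_ne hlk] at hl
            exact ⟨l, by rw [← hl, Equiv.swap_apply_of_ne_of_ne (hai l) (hne l hlk)]⟩
    rw [ampVec_of_isSites ha, ampVec_of_isSites ha, ampVec_of_isSites hsites]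
    exact amp_swap_up_down hq hq1 hz hij hk fun l hl => ⟨hai l, hne l hl⟩

end Vec

/-! ### Boundary reflections of the vector -/

section VecReflect

variable {N n : ℕ} {q β : ℂ}

/-- This and `ampVec_reflectFirst_down` are the two diagonal entries of the K-matrix with parameter
`β` at the left end. -/
theorem ampVec_reflectFirst_up {z : Fin (N + 1) → ℂ} (hq1 : bracket q ≠ 0) (hq3 : q ^ 3 = 1)
    (hN : N ≤ 2 * n) (hz : IsRegular q z) (hβ : ∀ i, bracket (β * z i) ≠ 0)
    (hβ' : bracket (β / z 0) ≠ 0) {s : Config (N + 1)} (hs : s 0 = 0) :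
    ampVec n q β (reflectFirst z) s = ampVec n q β z s := by
  by_cases hc : (univ.filter fun i => s i = 1).card = n
  swap
  · rw [ampVec_eq_zero hc, ampVec_eq_zero hc]
  obtain ⟨a, ha⟩ := exists_isSites_iff.2 hc
  rw [ampVec_of_isSites ha, ampVec_of_isSites ha]
  have ha0 : ∀ l, a l ≠ 0 := fun l e => by
    have := (ha.2 0).2 ⟨l, e⟩
    rw [hs] at this
    exact absurd this (by decide)
  -- With the first spin up the down spins share the remaining `N` sites.
  have hn : n < N + 1 := by
    by_contra hn
    have h1 : Function.Injective fun l : Fin n => (a l).pred (ha0 l) := fun x y h =>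
      ha.1.injective (Fin.pred_inj.1 h)
    have := Fintype.card_le_of_injective _ h1
    simp only [Fintype.card_fin] at this
    omega
  exact amp_reflectFirst_up hq1 hq3 hn hN a ha.1 ha0 hz hβ hβ'

theorem ampVec_reflectFirst_down {z : Fin (N + 1) → ℂ} (hq1 : bracket q ≠ 0) (hq3 : q ^ 3 = 1)
    (hz : IsRegular q z) (hβ : ∀ i, bracket (β * z i) ≠ 0)
    (hβ' : bracket (β / z 0) ≠ 0) {s : Config (N + 1)} (hs : s 0 = 1) :
    bracket (β * z 0) * ampVec n q β (reflectFirst z) s =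
      bracket (β / z 0) * ampVec n q β z s := by
  by_cases hc : (univ.filter fun i => s i = 1).card = n
  swap
  · rw [ampVec_eq_zero hc, ampVec_eq_zero hc, mul_zero, mul_zero]
  obtain ⟨a, ha⟩ := exists_isSites_iff.2 hc
  rw [ampVec_of_isSites ha, ampVec_of_isSites ha]
  obtain ⟨l, hl⟩ := (ha.2 0).1 hs
  exact amp_reflectFirst_down hq1 hq3 a ha.1 hl hz hβ hβ'

theorem isRegular_snoc_inv (hq3 : q ^ 3 = 1) {x : Fin N → ℂ} {y : ℂ}
    (hz : IsRegular q (snocParam x y)) : IsRegular q (snocParam x y⁻¹) := by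
  have := hz.update_inv hq3 (Fin.last N)
  have h1 : snocParam x y (Fin.last N) = y := Fin.snoc_last (α := fun _ => ℂ) y x
  rw [h1] at this
  convert this using 1
  exact (Fin.update_snoc_last (α := fun _ => ℂ) y x y⁻¹).symm

theorem ampVec_reflectLast_up {x : Fin N → ℂ} {y : ℂ} (hq3 : q ^ 3 = 1)
    (hz : IsRegular q (snocParam x y)) {s : Config (N + 1)} (hs : s (Fin.last N) = 0) :
    ampVec n q β (snocParam x y⁻¹) s = ampVec n q β (snocParam x y) s := by
  by_cases hc : (univ.filter fun i => s i = 1).card = n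
  swap
  · rw [ampVec_eq_zero hc, ampVec_eq_zero hc]
  obtain ⟨a, ha⟩ := exists_isSites_iff.2 hc
  rw [ampVec_of_isSites ha, ampVec_of_isSites ha]
  have ha0 : ∀ l, a l ≠ Fin.last N := fun l e => by
    have := (ha.2 _).2 ⟨l, e⟩
    rw [hs] at this
    exact absurd this (by decide)
  have hb : a = fun l => ((a l).castPred (ha0 l)).castSucc := by funext l; simp
  rw [hb]
  exact amp_reflect_last_up hq3 x y hz (isRegular_snoc_inv hq3 hz) _

/-- The last down spin is at the last site. -/
theorem IsSites.exists_eq_snoc {a : Fin n → Fin (N + 1)} {s : Config (N + 1)} (ha : IsSites a s)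
    (hs : s (Fin.last N) = 1) : ∃ (m : ℕ) (h : n = m + 1) (b : Fin m → Fin N), StrictMono b ∧
      a = (Fin.snoc (α := fun _ => Fin (N + 1)) (fun l => (b l).castSucc) (Fin.last N)) ∘
        Fin.cast h := by
  obtain ⟨l, hl⟩ := (ha.2 _).1 hs
  obtain ⟨m, rfl⟩ : ∃ m, n = m + 1 := ⟨n - 1, by have := Fin.pos l; omega⟩
  have hlast : a (Fin.last m) = Fin.last N := by
    refine le_antisymm (Fin.le_last _) ?_
    rw [← hl]
    exact ha.1.monotone (Fin.le_last l)
  have hne : ∀ l : Fin m, a l.castSucc ≠ Fin.last N := fun l e => by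
    rw [← hlast] at e
    exact (Fin.castSucc_lt_last l).ne (ha.1.injective e)
  refine ⟨m, rfl, fun l => (a l.castSucc).castPred (hne l), fun x y hxy => ?_, ?_⟩
  · rw [Fin.castPred_lt_castPred_iff]
    exact ha.1 (Fin.castSucc_lt_castSucc_iff.2 hxy)
  · funext l
    induction l using Fin.lastCases <;> simp [hlast]

/-- The right boundary has the same form as the left one with `β` replaced by `q * β` and the
parameter inverted. -/
theorem ampVec_reflectLast_down {x : Fin N → ℂ} {y : ℂ} (hq1 : bracket q ≠ 0) (hq3 : q ^ 3 = 1)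
    (hβ : β ≠ 0) (hN : 2 * n ≤ N + 1) (hz : IsRegular q (snocParam x y)) {s : Config (N + 1)}
    (hs : s (Fin.last N) = 1) :
    bracket (q * β * y) * ampVec n q β (snocParam x y⁻¹) s =
      bracket (q * β / y) * ampVec n q β (snocParam x y) s := by
  by_cases hc : (univ.filter fun i => s i = 1).card = n
  swap
  · rw [ampVec_eq_zero hc, ampVec_eq_zero hc, mul_zero, mul_zero]
  obtain ⟨a, ha⟩ := exists_isSites_iff.2 hc
  rw [ampVec_of_isSites ha, ampVec_of_isSites ha]
  obtain ⟨m, rfl, b, -, rfl⟩ := ha.exists_eq_snoc hs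
  exact amp_reflect_last_down hq1 hq3 hβ x y hz (isRegular_snoc_inv hq3 hz) (by omega) b

end VecReflect
end SixVertex

namespace SixVertex

open Finset Filter Topology

/-! ### Continuity in the parameters -/

section Continuity

variable {X : Type*} [TopologicalSpace X] {x₀ : X}

theorem _root_.ContinuousAt.bracket {f : X → ℂ} (hf : ContinuousAt f x₀) (h0 : f x₀ ≠ 0) :
    ContinuousAt (fun x => bracket (f x)) x₀ :=
  hf.sub (hf.inv₀ h0)

variable {N n : ℕ} {q β : ℂ}

/-- The conditions on the parameters under which the components are continuous. -/
structure IsOrderedRegular (q : ℂ) (z : Fin N → ℂ) : Prop where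
  ne_zero : ∀ i, z i ≠ 0
  div_ne : ∀ i j, i ≠ j → bracket (z i / z j) ≠ 0
  q_div_ne : ∀ i j, i ≤ j → bracket (q * z j / z i) ≠ 0
  q_sq_mul_ne : ∀ i j, bracket (q ^ 2 * z i * z j) ≠ 0

/-- If `a < k` the function vanishes identically near `x₀`; otherwise the denominators only involve
`j ≥ a ≥ k`. Hence the one-sided condition in `IsOrderedRegular`, which still holds at the
configuration `(y, q * y)` needed for fusion. -/
theorem continuousAt_siteFactor (hq : q ≠ 0) {z : X → Fin N → ℂ} (hz : ContinuousAt z x₀)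
    (h : IsOrderedRegular q (z x₀)) (a k : Fin N) :
    ContinuousAt (fun x => siteFactor q (z x) a (z x k)) x₀ := by
  have hc : ∀ i, ContinuousAt (fun x => z x i) x₀ := fun i => (continuousAt_pi.1 hz) i
  rcases lt_or_ge a k with hak | hak
  · have : (fun x => siteFactor q (z x) a (z x k)) =ᶠ[𝓝 x₀] fun _ => 0 := by
      filter_upwards [(hc k).eventually_ne (h.ne_zero k)] with x hx
      exact siteFactor_eq_zero hx hak
    exact continuousAt_const.congr this.symm
  · unfold siteFactor
    refine ContinuousAt.div (tendsto_finsetProd _ fun j _ => ?_)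
      (tendsto_finsetProd _ fun j _ => ?_) (prod_ne_zero_iff.2 fun j hj => ?_)
    · exact ((hc j).div (hc k) (h.ne_zero k)).bracket (div_ne_zero (h.ne_zero j) (h.ne_zero k))
    · exact ((continuousAt_const.mul (hc j)).div (hc k) (h.ne_zero k)).bracket
        (div_ne_zero (mul_ne_zero hq (h.ne_zero j)) (h.ne_zero k))
    · exact h.q_div_ne _ _ (hak.trans (mem_Ici.1 hj))

theorem continuousAt_pairFactor (hq : q ≠ 0) {f g : X → ℂ} (hf : ContinuousAt f x₀)
    (hg : ContinuousAt g x₀) (hf0 : f x₀ ≠ 0) (hg0 : g x₀ ≠ 0) :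
    ContinuousAt (fun x => pairFactor q (f x) (g x)) x₀ := by
  unfold pairFactor
  exact ((((((continuousAt_const.mul hg).div hf hf0).bracket
      (div_ne_zero (mul_ne_zero hq hg0) hf0)).mul
    ((hf.div hg hg0).bracket (div_ne_zero hf0 hg0))).mul
    (((continuousAt_const.mul hf).mul hg).bracket (mul_ne_zero (mul_ne_zero hq hf0) hg0))).mul
    (((continuousAt_const.mul hf).mul hg).bracket
      (mul_ne_zero (mul_ne_zero (pow_ne_zero 2 hq) hf0) hg0)))

theorem continuousAt_amp (hq : q ≠ 0) (hβ : β ≠ 0) {z : X → Fin N → ℂ} (hz : ContinuousAt z x₀)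
    (h : IsOrderedRegular q (z x₀)) (a : Fin n → Fin N) :
    ContinuousAt (fun x => amp q β (z x) a) x₀ := by
  have hc : ∀ i, ContinuousAt (fun x => z x i) x₀ := fun i => (continuousAt_pi.1 hz) i
  have h0 := h.ne_zero
  unfold amp prefactor nodeSum pairProd
  refine (continuousAt_const.mul (tendsto_finsetProd _ fun i _ => tendsto_finsetProd _
    fun j _ => ?_)).mul (tendsto_finsetSum _ fun σ _ => ?_)
  · exact ((((continuousAt_const.mul (hc j)).div (hc i) (h0 i)).bracket
      (div_ne_zero (mul_ne_zero hq (h0 j)) (h0 i))).mul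
      (((continuousAt_const.mul (hc i)).mul (hc j)).bracket
      (mul_ne_zero (mul_ne_zero (pow_ne_zero 2 hq) (h0 i)) (h0 j))))
  · refine ContinuousAt.mul (tendsto_finsetProd _ fun l _ => ?_) (ContinuousAt.mul
      (tendsto_finsetProd _ fun i _ => tendsto_finsetProd _ fun j _ =>
        continuousAt_pairFactor hq (hc _) (hc _) (h0 _) (h0 _)) (tendsto_finsetProd _ fun l _ =>
        ContinuousAt.mul ?_ (continuousAt_siteFactor hq hz h _ _)))
    · unfold nodeWeight
      refine ContinuousAt.inv₀ (tendsto_finsetProd _ fun j _ => ?_)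
        (prod_ne_zero_iff.2 fun j hj => h.div_ne _ _ (ne_of_mem_erase hj))
      exact ((hc j).div (hc _) (h0 _)).bracket (div_ne_zero (h0 j) (h0 _))
    · unfold oneFactor
      have hk := hc (σ l)
      have hk0 := h0 (σ l)
      refine ContinuousAt.div (((((continuousAt_const.mul hk).mul hk)).bracket ?_).mul
        ((continuousAt_const.mul hk).bracket ?_)) (tendsto_finsetProd _ fun j _ =>
          ((continuousAt_const.mul hk).mul (hc j)).bracket ?_) (prod_ne_zero_iff.2 fun j _ =>
          h.q_sq_mul_ne _ _)
      · exact mul_ne_zero (mul_ne_zero (pow_ne_zero 2 hq) hk0) hk0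
      · exact mul_ne_zero hβ hk0
      · exact mul_ne_zero (mul_ne_zero (pow_ne_zero 2 hq) hk0) (h0 j)

theorem continuousAt_ampVec (hq : q ≠ 0) (hβ : β ≠ 0) {z : X → Fin N → ℂ}
    (hz : ContinuousAt z x₀) (h : IsOrderedRegular q (z x₀)) (s : Config N) :
    ContinuousAt (fun x => ampVec n q β (z x) s) x₀ := by
  unfold ampVec
  split_ifs
  · exact continuousAt_amp hq hβ hz h _
  · exact continuousAt_const

end Continuity
end SixVertex

namespace SixVertex

open Finset Filter Topology

/-! ### Two additional parameters whose ratio approaches `q` -/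

section Recursion

variable {N m : ℕ} {q β : ℂ}

theorem IsRegular.of_snoc {x : Fin N → ℂ} {y : ℂ} (hz : IsRegular q (snocParam x y)) :
    IsRegular q x :=
  ⟨fun i => by simpa using hz.ne_zero i.castSucc,
    fun k i j => by simpa using hz.mul_ne k i.castSucc j.castSucc,
    fun k i j h => by
      simpa using hz.div_ne k i.castSucc j.castSucc ((Fin.castSucc_injective N).ne h)⟩

/-- Expanding first in `v` (up) and then in `u` (down) isolates the factor `[q v / u]`, which
vanishes at `u = q * v`. It multiplies the sum over the old nodes, while it cancels in the
contribution of the node `u`. The formula is therefore continuous at the fusion point, where only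
that node survives. -/
theorem amp_snoc_snoc (hq1 : bracket q ≠ 0) (x : Fin N → ℂ) (u v : ℂ)
    (hz : IsRegular q (snocParam (snocParam x u) v)) (b : Fin m → Fin N) :
    amp q β (snocParam (snocParam x u) v)
        (fun l => (Fin.snoc (α := fun _ => Fin (N + 1)) (fun l => (b l).castSucc) (Fin.last N)
          l).castSucc) =
      bracket q ^ (m + 1) * (prefactor q x * ∏ i, (bracket (q * u / x i) * bracket (q ^ 2 * x i * u)))
        * (∏ i, (bracket (q * v / x i) * bracket (q ^ 2 * x i * v))) * nodeSum x fun w =>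
        pairProd (fun i j => pairFactor q (w i) (w j)) *
          (∏ l, (oneFactor q β x (w l) * siteFactor q x (b l) (w l) *
            (bracket (q * u / w l) * bracket (q ^ 2 * w l * u))⁻¹ *
            (bracket (q * v / w l) * bracket (q ^ 2 * w l * v))⁻¹)) *
          (bracket (q * v / u) * bracket (q ^ 2 * u * v) *
            (∑ k, nodeWeight x k * (bracket (u / x k))⁻¹ *
              (oneFactor q β x (x k) / bracket (q ^ 2 * x k * u)) * (bracket (q * u / x k))⁻¹ *
              (∏ l, pairFactor q (w l) (x k)) *
              (bracket (q * v / x k) * bracket (q ^ 2 * x k * v))⁻¹) +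
            (∏ j, bracket (x j / u))⁻¹ * (bracket (β * u) * (∏ j, bracket (q ^ 2 * u * x j))⁻¹) *
              (bracket q)⁻¹ * ∏ l, pairFactor q (w l) u) := by
  have hu := hz.of_snoc
  have hu0 : u ≠ 0 := by simpa using hu.ne_zero (Fin.last N)
  have h1 : bracket (q * v / u) ≠ 0 := by
    simpa using hz.q_div_ne hq1 (Fin.last _) (Fin.last N).castSucc
  have h2 : bracket (q ^ 2 * u * v) ≠ 0 := by
    simpa using hz.mul_ne 2 (Fin.last N).castSucc (Fin.last _)
  have h3 : bracket (q ^ 2 * u * u) ≠ 0 := by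
    simpa using hu.mul_ne 2 (Fin.last N) (Fin.last _)
  rw [amp_snoc_castSucc _ _ hz, prefactor_snoc, prefactor_snoc, Fin.prod_univ_castSucc (n := N)]
  simp only [Fin.snoc_castSucc, Fin.snoc_last]
  have hG := nodeSum_snoc_last (β := β) x u hu b fun w =>
    pairProd (fun i j => pairFactor q (w i) (w j)) *
      ∏ l, (bracket (q * v / w l) * bracket (q ^ 2 * w l * v))⁻¹
  have e1 : ∀ w : Fin (m + 1) → ℂ, pairProd (fun i j => pairFactor q (w i) (w j)) *
      ∏ l, (oneFactor q β (snocParam x u) (w l) * siteFactor q (snocParam x u)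
        (Fin.snoc (α := fun _ => Fin (N + 1)) (fun l => (b l).castSucc) (Fin.last N) l) (w l) *
          (bracket (q * v / w l) * bracket (q ^ 2 * w l * v))⁻¹) =
      (pairProd (fun i j => pairFactor q (w i) (w j)) *
      ∏ l, (bracket (q * v / w l) * bracket (q ^ 2 * w l * v))⁻¹) *
      ∏ l, (oneFactor q β (snocParam x u) (w l) * siteFactor q (snocParam x u)
        (Fin.snoc (α := fun _ => Fin (N + 1)) (fun l => (b l).castSucc) (Fin.last N) l) (w l)) := by
    intro w
    rw [prod_mul_distrib]
    ring
  simp only [e1]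
  rw [hG]
  have key : ∀ A B P c F G : ℂ, c * F = G → A * (B * (P * c)) * F = A * B * P * G := by
    rintro A B P c F G rfl
    ring
  apply key
  rw [← nodeSum_const_mul]
  refine nodeSum_congr fun σ => ?_
  have h4 : nodeWeight (snocParam x u) (Fin.last N) = (∏ j, bracket (x j / u))⁻¹ :=
    nodeWeight_snoc_last x u
  have h5 : oneFactor q β (snocParam x u) u = bracket (β * u) * (∏ j, bracket (q ^ 2 * u * x j))⁻¹ := by
    rw [oneFactor_snoc, oneFactor, div_div, div_eq_iff
      (mul_ne_zero (prod_ne_zero_iff.2 fun j _ => ?_) h3)]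
    · have : ∏ j, bracket (q ^ 2 * u * x j) ≠ 0 := prod_ne_zero_iff.2 fun j _ => by
        simpa using hu.mul_ne 2 (Fin.last N) j.castSucc
      field_simp
    · simpa using hu.mul_ne 2 (Fin.last N) j.castSucc
  simp only [Fin.sum_univ_castSucc, Fin.prod_univ_castSucc (n := m), pairProd_castSucc,
    Fin.snoc_castSucc, Fin.snoc_last, nodeWeight_snoc_castSucc, h4, h5, oneFactor_snoc x u (x _),
    mul_div_assoc q u u, div_self hu0, mul_one, prod_mul_distrib, mul_sum, mul_add]
  congr 1
  · refine sum_congr rfl fun k _ => ?_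
    ring
  · have key2 : ∀ c O M A B R : ℂ, c ≠ 0 →
        c * (O * (M * ((A * B) * (R * c⁻¹)))) = A * (O * R) * (M * B) := by
      intro c O M A B R hc
      field_simp
    exact key2 _ _ _ _ _ _ (mul_ne_zero h1 h2)

attribute [fun_prop] ContinuousAt.bracket

/-- At `u = q * v₀` the factors coupling an old integration variable to the new ones reduce to `-1`
(`hnode`), giving `(-1) ^ m`, and the prefactors of each old site simplify with another `-1`
(`hterm`), giving `(-1) ^ N`. -/
theorem tendsto_amp_snoc_snoc (hq1 : bracket q ≠ 0) (hq3 : q ^ 3 = 1) (hβ : β ≠ 0) (x : Fin N → ℂ)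
    (v₀ : ℂ) (hx : IsRegular q (snocParam x v₀)) (b : Fin m → Fin N) {ι : Type*} {l : Filter ι}
    {u v : ι → ℂ} (hu : Tendsto u l (𝓝 (q * v₀))) (hv : Tendsto v l (𝓝 v₀))
    (huv : ∀ᶠ t in l, IsRegular q (snocParam (snocParam x (u t)) (v t))) :
    Tendsto (fun t => amp q β (snocParam (snocParam x (u t)) (v t))
        (fun l => (Fin.snoc (α := fun _ => Fin (N + 1)) (fun l => (b l).castSucc) (Fin.last N)
          l).castSucc)) l (𝓝 ((-1) ^ m * (-1) ^ N * bracket (β * (q * v₀)) *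
            (∏ i, (bracket (q * (q * v₀) / x i) * bracket (q * x i * (q * v₀)))) * amp q β x b)) := by
  have hq := ne_zero_of_pow_three hq3
  have hv0 : v₀ ≠ 0 := by simpa using hx.ne_zero (Fin.last N)
  have hx0 := hx.of_snoc.ne_zero
  have hqv : ∀ i, bracket (q * (q * v₀) / x i) ≠ 0 := fun i => by
    have := hx.div_ne 2 (Fin.last N) i.castSucc (Fin.castSucc_lt_last i).ne'
    simpa [sq, mul_assoc] using this
  have hqqv : ∀ i, bracket (q ^ 2 * x i * (q * v₀)) ≠ 0 := fun i => by
    have := hx.mul_ne 3 i.castSucc (Fin.last N)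
    simp only [Fin.snoc_castSucc, Fin.snoc_last] at this
    rwa [show q ^ 2 * x i * (q * v₀) = q ^ 3 * x i * v₀ by ring]
  have hv1 : ∀ i, bracket (q * v₀ / x i) ≠ 0 := fun i => by
    have := hx.div_ne 1 (Fin.last N) i.castSucc (Fin.castSucc_lt_last i).ne'
    simpa using this
  have hv2 : ∀ i, bracket (q ^ 2 * x i * v₀) ≠ 0 := fun i => by
    simpa using hx.mul_ne 2 i.castSucc (Fin.last N)
  have hv3 : ∀ i, bracket (x i / (q * v₀)) ≠ 0 := fun i => by
    rw [bracket_div_comm, neg_ne_zero]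
    exact hv1 i
  have hqqv' : ∀ i, bracket (q ^ 2 * (q * v₀) * x i) ≠ 0 := fun i => by
    rw [show q ^ 2 * (q * v₀) * x i = q ^ 2 * x i * (q * v₀) by ring]
    exact hqqv i
  have hlim := hu.prodMk_nhds hv
  have hF : ContinuousAt (fun p : ℂ × ℂ => bracket q ^ (m + 1) * (prefactor q x *
      ∏ i, (bracket (q * p.1 / x i) * bracket (q ^ 2 * x i * p.1)))
        * (∏ i, (bracket (q * p.2 / x i) * bracket (q ^ 2 * x i * p.2))) * nodeSum x fun w =>
        pairProd (fun i j => pairFactor q (w i) (w j)) *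
          (∏ l, (oneFactor q β x (w l) * siteFactor q x (b l) (w l) *
            (bracket (q * p.1 / w l) * bracket (q ^ 2 * w l * p.1))⁻¹ *
            (bracket (q * p.2 / w l) * bracket (q ^ 2 * w l * p.2))⁻¹)) *
          (bracket (q * p.2 / p.1) * bracket (q ^ 2 * p.1 * p.2) *
            (∑ k, nodeWeight x k * (bracket (p.1 / x k))⁻¹ *
              (oneFactor q β x (x k) / bracket (q ^ 2 * x k * p.1)) * (bracket (q * p.1 / x k))⁻¹ *
              (∏ l, pairFactor q (w l) (x k)) *
              (bracket (q * p.2 / x k) * bracket (q ^ 2 * x k * p.2))⁻¹) +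
            (∏ j, bracket (x j / p.1))⁻¹ * (bracket (β * p.1) *
              (∏ j, bracket (q ^ 2 * p.1 * x j))⁻¹) *
              (bracket q)⁻¹ * ∏ l, pairFactor q (w l) p.1)) (q * v₀, v₀) := by
    simp only [nodeSum, pairFactor]
    fun_prop (disch := simp [hq, hv0, hx0, hβ, hqv, hqqv, hv1, hv2, hv3, hqqv', prod_eq_zero_iff])
  have hT := hF.tendsto.comp hlim
  refine (hT.congr' ?_).trans_eq ?_
  · filter_upwards [huv] with t ht
    rw [amp_snoc_snoc hq1 x _ _ ht]
    rfl
  congr 1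
  simp only [div_self (mul_ne_zero hq hv0), bracket_one, zero_mul, zero_add]
  have hterm : ∀ i, bracket (q * (q * v₀) / x i) * bracket (q ^ 2 * x i * (q * v₀)) *
      ((bracket (q * v₀ / x i) * bracket (q ^ 2 * x i * v₀)) *
      ((bracket (x i / (q * v₀)))⁻¹ * (bracket (q ^ 2 * (q * v₀) * x i))⁻¹)) =
      (-1) * (bracket (q * (q * v₀) / x i) * bracket (q * x i * (q * v₀))) := fun i => by
    have h1 := hv1 i
    have h2 := hqqv i
    rw [bracket_div_comm (x i), show q ^ 2 * (q * v₀) * x i = q ^ 2 * x i * (q * v₀) by ring,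
      show q * x i * (q * v₀) = q ^ 2 * x i * v₀ by ring]
    generalize bracket (q * v₀ / x i) = A at *
    generalize bracket (q ^ 2 * x i * (q * v₀)) = B at *
    generalize bracket (q ^ 2 * x i * v₀) = C
    field_simp
  have hnode : ∀ i, (bracket (q * (q * v₀) / x i) * bracket (q ^ 2 * x i * (q * v₀)))⁻¹ *
      (bracket (q * v₀ / x i) * bracket (q ^ 2 * x i * v₀))⁻¹ * pairFactor q (x i) (q * v₀) = -1 :=
    fun i => by
      have h1 := hv1 i
      have h2 := hqqv i
      have h3 := hqv i
      have h4 := hv2 i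
      rw [pairFactor, bracket_div_comm (x i), show q * x i * (q * v₀) = q ^ 2 * x i * v₀ by ring]
      generalize bracket (q * v₀ / x i) = A at *
      generalize bracket (q ^ 2 * x i * (q * v₀)) = B at *
      generalize bracket (q ^ 2 * x i * v₀) = C at *
      generalize bracket (q * (q * v₀) / x i) = D at *
      field_simp
  have hsum : ∀ σ : Fin m → Fin N, (∏ l, (oneFactor q β x (x (σ l)) * siteFactor q x (b l) (x (σ l)) *
      (bracket (q * (q * v₀) / x (σ l)) * bracket (q ^ 2 * x (σ l) * (q * v₀)))⁻¹ *
      (bracket (q * v₀ / x (σ l)) * bracket (q ^ 2 * x (σ l) * v₀))⁻¹)) *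
      ∏ l, pairFactor q (x (σ l)) (q * v₀) =
      (-1) ^ m * ∏ l, (oneFactor q β x (x (σ l)) * siteFactor q x (b l) (x (σ l))) := fun σ => by
    have : ((-1 : ℂ)) ^ m = ∏ _l : Fin m, (-1 : ℂ) := by simp
    rw [this, ← prod_mul_distrib, ← prod_mul_distrib]
    refine prod_congr rfl fun l _ => ?_
    linear_combination (oneFactor q β x (x (σ l)) * siteFactor q x (b l) (x (σ l))) * hnode (σ l)
  have hprod := prod_congr (rfl : (univ : Finset (Fin N)) = univ) fun i _ => hterm i
  simp only [prod_mul_distrib (f := fun _ => (-1 : ℂ)), prod_const, card_univ, Fintype.card_fin] at hprod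
  rw [prod_mul_distrib, prod_mul_distrib (f := fun i => bracket (q * v₀ / x i) * _),
    prod_mul_distrib (f := fun i => (bracket (x i / (q * v₀)))⁻¹), prod_inv_distrib,
    prod_inv_distrib] at hprod
  set K := (∏ j, bracket (x j / (q * v₀)))⁻¹
  set K' := (∏ j, bracket (q ^ 2 * (q * v₀) * x j))⁻¹
  have hns : (nodeSum x fun w => pairProd (fun i j => pairFactor q (w i) (w j)) *
          (∏ l, (oneFactor q β x (w l) * siteFactor q x (b l) (w l) *
            (bracket (q * (q * v₀) / w l) * bracket (q ^ 2 * w l * (q * v₀)))⁻¹ *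
            (bracket (q * v₀ / w l) * bracket (q ^ 2 * w l * v₀))⁻¹)) *
            (K * (bracket (β * (q * v₀)) * K') * (bracket q)⁻¹ * ∏ l, pairFactor q (w l) (q * v₀))) =
      (K * (bracket (β * (q * v₀)) * K') * (bracket q)⁻¹ * (-1) ^ m) * nodeSum x fun w =>
        pairProd (fun i j => pairFactor q (w i) (w j)) *
          ∏ l, (oneFactor q β x (w l) * siteFactor q x (b l) (w l)) := by
    rw [← nodeSum_const_mul]
    refine nodeSum_congr fun σ => ?_
    have := hsum σ
    simp only [Function.comp_apply]
    linear_combination (pairProd (fun i j => pairFactor q (x (σ i)) (x (σ j))) *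
      (K * (bracket (β * (q * v₀)) * K') * (bracket q)⁻¹)) * this
  rw [hns, amp, pow_succ]
  have hq1' := mul_inv_cancel₀ hq1
  generalize (nodeSum x fun w => _) = S
  generalize bracket (β * (q * v₀)) = B
  generalize (∏ i, bracket (q * (q * v₀) / x i) * bracket (q ^ 2 * x i * (q * v₀))) = P at *
  generalize (∏ i, bracket (q * v₀ / x i) * bracket (q ^ 2 * x i * v₀)) = P' at *
  generalize (∏ i, bracket (q * (q * v₀) / x i) * bracket (q * x i * (q * v₀))) = P'' at *
  linear_combination (bracket q ^ m * prefactor q x * S * (-1) ^ m * B) *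
    ((bracket q * (bracket q)⁻¹) * hprod + (-1) ^ N * P'' * hq1')

/-- At `(q * y, y)` a denominator `[q z_j / z_i]` with `i < j` would vanish; in the order `(y, q *
y)` the corresponding bracket is `[q²] ≠ 0`. -/
theorem isOrderedRegular_snoc_snoc (hq1 : bracket q ≠ 0) (hq3 : q ^ 3 = 1) {x : Fin N → ℂ} {y : ℂ}
    (hx : IsRegular q (snocParam x y)) :
    IsOrderedRegular q (snocParam (snocParam x y) (q * y)) := by
  have hq := ne_zero_of_pow_three hq3
  have hy : y ≠ 0 := by simpa using hx.ne_zero (Fin.last N)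
  have h0 : ∀ i, snocParam x y i ≠ 0 := hx.ne_zero
  have hsq : bracket (q ^ 2) ≠ 0 := by rw [bracket_sq hq3]; exact neg_ne_zero.2 hq1
  have hm : ∀ (k : ℕ) i, bracket (q ^ k * snocParam x y i * y) ≠ 0 := fun k i => by
    simpa using hx.mul_ne k i (Fin.last N)
  have hd : ∀ (k : ℕ) (i : Fin N), bracket (q ^ k * y / x i) ≠ 0 := fun k i => by
    simpa using hx.div_ne k (Fin.last N) i.castSucc (Fin.castSucc_lt_last i).ne'
  have hl : ∀ (k : ℕ) i, bracket (q ^ k * (q * y) / snocParam x y i) ≠ 0 ∨ i = Fin.last N := by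
    intro k i
    induction i using Fin.lastCases with
    | last => exact Or.inr rfl
    | cast i =>
      left
      have := hd (k + 1) i
      rw [pow_succ, mul_assoc] at this
      simpa using this
  have hdiv : ∀ i, bracket (q * y / snocParam x y i) ≠ 0 := fun i => by
    rcases hl 0 i with h | rfl
    · simpa using h
    · simp only [Fin.snoc_last]
      rwa [mul_div_assoc, div_self hy, mul_one]
  refine ⟨fun i => ?_, fun i j hij => ?_, fun i j hij => ?_, fun i j => ?_⟩
  · induction i using Fin.lastCases with
    | last => simpa using ⟨hq, hy⟩
    | cast i => simpa using h0 i
  · induction i using Fin.lastCases with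
    | last =>
      induction j using Fin.lastCases with
      | last => exact absurd rfl hij
      | cast j => simpa using hdiv j
    | cast i =>
      induction j using Fin.lastCases with
      | last =>
        rw [bracket_div_comm, neg_ne_zero]
        simpa using hdiv i
      | cast j =>
        have hne : i ≠ j := fun e => hij (by rw [e])
        simpa using hx.div_ne 0 i j hne
  · induction i using Fin.lastCases with
    | last =>
      have hj : j = Fin.last _ := le_antisymm (Fin.le_last _) hij
      rw [hj, mul_div_assoc, div_self, mul_one]
      · exact hq1
      · simpa using ⟨hq, hy⟩
    | cast i =>
      induction j using Fin.lastCases with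
      | last =>
        simp only [Fin.snoc_last, Fin.snoc_castSucc]
        rcases hl 1 i with h | rfl
        · simpa using h
        · simp only [Fin.snoc_last]
          rw [← mul_assoc, ← sq, mul_div_assoc, div_self hy, mul_one]
          exact hsq
      | cast j => simpa using hx.q_div_ne hq1 j i
  · induction i using Fin.lastCases with
    | last =>
      induction j using Fin.lastCases with
      | last =>
        have := hm 4 (Fin.last N)
        simp only [Fin.snoc_last] at this ⊢
        rwa [show q ^ 2 * (q * y) * (q * y) = q ^ 4 * y * y by ring]
      | cast j =>
        have := hm 3 j
        simp only [Fin.snoc_last, Fin.snoc_castSucc] at this ⊢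
        rwa [show q ^ 2 * (q * y) * snocParam x y j = q ^ 3 * snocParam x y j * y by ring]
    | cast i =>
      induction j using Fin.lastCases with
      | last =>
        have := hm 3 i
        simp only [Fin.snoc_last, Fin.snoc_castSucc] at this ⊢
        rwa [show q ^ 2 * snocParam x y i * (q * y) = q ^ 3 * snocParam x y i * y by ring]
      | cast j => simpa using hx.mul_ne 2 i j

theorem snoc_snoc_comp_swap {α : Type*} (x : Fin N → α) (u v : α) :
    (Fin.snoc (α := fun _ => α) (Fin.snoc (α := fun _ => α) x u) v : Fin (N + 2) → α) ∘
        Equiv.swap (Fin.last N).castSucc (Fin.last (N + 1)) =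
      Fin.snoc (α := fun _ => α) (Fin.snoc (α := fun _ => α) x v) u := by
  funext i
  rw [Function.comp_apply]
  induction i using Fin.lastCases with
  | last => rw [Equiv.swap_apply_right]; simp
  | cast i =>
    induction i using Fin.lastCases with
    | last => rw [Equiv.swap_apply_left]; simp
    | cast i =>
      rw [Equiv.swap_apply_of_ne_of_ne]
      · simp
      · exact fun e => (Fin.castSucc_lt_last i).ne (Fin.castSucc_injective _ e)
      · exact (Fin.castSucc_lt_last _).ne

/-- The factor by which the vectors for `N + 2` and for `N` parameters differ in the limit. -/
noncomputable def recursionFactor (m : ℕ) (q β : ℂ) (x : Fin N → ℂ) (u : ℂ) : ℂ :=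
  (-1) ^ m * (-1) ^ N * bracket (β * u) * ∏ i, (bracket (q * u / x i) * bracket (q * x i * u))

/-- The components of the singlet of two spins. -/
noncomputable def singlet (a b : Fin 2) : ℂ := if a = b then 0 else if a = 1 then 1 else -1

theorem ampVec_snoc_snoc_eq {Z : Fin (N + 2) → ℂ} {s : Config N} {b : Fin m → Fin N}
    (hb : IsSites b s) :
    ampVec (m + 1) q β Z (Fin.snoc (α := fun _ => Fin 2) (Fin.snoc (α := fun _ => Fin 2) s 1) 0) =
      amp q β Z (fun l => (Fin.snoc (α := fun _ => Fin (N + 1)) (fun l => (b l).castSucc)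
        (Fin.last N) l).castSucc) := by
  apply ampVec_of_isSites
  constructor
  · intro i j hij
    rw [Fin.castSucc_lt_castSucc_iff]
    induction i using Fin.lastCases with
    | last => exact absurd hij (not_lt.2 (Fin.le_last _))
    | cast i =>
      induction j using Fin.lastCases with
      | last => simp [Fin.castSucc_lt_last]
      | cast j =>
        simp only [Fin.snoc_castSucc, Fin.castSucc_lt_castSucc_iff]
        exact hb.1 (Fin.castSucc_lt_castSucc_iff.1 hij)
  · intro i
    induction i using Fin.lastCases with
    | last => simp [(Fin.castSucc_lt_last _).ne]
    | cast i =>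
      simp only [Fin.snoc_castSucc, Fin.castSucc_inj]
      induction i using Fin.lastCases with
      | last => simpa using ⟨Fin.last m, by simp⟩
      | cast i =>
        simp only [Fin.snoc_castSucc, hb.2]
        constructor
        · rintro ⟨l, rfl⟩
          exact ⟨l.castSucc, by simp⟩
        · rintro ⟨l, hl⟩
          induction l using Fin.lastCases with
          | last => simp [(Fin.castSucc_lt_last _).ne'] at hl
          | cast l => exact ⟨l, by simpa using hl⟩

theorem card_filter_snoc_snoc (s : Config N) (a b : Fin 2) :
    (univ.filter fun i => (Fin.snoc (α := fun _ => Fin 2) (Fin.snoc (α := fun _ => Fin 2) s a) b :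
      Config (N + 2)) i = 1).card =
      (univ.filter fun i => s i = 1).card + (if a = 1 then 1 else 0) + (if b = 1 then 1 else 0) := by
  simp only [card_filter, Fin.sum_univ_castSucc, Fin.snoc_castSucc, Fin.snoc_last]

/-- The component `(1, 0)` is computed directly. The others follow from the exchange relation on the
last two sites: with the parameters exchanged the vector stays continuous, and its coefficient `[q v
/ u]` tends to zero. In the limit this forces equal spins to vanish and `(0, 1)` to be the negative
of `(1, 0)`. -/
theorem tendsto_ampVec_snoc_snoc (hq1 : bracket q ≠ 0) (hq3 : q ^ 3 = 1) (hβ : β ≠ 0)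
    (x : Fin N → ℂ) (v₀ : ℂ) (hx : IsRegular q (snocParam x v₀)) {ι : Type*} {l : Filter ι}
    {u v : ι → ℂ} (hu : Tendsto u l (𝓝 (q * v₀))) (hv : Tendsto v l (𝓝 v₀))
    (huv : ∀ᶠ t in l, IsRegular q (snocParam (snocParam x (u t)) (v t))) (s : Config N)
    (a b : Fin 2) :
    Tendsto (fun t => ampVec (m + 1) q β (snocParam (snocParam x (u t)) (v t))
        (Fin.snoc (α := fun _ => Fin 2) (Fin.snoc (α := fun _ => Fin 2) s a) b)) l
      (𝓝 (singlet a b * recursionFactor m q β x (q * v₀) * ampVec m q β x s)) := by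
  have hq := ne_zero_of_pow_three hq3
  have hv0 : v₀ ≠ 0 := by simpa using hx.ne_zero (Fin.last N)
  have hadj : ((Fin.last N).castSucc : Fin (N + 2)).val + 1 = (Fin.last (N + 1)).val := by simp
  have hlim := hu.prodMk_nhds hv
  have hcont : ∀ S, ContinuousAt (fun p : ℂ × ℂ =>
      ampVec (m + 1) q β (snocParam (snocParam x p.2) p.1) S) (q * v₀, v₀) := by
    refine fun S => continuousAt_ampVec
      (z := fun p : ℂ × ℂ => snocParam (snocParam x p.2) p.1) hq hβ (continuousAt_pi.2 fun i => ?_)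
      (isOrderedRegular_snoc_snoc hq1 hq3 hx) S
    induction i using Fin.lastCases with
    | last => simpa using continuousAt_fst
    | cast i =>
      induction i using Fin.lastCases with
      | last => simpa using continuousAt_snd
      | cast i => simpa using continuousAt_const
  -- The exchanged side of every exchange relation disappears in the limit.
  have hV : ∀ S, Tendsto (fun t => bracket (q * v t / u t) *
      ampVec (m + 1) q β (snocParam (snocParam x (v t)) (u t)) S) l (𝓝 0) := fun S => by
    have h1 : ContinuousAt (fun p : ℂ × ℂ => bracket (q * p.2 / p.1)) (q * v₀, v₀) := by
      fun_prop (disch := simp [hq, hv0])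
    have := (h1.tendsto.comp hlim).mul ((hcont S).tendsto.comp hlim)
    simpa [div_self (mul_ne_zero hq hv0), bracket_one] using this
  have hdiv : Tendsto (fun t => bracket (u t / v t)) l (𝓝 (bracket q)) := by
    have h1 : ContinuousAt (fun p : ℂ × ℂ => bracket (p.1 / p.2)) (q * v₀, v₀) := by
      fun_prop (disch := simp [hq, hv0])
    simpa [hv0, Function.comp_def] using h1.tendsto.comp hlim
  have hqdiv : Tendsto (fun t => bracket (q * u t / v t)) l (𝓝 (-bracket q)) := by
    have h1 : ContinuousAt (fun p : ℂ × ℂ => bracket (q * p.1 / p.2)) (q * v₀, v₀) := by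
      fun_prop (disch := simp [hq, hv0])
    have := h1.tendsto.comp hlim
    simp only [← mul_assoc, ← sq, mul_div_assoc, div_self hv0, mul_one] at this
    rw [← bracket_sq hq3]
    simpa [Function.comp_def, mul_div_assoc] using this
  have h10 : Tendsto (fun t => ampVec (m + 1) q β (snocParam (snocParam x (u t)) (v t))
        (Fin.snoc (α := fun _ => Fin 2) (Fin.snoc (α := fun _ => Fin 2) s 1) 0)) l
      (𝓝 (recursionFactor m q β x (q * v₀) * ampVec m q β x s)) := by
    by_cases hc : (univ.filter fun i => s i = 1).card = m
    · obtain ⟨b, hb⟩ := exists_isSites_iff.2 hc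
      simp only [ampVec_snoc_snoc_eq hb, ampVec_of_isSites hb]
      exact tendsto_amp_snoc_snoc hq1 hq3 hβ x v₀ hx b hu hv huv
    · have hc' := card_filter_snoc_snoc s 1 0
      rw [ampVec_eq_zero hc, mul_zero]
      refine tendsto_const_nhds.congr fun t => (ampVec_eq_zero ?_).symm
      simp only [hc', if_true, if_neg (zero_ne_one (α := Fin 2))]
      omega
  by_cases hab : a = b
  · subst hab
    rw [singlet, if_pos rfl, zero_mul, zero_mul]
    have := (hV (Fin.snoc (α := fun _ => Fin 2) (Fin.snoc (α := fun _ => Fin 2) s a) a)).div hqdiv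
      (neg_ne_zero.2 hq1)
    rw [zero_div] at this
    refine this.congr' ?_
    filter_upwards [huv] with t ht
    have h1 := ampVec_swap_of_eq (n := m + 1) (β := β) hq hq1 ht hadj
      (s := Fin.snoc (α := fun _ => Fin 2) (Fin.snoc (α := fun _ => Fin 2) s a) a) (by simp)
    rw [snoc_snoc_comp_swap] at h1
    simp only [Fin.snoc_last, Fin.snoc_castSucc] at h1
    have h2 : bracket (q * u t / v t) ≠ 0 := by
      simpa using ht.q_div_ne hq1 (Fin.last N).castSucc (Fin.last _)
    rw [Pi.div_apply, div_eq_iff h2, h1, mul_comm]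
  · by_cases ha : a = 1
    · obtain rfl : b = 0 := by omega
      subst ha
      simpa [singlet] using h10
    · obtain rfl : a = 0 := by omega
      obtain rfl : b = 1 := by omega
      have := ((hV (Fin.snoc (α := fun _ => Fin 2) (Fin.snoc (α := fun _ => Fin 2) s 0) 1)).sub
        (hdiv.mul h10)).div (tendsto_const_nhds (x := bracket q)) hq1
      refine (this.congr' ?_).trans_eq ?_
      · filter_upwards [huv] with t ht
        have h1 := ampVec_swap_of_ne (n := m + 1) (β := β) hq hq1 ht hadj
          (s := Fin.snoc (α := fun _ => Fin 2) (Fin.snoc (α := fun _ => Fin 2) s 0) 1) (by simp)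
        rw [snoc_snoc_comp_swap, snoc_snoc_comp_swap] at h1
        simp only [Fin.snoc_last, Fin.snoc_castSucc] at h1
        rw [Pi.div_apply, div_eq_iff hq1, h1]
        ring
      · congr 1
        simp only [singlet]
        field_simp
        simp

end Recursion
end SixVertex

namespace SixVertex

open Finset

/-! ### The action of the transfer matrix -/

section Action

variable {N M : ℕ} {q β : ℂ}

theorem leg1_diagonal_mulVec (d : Fin 2 → ℂ) (i : Fin M) (X : Config M → ℂ) (s : Config M) :
    (leg1 (Matrix.diagonal d) i).mulVec X s = d (s i) * X s := by
  unfold Matrix.mulVec dotProduct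
  rw [sum_eq_single s]
  · simp [leg1]
  · intro t _ ht
    simp only [leg1, Matrix.of_apply]
    split_ifs with h
    · have : s i ≠ t i := fun e => ht (funext fun k => by
        by_cases hk : k = i
        · rw [hk, e]
        · exact (h k hk).symm)
      rw [Matrix.diagonal_apply_ne _ this, zero_mul]
    · rw [zero_mul]
  · simp

/-- By spin conservation, row `s` meets only `s` itself and `s` with the two spins exchanged. -/
theorem leg2_RMatrix_mulVec (r : ℂ) {i j : Fin M} (X : Config M → ℂ) (s : Config M) :
    (leg2 (RMatrix q r) i j).mulVec X s =
      if s i = s j then bracket (q * r) / bracket (q / r) * X s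
      else bracket r / bracket (q / r) * X s +
        bracket q / bracket (q / r) * X (s ∘ Equiv.swap i j) := by
  have hterm : ∀ t, t ≠ s → t ≠ s ∘ Equiv.swap i j → leg2 (RMatrix q r) i j s t * X t = 0 := by
    intro t h1 h2
    rw [leg2, Matrix.of_apply]
    split_ifs with h
    · rw [RMatrix, Matrix.of_apply, if_neg, if_neg, zero_mul]
      · intro e
        simp only [Prod.swap, Prod.mk.injEq] at e
        refine h2 (funext fun k => ?_)
        by_cases hki : k = i
        · rw [hki, Function.comp_apply, Equiv.swap_apply_left, e.2]
        · by_cases hkj : k = j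
          · rw [hkj, Function.comp_apply, Equiv.swap_apply_right, e.1]
          · rw [Function.comp_apply, Equiv.swap_apply_of_ne_of_ne hki hkj, h k hki hkj]
      · intro e
        simp only [Prod.mk.injEq] at e
        refine h1 (funext fun k => ?_)
        by_cases hki : k = i
        · rw [hki, e.1]
        · by_cases hkj : k = j
          · rw [hkj, e.2]
          · rw [h k hki hkj]
    · rw [zero_mul]
  unfold Matrix.mulVec dotProduct
  by_cases hs : s i = s j
  · have hsw : s ∘ Equiv.swap i j = s := by
      funext k
      rw [Function.comp_apply, Equiv.swap_apply_def]
      split_ifs with h1 h2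
      · rw [h1, hs]
      · rw [h2, hs]
      · rfl
    rw [if_pos hs, sum_eq_single s (fun t _ ht => hterm t ht (by rwa [hsw])) (by simp)]
    simp [leg2, RMatrix, hs]
  · have hsw : s ∘ Equiv.swap i j ≠ s := fun e => hs (by
      have := congrFun e i
      rw [Function.comp_apply, Equiv.swap_apply_left] at this
      exact this.symm)
    rw [if_neg hs, ← sum_subset (subset_univ {s, s ∘ Equiv.swap i j}) (fun t _ ht => by
      simp only [mem_insert, mem_singleton, not_or] at ht
      exact hterm t ht.1 ht.2), sum_pair hsw.symm]
    have h1 : ∀ k, k ≠ i → k ≠ j → s k = s (Equiv.swap i j k) := fun k hi hj => by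
      rw [Equiv.swap_apply_of_ne_of_ne hi hj]
    have h2 : ¬(s i = s j ∧ s j = s i) := fun h => hs h.1
    simp only [leg2, RMatrix, Matrix.of_apply, Function.comp_apply, Equiv.swap_apply_left,
      Equiv.swap_apply_right, Prod.mk.injEq, Prod.swap, if_true, if_neg hs, h2, if_false, and_self,
      if_pos h1, implies_true]

theorem ofFn_prod_mulVec {ι : Type*} [Fintype ι] [DecidableEq ι] (A : Fin N → Matrix ι ι ℂ)
    (Φ : Fin (N + 1) → ι → ℂ) (h : ∀ i, (A i).mulVec (Φ i.succ) = Φ i.castSucc) :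
    (List.ofFn A).prod.mulVec (Φ (Fin.last N)) = Φ 0 := by
  induction N with
  | zero => simp
  | succ N ih =>
    rw [List.ofFn_succ, List.prod_cons, ← Matrix.mulVec_mulVec, ← Fin.succ_last,
      ih (fun i => A i.succ) (fun i => Φ i.succ) fun i => h i.succ]
    exact h 0

theorem ofFn_reverse_prod_mulVec {ι : Type*} [Fintype ι] [DecidableEq ι]
    (A : Fin N → Matrix ι ι ℂ) (Φ : Fin (N + 1) → ι → ℂ)
    (h : ∀ i, (A i).mulVec (Φ i.castSucc) = Φ i.succ) :
    (List.ofFn A).reverse.prod.mulVec (Φ 0) = Φ (Fin.last N) := by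
  induction N with
  | zero => simp
  | succ N ih =>
    rw [List.ofFn_succ, List.reverse_cons, List.prod_append, List.prod_singleton,
      ← Matrix.mulVec_mulVec, ← Fin.succ_last]
    have h0 := h 0
    rw [Fin.castSucc_zero] at h0
    rw [h0]
    exact ih (fun i => A i.succ) (fun i => Φ i.succ) fun i => h i.succ

/-- The vector `ψ` together with the spin `a` in the auxiliary space. -/
noncomputable def auxVec (a : Fin 2) (ψ : Config N → ℂ) : Config (N + 1) → ℂ :=
  fun S => if S 0 = a then ψ (Fin.tail S) else 0

theorem partialTrace_mulVec (A : Matrix (Config (N + 1)) (Config (N + 1)) ℂ) (ψ : Config N → ℂ)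
    (s : Config N) :
    (partialTrace A).mulVec ψ s = ∑ a, A.mulVec (auxVec a ψ) (Fin.cons a s) := by
  simp only [Matrix.mulVec, dotProduct, partialTrace, Matrix.of_apply, sum_mul]
  rw [sum_comm]
  refine sum_congr rfl fun a _ => ?_
  rw [← (Fin.consEquiv fun _ : Fin (N + 1) => Fin 2).sum_comp, Fintype.sum_prod_type]
  rw [sum_eq_single a]
  · simp [auxVec, Fin.consEquiv]
  · intro b _ hb
    simp [auxVec, Fin.consEquiv, hb]
  · simp

theorem swap_castSucc_succAbove (i k : Fin N) :
    Equiv.swap i.castSucc i.succ (i.castSucc.succAbove k) = i.succ.succAbove k := by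
  simp only [Equiv.swap_apply_def, Fin.succAbove, Fin.ext_iff, Fin.lt_def]
  split_ifs <;> simp_all <;> omega

theorem insertNth_succ_comp_swap {α : Type*} (i : Fin N) (u : α) (z : Fin N → α) :
    Fin.insertNth (α := fun _ => α) i.succ u z ∘ Equiv.swap i.castSucc i.succ =
      Fin.insertNth (α := fun _ => α) i.castSucc u z := by
  rw [Fin.eq_insertNth_iff]
  constructor
  · simp
  · funext k
    simp [Fin.removeNth, swap_castSucc_succAbove]

theorem insertNth_castSucc_comp_swap {α : Type*} (i : Fin N) (u : α) (z : Fin N → α) :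
    Fin.insertNth (α := fun _ => α) i.castSucc u z ∘ Equiv.swap i.castSucc i.succ =
      Fin.insertNth (α := fun _ => α) i.succ u z := by
  rw [← insertNth_succ_comp_swap]
  funext k
  simp

/-- The configuration `S` with the auxiliary spin `S 0` moved to the site `p`. -/
def moveAux (p : Fin (N + 1)) (S : Config (N + 1)) : Config (N + 1) :=
  Fin.insertNth (α := fun _ => Fin 2) p (S 0) (Fin.tail S)

/-- Exchanging the auxiliary spin with the spin `i` has the effect of inserting the auxiliary spin
on the other side of that site. This translates operators `R_{0,i}` into adjacent exchanges. -/
theorem moveAux_succ_comp_swap (i : Fin N) (S : Config (N + 1)) :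
    moveAux i.succ (S ∘ Equiv.swap 0 i.succ) = moveAux i.castSucc S := by
  unfold moveAux
  rw [Fin.eq_insertNth_iff]
  have key : ∀ k, k ≠ i → i.castSucc.succAbove k = i.succ.succAbove k := fun k hk => by
    simp only [Fin.succAbove, Fin.ext_iff, Fin.lt_def, ne_eq] at *
    split_ifs <;> simp_all <;> omega
  constructor
  · rw [show i.castSucc = i.succ.succAbove i by simp, Fin.insertNth_apply_succAbove]
    simp [Fin.tail]
  · funext k
    by_cases hk : k = i
    · subst hk
      simp [Fin.removeNth, Fin.tail]
    · rw [Fin.removeNth, key k hk, Fin.insertNth_apply_succAbove]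
      have : (k.succ : Fin (N + 1)) ≠ i.succ := fun e => hk (Fin.succ_injective _ e)
      simp [Fin.tail, Equiv.swap_apply_of_ne_of_ne (Fin.succ_ne_zero k) this]

theorem moveAux_castSucc_comp_swap (i : Fin N) (S : Config (N + 1)) :
    moveAux i.castSucc (S ∘ Equiv.swap 0 i.succ) = moveAux i.succ S := by
  rw [← moveAux_succ_comp_swap]
  congr 1
  funext k
  simp

theorem moveAux_succ_comp (i : Fin N) (S : Config (N + 1)) :
    moveAux i.succ S ∘ Equiv.swap i.castSucc i.succ = moveAux i.castSucc S :=
  insertNth_succ_comp_swap _ _ _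

theorem moveAux_castSucc_comp (i : Fin N) (S : Config (N + 1)) :
    moveAux i.castSucc S ∘ Equiv.swap i.castSucc i.succ = moveAux i.succ S :=
  insertNth_castSucc_comp_swap _ _ _

theorem snoc_comp_swap {α : Type*} (f : Fin M → α) (v : α) (i j : Fin M) :
    (Fin.snoc (α := fun _ => α) f v : Fin (M + 1) → α) ∘ Equiv.swap i.castSucc j.castSucc =
      Fin.snoc (α := fun _ => α) (f ∘ Equiv.swap i j) v := by
  funext k
  rw [Function.comp_apply]
  induction k using Fin.lastCases with
  | last =>
    rw [Equiv.swap_apply_of_ne_of_ne (Fin.castSucc_lt_last i).ne' (Fin.castSucc_lt_last j).ne']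
    simp
  | cast k =>
    have : Equiv.swap i.castSucc j.castSucc k.castSucc = (Equiv.swap i j k).castSucc := by
      simp only [Equiv.swap_apply_def, Fin.castSucc_inj]
      split_ifs <;> rfl
    rw [this]
    simp

/-- The parameter `u` inserted at position `p` and `v` appended at the end. -/
abbrev stageParam (z : Fin N → ℂ) (p : Fin (N + 1)) (u v : ℂ) : Fin (N + 2) → ℂ :=
  snocParam (Fin.insertNth (α := fun _ => ℂ) p u z) v

theorem stageParam_comp_swap_succ (z : Fin N → ℂ) (i : Fin N) (u v : ℂ) :
    stageParam z i.succ u v ∘ Equiv.swap i.castSucc.castSucc i.succ.castSucc =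
      stageParam z i.castSucc u v := by
  rw [snoc_comp_swap, insertNth_succ_comp_swap]

theorem stageParam_comp_swap_castSucc (z : Fin N → ℂ) (i : Fin N) (u v : ℂ) :
    stageParam z i.castSucc u v ∘ Equiv.swap i.castSucc.castSucc i.succ.castSucc =
      stageParam z i.succ u v := by
  rw [snoc_comp_swap, insertNth_castSucc_comp_swap]

theorem isRegular_stageParam {z : Fin N → ℂ} {u v : ℂ}
    (h : IsRegular q (snocParam (snocParam z u) v)) (p : Fin (N + 1)) :
    IsRegular q (stageParam z p u v) := by
  induction p using Fin.reverseInduction with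
  | last => rwa [stageParam, Fin.insertNth_last']
  | cast i ih =>
    rw [← stageParam_comp_swap_succ]
    exact ih.comp_perm _

/-- The vector with the parameter `u` at the position `p`, the corresponding spin being regarded as
the auxiliary one, and the last spin `b` fixed. -/
noncomputable def stageVec (n : ℕ) (q β : ℂ) (z : Fin N → ℂ) (u v : ℂ) (b : Fin 2)
    (p : Fin (N + 1)) : Config (N + 1) → ℂ :=
  fun S => ampVec n q β (stageParam z p u v) (Fin.snoc (α := fun _ => Fin 2) (moveAux p S) b)

/-- This is the exchange relation reread: the R-matrix carries the parameter `u`, with its auxiliary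
spin, from the right of `z i` to the left. -/
theorem RMatrix_mulVec_stageVec_succ {n : ℕ} (hq : q ≠ 0) (hq1 : bracket q ≠ 0) {z : Fin N → ℂ}
    {u v : ℂ} (h : IsRegular q (snocParam (snocParam z u) v)) (b : Fin 2) (i : Fin N) :
    (leg2 (RMatrix q (z i / u)) 0 i.succ).mulVec (stageVec n q β z u v b i.succ) =
      stageVec n q β z u v b i.castSucc := by
  funext S
  have hi := isRegular_stageParam h i.succ
  have hadj : (i.castSucc.castSucc : Fin (N + 2)).val + 1 = (i.succ.castSucc : Fin (N + 2)).val := by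
    simp
  have hp1 : stageParam z i.succ u v i.castSucc.castSucc = z i := by
    simp only [Fin.snoc_castSucc]
    rw [show i.castSucc = i.succ.succAbove i by simp, Fin.insertNth_apply_succAbove]
  have hp2 : stageParam z i.succ u v i.succ.castSucc = u := by
    simp only [Fin.snoc_castSucc, Fin.insertNth_apply_same]
  have hd := hi.q_div_ne hq1 i.succ.castSucc i.castSucc.castSucc
  rw [hp1, hp2] at hd
  have hs1 : moveAux i.castSucc S i.castSucc = S 0 := by simp [moveAux]
  have hs2 : moveAux i.castSucc S i.succ = S i.succ := by
    rw [moveAux, show i.succ = i.castSucc.succAbove i by simp, Fin.insertNth_apply_succAbove]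
    simp [Fin.tail]
  rw [leg2_RMatrix_mulVec, div_div_eq_mul_div, mul_div_assoc' q (z i) u]
  unfold stageVec
  rw [moveAux_succ_comp_swap, ← stageParam_comp_swap_succ z i u v]
  split_ifs with hS
  · have h1 := ampVec_swap_of_eq (n := n) (β := β) hq hq1 hi hadj
      (s := Fin.snoc (α := fun _ => Fin 2) (moveAux i.castSucc S) b) (by
        simpa only [Fin.snoc_castSucc, hs1, hs2] using hS)
    rw [hp1, hp2] at h1
    have : moveAux i.succ S = moveAux i.castSucc S := by
      rw [← moveAux_castSucc_comp_swap]
      congr 1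
      funext k
      rw [Function.comp_apply, Equiv.swap_apply_def]
      split_ifs with h1 h2
      · rw [h1, hS]
      · rw [h2, hS]
      · rfl
    rw [this]
    rw [div_mul_eq_mul_div, div_eq_iff hd]
    linear_combination -h1
  · have h1 := ampVec_swap_of_ne (n := n) (β := β) hq hq1 hi hadj
      (s := Fin.snoc (α := fun _ => Fin 2) (moveAux i.castSucc S) b) (by
        simpa only [Fin.snoc_castSucc, hs1, hs2] using hS)
    rw [hp1, hp2, snoc_comp_swap (moveAux i.castSucc S), moveAux_castSucc_comp] at h1
    rw [div_mul_eq_mul_div, div_mul_eq_mul_div, ← add_div, div_eq_iff hd]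
    linear_combination -h1

/-- The same move in the opposite direction, with the inverse ratio as argument. -/
theorem RMatrix_mulVec_stageVec_castSucc {n : ℕ} (hq : q ≠ 0) (hq1 : bracket q ≠ 0)
    {z : Fin N → ℂ} {u v : ℂ} (h : IsRegular q (snocParam (snocParam z u) v)) (b : Fin 2)
    (i : Fin N) :
    (leg2 (RMatrix q (u / z i)) 0 i.succ).mulVec (stageVec n q β z u v b i.castSucc) =
      stageVec n q β z u v b i.succ := by
  funext S
  have hi := isRegular_stageParam h i.castSucc
  have hadj : (i.castSucc.castSucc : Fin (N + 2)).val + 1 = (i.succ.castSucc : Fin (N + 2)).val := by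
    simp
  have hp1 : stageParam z i.castSucc u v i.succ.castSucc = z i := by
    simp only [Fin.snoc_castSucc]
    rw [show i.succ = i.castSucc.succAbove i by simp, Fin.insertNth_apply_succAbove]
  have hp2 : stageParam z i.castSucc u v i.castSucc.castSucc = u := by simp
  have hd := hi.q_div_ne hq1 i.succ.castSucc i.castSucc.castSucc
  rw [hp1, hp2] at hd
  have hs1 : moveAux i.succ S i.succ = S 0 := by simp [moveAux]
  have hs2 : moveAux i.succ S i.castSucc = S i.succ := by
    rw [moveAux, show i.castSucc = i.succ.succAbove i by simp, Fin.insertNth_apply_succAbove]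
    simp [Fin.tail]
  rw [leg2_RMatrix_mulVec, div_div_eq_mul_div, mul_div_assoc' q u (z i)]
  unfold stageVec
  rw [moveAux_castSucc_comp_swap, ← stageParam_comp_swap_castSucc z i u v]
  split_ifs with hS
  · have h1 := ampVec_swap_of_eq (n := n) (β := β) hq hq1 hi hadj
      (s := Fin.snoc (α := fun _ => Fin 2) (moveAux i.succ S) b) (by
        simpa only [Fin.snoc_castSucc, hs1, hs2] using hS.symm)
    rw [hp1, hp2] at h1
    have : moveAux i.castSucc S = moveAux i.succ S := by
      rw [← moveAux_succ_comp_swap]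
      congr 1
      funext k
      rw [Function.comp_apply, Equiv.swap_apply_def]
      split_ifs with h1 h2
      · rw [h1, hS]
      · rw [h2, hS]
      · rfl
    rw [this]
    rw [div_mul_eq_mul_div, div_eq_iff hd]
    linear_combination -h1
  · have h1 := ampVec_swap_of_ne (n := n) (β := β) hq hq1 hi hadj
      (s := Fin.snoc (α := fun _ => Fin 2) (moveAux i.succ S) b)
      (by simpa only [Fin.snoc_castSucc, hs1, hs2] using Ne.symm hS)
    rw [hp1, hp2, snoc_comp_swap (moveAux i.succ S), moveAux_succ_comp] at h1
    rw [div_mul_eq_mul_div, div_mul_eq_mul_div, ← add_div, div_eq_iff hd]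
    linear_combination -h1

end Action
end SixVertex

namespace SixVertex

open Finset Filter Topology

/-! ### Genericity of the regularity conditions -/

section Generic

variable {N : ℕ} {q : ℂ}

theorem pow_mod_three (hq3 : q ^ 3 = 1) (k : ℕ) : q ^ k = q ^ (k % 3) := by
  conv_lhs => rw [← Nat.div_add_mod k 3, pow_add, pow_mul, hq3, one_pow, one_mul]

/-- Since `q ^ 3 = 1`, only exponents modulo three matter: regularity is a finite list of
conditions, so it can hold eventually along a limit. -/
theorem isRegular_of_sq_ne (hq3 : q ^ 3 = 1) {z : Fin N → ℂ} (h0 : ∀ i, z i ≠ 0)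
    (hm : ∀ (k : Fin 3) (i j), (q ^ (k : ℕ) * z i * z j) ^ 2 ≠ 1)
    (hd : ∀ (k : Fin 3) (i j), i ≠ j → (q ^ (k : ℕ) * z i / z j) ^ 2 ≠ 1) : IsRegular q z := by
  have hq := ne_zero_of_pow_three hq3
  refine ⟨h0, fun k i j => ?_, fun k i j hij => ?_⟩
  · rw [bracket_ne_zero_iff (mul_ne_zero (mul_ne_zero (pow_ne_zero k hq) (h0 i)) (h0 j)),
      pow_mod_three hq3]
    exact hm ⟨k % 3, Nat.mod_lt _ (by norm_num)⟩ i j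
  · rw [bracket_ne_zero_iff (div_ne_zero (mul_ne_zero (pow_ne_zero k hq) (h0 i)) (h0 j)),
      pow_mod_three hq3]
    exact hd ⟨k % 3, Nat.mod_lt _ (by norm_num)⟩ i j hij

theorem IsRegular.sq_mul_ne {z : Fin N → ℂ} (hz : IsRegular q z) (hq : q ≠ 0) (k : ℕ)
    (i j : Fin N) : (q ^ k * z i * z j) ^ 2 ≠ 1 :=
  (bracket_ne_zero_iff (mul_ne_zero (mul_ne_zero (pow_ne_zero k hq) (hz.ne_zero i))
    (hz.ne_zero j))).1 (hz.mul_ne k i j)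

theorem IsRegular.sq_div_ne {z : Fin N → ℂ} (hz : IsRegular q z) (hq : q ≠ 0) (k : ℕ)
    {i j : Fin N} (hij : i ≠ j) : (q ^ k * z i / z j) ^ 2 ≠ 1 :=
  (bracket_ne_zero_iff (div_ne_zero (mul_ne_zero (pow_ne_zero k hq) (hz.ne_zero i))
    (hz.ne_zero j))).1 (hz.div_ne k i j hij)

/-- A nontrivial power takes a given value only finitely often. -/
theorem eventually_pow_ne (x : ℂ) {n : ℕ} (hn : 0 < n) (c : ℂ) : ∀ᶠ t in 𝓝[≠] x, t ^ n ≠ c := by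
  have hfin : {t : ℂ | t ^ n = c}.Finite := by
    refine (Polynomial.nthRoots n c).toFinset.finite_toSet.subset fun t ht => ?_
    simpa [Polynomial.mem_nthRoots hn] using ht
  exact nhdsNE_le_cofinite x hfin.compl_mem_cofinite

theorem eventually_sq_mul_pow_ne (x : ℂ) {n : ℕ} (hn : 0 < n) (c : ℂ) :
    ∀ᶠ t in 𝓝[≠] x, (c * t ^ n) ^ 2 ≠ 1 := by
  by_cases hc : c = 0
  · simp [hc]
  · filter_upwards [eventually_pow_ne x (Nat.mul_pos hn two_pos) ((c ^ 2)⁻¹)] with t ht h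
    apply ht
    rw [pow_mul]
    refine eq_inv_of_mul_eq_one_left ?_
    rw [← h]
    ring

theorem eventually_isRegular_snoc (hq3 : q ^ 3 = 1) {x : Fin N → ℂ} (hx : IsRegular q x) (y : ℂ) :
    ∀ᶠ t in 𝓝[≠] y, IsRegular q (snocParam x t) := by
  have hq := ne_zero_of_pow_three hq3
  have h0 : ∀ᶠ t in 𝓝[≠] y, t ≠ 0 := by simpa using eventually_pow_ne y one_pos 0
  have h1 : ∀ᶠ t in 𝓝[≠] y, ∀ k : Fin 3, ∀ i, (q ^ (k : ℕ) * x i * t ^ 1) ^ 2 ≠ 1 :=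
    eventually_all.2 fun k => eventually_all.2 fun i => eventually_sq_mul_pow_ne y one_pos _
  have h2 : ∀ᶠ t in 𝓝[≠] y, ∀ k : Fin 3, ∀ i, (q ^ (k : ℕ) * (x i)⁻¹ * t ^ 1) ^ 2 ≠ 1 :=
    eventually_all.2 fun k => eventually_all.2 fun i => eventually_sq_mul_pow_ne y one_pos _
  have h3 : ∀ᶠ t in 𝓝[≠] y, ∀ k : Fin 3, ∀ i, ((q ^ (k : ℕ) * x i)⁻¹ * t ^ 1) ^ 2 ≠ 1 :=
    eventually_all.2 fun k => eventually_all.2 fun i => eventually_sq_mul_pow_ne y one_pos _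
  have h4 : ∀ᶠ t in 𝓝[≠] y, ∀ k : Fin 3, (q ^ (k : ℕ) * t ^ 2) ^ 2 ≠ 1 :=
    eventually_all.2 fun k => eventually_sq_mul_pow_ne y two_pos _
  filter_upwards [h0, h1, h2, h3, h4] with t h0 h1 h2 h3 h4
  refine isRegular_of_sq_ne hq3 (fun i => ?_) (fun k i j => ?_) fun k i j hij => ?_
  · induction i using Fin.lastCases with
    | last => simpa using h0
    | cast i => simpa using hx.ne_zero i
  · induction i using Fin.lastCases with
    | last =>
      induction j using Fin.lastCases with
      | last => simpa only [Fin.snoc_last, sq t, mul_assoc] using h4 k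
      | cast j =>
        simp only [Fin.snoc_last, Fin.snoc_castSucc, mul_right_comm _ t]
        simpa using h1 k j
    | cast i =>
      induction j using Fin.lastCases with
      | last => simpa using h1 k i
      | cast j => simpa using hx.sq_mul_ne hq k i j
  · induction i using Fin.lastCases with
    | last =>
      induction j using Fin.lastCases with
      | last => exact absurd rfl hij
      | cast j =>
        simp only [Fin.snoc_last, Fin.snoc_castSucc, div_eq_mul_inv, mul_right_comm _ t]
        simpa using h2 k j
    | cast i =>
      induction j using Fin.lastCases with
      | last =>
        have := h3 k i
        intro h
        apply this
        simp only [Fin.snoc_last, Fin.snoc_castSucc] at h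
        rw [← inv_inj, inv_one] at h
        rw [← h, ← inv_pow, inv_div, pow_one, div_eq_inv_mul]
      | cast j =>
        have hne : i ≠ j := fun e => hij (by rw [e])
        simpa using hx.sq_div_ne hq k hne

/-- A factor `q` only shifts the exponents in the conditions, by one or by two (`q⁻¹ = q ^ 2`), and
these cover all powers. -/
theorem IsRegular.snoc_q_mul {x : Fin N → ℂ} {y : ℂ} (hz : IsRegular q (snocParam x y))
    (hq3 : q ^ 3 = 1) : IsRegular q (snocParam x (q * y)) := by
  have hq := ne_zero_of_pow_three hq3
  have hx := hz.of_snoc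
  have hy : y ≠ 0 := by simpa using hz.ne_zero (Fin.last N)
  refine ⟨fun i => ?_, fun k i j => ?_, fun k i j hij => ?_⟩
  · induction i using Fin.lastCases with
    | last => simpa using ⟨hq, hy⟩
    | cast i => simpa using hx.ne_zero i
  · induction i using Fin.lastCases with
    | last =>
      induction j using Fin.lastCases with
      | last =>
        have := hz.mul_ne (k + 2) (Fin.last N) (Fin.last N)
        simp only [Fin.snoc_last] at this ⊢
        rwa [show q ^ k * (q * y) * (q * y) = q ^ (k + 2) * y * y by ring]
      | cast j =>
        have := hz.mul_ne (k + 1) (Fin.last N) j.castSucc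
        simp only [Fin.snoc_last, Fin.snoc_castSucc] at this ⊢
        rwa [show q ^ k * (q * y) * x j = q ^ (k + 1) * y * x j by ring]
    | cast i =>
      induction j using Fin.lastCases with
      | last =>
        have := hz.mul_ne (k + 1) i.castSucc (Fin.last N)
        simp only [Fin.snoc_last, Fin.snoc_castSucc] at this ⊢
        rwa [show q ^ k * x i * (q * y) = q ^ (k + 1) * x i * y by ring]
      | cast j => simpa using hx.mul_ne k i j
  · induction i using Fin.lastCases with
    | last =>
      induction j using Fin.lastCases with
      | last => exact absurd rfl hij
      | cast j =>
        have := hz.div_ne (k + 1) (Fin.last N) j.castSucc hij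
        simp only [Fin.snoc_last, Fin.snoc_castSucc] at this ⊢
        rwa [show q ^ k * (q * y) / x j = q ^ (k + 1) * y / x j by ring]
    | cast i =>
      induction j using Fin.lastCases with
      | last =>
        have := hz.div_ne (k + 2) i.castSucc (Fin.last N) hij
        simp only [Fin.snoc_last, Fin.snoc_castSucc] at this ⊢
        rwa [show q ^ k * x i / (q * y) = q ^ (k + 2) * x i / y by
          rw [div_eq_div_iff (mul_ne_zero hq hy) hy]
          linear_combination (-q ^ k * x i * y) * hq3]
      | cast j =>
        have hne : i ≠ j := fun e => hij (by rw [e])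
        simpa using hx.div_ne k i j hne

end Generic
end SixVertex

namespace SixVertex

open Finset Filter Topology

/-! ### The eigenvalue equation for regular parameters -/

section Eigen

variable {N m : ℕ} {q β β' : ℂ} {z : Fin N → ℂ} {w v : ℂ}

theorem moveAux_zero (S : Config (N + 1)) : moveAux 0 S = S := by
  rw [moveAux, Fin.insertNth_zero']
  exact Fin.cons_self_tail S

theorem stageParam_zero_reflectFirst (z : Fin N → ℂ) (u v : ℂ) :
    reflectFirst (stageParam z 0 u v) = stageParam z 0 u⁻¹ v := by
  funext i
  by_cases hi : i = 0
  · subst hi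
    rw [reflectFirst_zero]
    have : (0 : Fin (N + 2)) = (0 : Fin (N + 1)).castSucc := rfl
    rw [this]
    simp only [Fin.snoc_castSucc, Fin.insertNth_apply_same]
  · rw [reflectFirst_of_ne _ hi]
    induction i using Fin.lastCases with
    | last => simp
    | cast i =>
      have hi' : i ≠ 0 := fun e => hi (by rw [e]; rfl)
      obtain ⟨j, rfl⟩ := Fin.exists_succ_eq.2 hi'
      simp only [Fin.snoc_castSucc]
      rw [← Fin.zero_succAbove, Fin.insertNth_apply_succAbove, Fin.insertNth_apply_succAbove]

theorem isRegular_snoc_inv_snoc (hq3 : q ^ 3 = 1) (h : IsRegular q (snocParam (snocParam z w) v)) :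
    IsRegular q (snocParam (snocParam z w⁻¹) v) := by
  have h1 := ((h.comp_perm (Equiv.swap (Fin.last N).castSucc (Fin.last (N + 1)))))
  rw [snoc_snoc_comp_swap] at h1
  have h2 := (isRegular_snoc_inv hq3 h1).comp_perm
    (Equiv.swap (Fin.last N).castSucc (Fin.last (N + 1)))
  rwa [snoc_snoc_comp_swap] at h2

/-- At position `0` the auxiliary site is the leftmost one, and the K-matrix inverts its parameter
by the left reflection relations. -/
theorem KMatrix_mulVec_stageVec (hq1 : bracket q ≠ 0) (hq3 : q ^ 3 = 1) (hN : N ≤ 2 * m + 1)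
    (h : IsRegular q (snocParam (snocParam z w) v)) (hβz : ∀ i, bracket (β * z i) ≠ 0)
    (hβw : bracket (β * w) ≠ 0) (hβw' : bracket (β / w) ≠ 0) (hβv : bracket (β * v) ≠ 0)
    (b : Fin 2) :
    (leg1 (KMatrix w β) 0).mulVec (stageVec (m + 1) q β z w⁻¹ v b 0) =
      stageVec (m + 1) q β z w v b 0 := by
  funext S
  have hreg := isRegular_stageParam (isRegular_snoc_inv_snoc hq3 h) 0
  have h0 : stageParam z 0 w⁻¹ v 0 = w⁻¹ := by
    have : (0 : Fin (N + 2)) = (0 : Fin (N + 1)).castSucc := rfl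
    conv_lhs => arg 5; rw [this]
    simp only [Fin.snoc_castSucc, Fin.insertNth_apply_same]
  have hβ : ∀ i, bracket (β * stageParam z 0 w⁻¹ v i) ≠ 0 := fun i => by
    induction i using Fin.lastCases with
    | last => simpa using hβv
    | cast i =>
      simp only [Fin.snoc_castSucc]
      induction i using Fin.cases with
      | zero => simpa only [Fin.insertNth_apply_same, ← div_eq_mul_inv] using hβw'
      | succ i =>
        rw [← Fin.zero_succAbove, Fin.insertNth_apply_succAbove]
        exact hβz i
  have hβ0 : bracket (β / stageParam z 0 w⁻¹ v 0) ≠ 0 := by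
    rwa [h0, div_inv_eq_mul]
  have hS0 : (Fin.snoc (α := fun _ => Fin 2) S b : Config (N + 2)) 0 = S 0 := by
    have : (0 : Fin (N + 2)) = (0 : Fin (N + 1)).castSucc := rfl
    rw [this, Fin.snoc_castSucc]
  rw [KMatrix, leg1_diagonal_mulVec]
  unfold stageVec
  rw [moveAux_zero]
  have hr := stageParam_zero_reflectFirst z w⁻¹ v
  rw [inv_inv] at hr
  rw [← hr]
  by_cases hS : S 0 = 1
  · have := ampVec_reflectFirst_down (n := m + 1) hq1 hq3 hreg hβ hβ0
      (s := Fin.snoc (α := fun _ => Fin 2) S b) (by rw [hS0, hS])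
    rw [h0, div_inv_eq_mul, ← div_eq_mul_inv] at this
    rw [hS]
    simp only [Matrix.cons_val_one, Matrix.cons_val_fin_one]
    rw [div_mul_eq_mul_div, div_eq_iff hβw', mul_comm _ (bracket (β / w)), this]
  · have hS' := eq_zero_of_ne_one hS
    rw [ampVec_reflectFirst_up hq1 hq3 (by omega) hreg hβ hβ0 (by rw [hS0, hS']), hS']
    simp

/-- The operator obtained from the monodromy on the strip by omitting the last reflection. -/
noncomputable def openMonodromy (q β : ℂ) (z : Fin N → ℂ) (w : ℂ) :
    Matrix (Config (N + 1)) (Config (N + 1)) ℂ :=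
  (List.ofFn fun i : Fin N => leg2 (RMatrix q (w / z i)) 0 i.succ).reverse.prod
      * leg1 (KMatrix w β) 0
      * (List.ofFn fun i : Fin N => leg2 (RMatrix q (w * z i)) 0 i.succ).prod

/-- The parameter `w⁻¹` travels from the right of the `z i` to the left end, is reflected to `w`,
and travels back; the spectator `v` at the far right is untouched. -/
theorem openMonodromy_mulVec_stageVec (hq1 : bracket q ≠ 0) (hq3 : q ^ 3 = 1) (hN : N ≤ 2 * m + 1)
    (h : IsRegular q (snocParam (snocParam z w) v)) (hβz : ∀ i, bracket (β * z i) ≠ 0)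
    (hβw : bracket (β * w) ≠ 0) (hβw' : bracket (β / w) ≠ 0) (hβv : bracket (β * v) ≠ 0)
    (b : Fin 2) :
    (openMonodromy q β z w).mulVec (stageVec (m + 1) q β z w⁻¹ v b (Fin.last N)) =
      stageVec (m + 1) q β z w v b (Fin.last N) := by
  have hq := ne_zero_of_pow_three hq3
  rw [openMonodromy, ← Matrix.mulVec_mulVec, ← Matrix.mulVec_mulVec]
  rw [ofFn_prod_mulVec (fun i : Fin N => leg2 (RMatrix q (w * z i)) 0 i.succ)
    (stageVec (m + 1) q β z w⁻¹ v b) fun i => ?_,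
    KMatrix_mulVec_stageVec hq1 hq3 hN h hβz hβw hβw' hβv]
  · exact ofFn_reverse_prod_mulVec (fun i : Fin N => leg2 (RMatrix q (w / z i)) 0 i.succ)
      (stageVec (m + 1) q β z w v b)
      fun i => RMatrix_mulVec_stageVec_castSucc hq hq1 h b i
  · have := RMatrix_mulVec_stageVec_succ (n := m + 1) (β := β) hq hq1
      (isRegular_snoc_inv_snoc hq3 h) b i
    -- Moving `w⁻¹` past `z i` uses the argument `z i / w⁻¹ = w * z i`.
    rwa [div_inv_eq_mul, mul_comm] at this

theorem moveAux_last (S : Config (N + 1)) :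
    moveAux (Fin.last N) S = Fin.snoc (α := fun _ => Fin 2) (Fin.tail S) (S 0) := by
  rw [moveAux, Fin.insertNth_last']

/-- The brackets for each `z i` are permuted up to cancelling signs, so the two fusion factors
differ only in the bracket with `β`. This ratio becomes the numerator of the eigenvalue. -/
theorem recursionFactor_ratio (hq3 : q ^ 3 = 1) :
    bracket (β / w) * recursionFactor m q β z (q * w) =
      bracket (q * β * w) * recursionFactor m q β z w⁻¹ := by
  unfold recursionFactor
  have h : ∀ i, bracket (q * (q * w) / z i) * bracket (q * z i * (q * w)) =
      bracket (q * w⁻¹ / z i) * bracket (q * z i * w⁻¹) := fun i => by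
    have h1 := bracket_pow_inv_eq hq3 1 (w * z i)
    have h2 := bracket_pow_inv_eq hq3 1 (w / z i)
    rw [show q ^ 1 * (w * z i)⁻¹ = q * w⁻¹ / z i by
      rw [mul_inv, pow_one, div_eq_mul_inv, mul_assoc]] at h1
    rw [show q ^ 1 * (w / z i)⁻¹ = q * z i * w⁻¹ by
      rw [inv_div, pow_one, div_eq_mul_inv, mul_assoc]] at h2
    rw [h1, h2, show q ^ (2 * 1) * (w * z i) = q * z i * (q * w) by ring,
      show q ^ (2 * 1) * (w / z i) = q * (q * w) / z i by ring]
    ring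
  rw [prod_congr rfl fun i _ => h i, show β * (q * w) = q * β * w by ring, ← div_eq_mul_inv β]
  ring

/-- The limit of the stage vectors as the ratio of the two additional parameters approaches `q`. -/
noncomputable def singletVec (c : ℂ) (ψ : Config N → ℂ) (b : Fin 2) : Config (N + 1) → ℂ :=
  fun S => singlet (S 0) b * c * ψ (Fin.tail S)

theorem singletVec_zero (c : ℂ) (ψ : Config N → ℂ) : singletVec c ψ 0 = c • auxVec 1 ψ := by
  funext S
  simp only [singletVec, singlet, auxVec, Pi.smul_apply, smul_eq_mul]
  rcases Fin.exists_fin_two.1 ⟨S 0, rfl⟩ with h | h <;> simp [h]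

theorem singletVec_one (c : ℂ) (ψ : Config N → ℂ) : singletVec c ψ 1 = (-c) • auxVec 0 ψ := by
  funext S
  simp only [singletVec, singlet, auxVec, Pi.smul_apply, smul_eq_mul]
  rcases Fin.exists_fin_two.1 ⟨S 0, rfl⟩ with h | h <;> simp [h]

/-- With `u = w⁻¹` fixed and `v → (q * w)⁻¹` the ratio `u / v` tends to `q`, so fusion applies. -/
theorem tendsto_stageVec_last (hq1 : bracket q ≠ 0) (hq3 : q ^ 3 = 1) (hβ : β ≠ 0)
    (hz : IsRegular q (snocParam z w)) (b : Fin 2) :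
    Tendsto (fun v => stageVec (m + 1) q β z w⁻¹ v b (Fin.last N)) (𝓝[≠] (q * w)⁻¹)
      (𝓝 (singletVec (recursionFactor m q β z w⁻¹) (ampVec m q β z) b)) := by
  have hq := ne_zero_of_pow_three hq3
  have hw : w ≠ 0 := by simpa using hz.ne_zero (Fin.last N)
  have hv : q * (q * w)⁻¹ = w⁻¹ := by field_simp
  refine tendsto_pi_nhds.2 fun S => ?_
  have := tendsto_ampVec_snoc_snoc (m := m) hq1 hq3 hβ z (q * w)⁻¹
    (isRegular_snoc_inv hq3 (hz.snoc_q_mul hq3)) (l := 𝓝[≠] (q * w)⁻¹) (u := fun _ => w⁻¹)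
    (v := fun v => v) (by rw [hv]; exact tendsto_const_nhds) (tendsto_id.mono_left nhdsWithin_le_nhds)
    (eventually_isRegular_snoc hq3 (isRegular_snoc_inv hq3 hz) _) (Fin.tail S) (S 0) b
  rw [hv] at this
  simpa only [stageVec, moveAux_last, stageParam, Fin.insertNth_last', singletVec] using this

/-- The action of the open monodromy on a singlet formed with an additional spin. -/
theorem openMonodromy_mulVec_singletVec (hq1 : bracket q ≠ 0) (hq3 : q ^ 3 = 1) (hβ : β ≠ 0)
    (hN : N ≤ 2 * m + 1) (hm : 2 * m ≤ N) (hz : IsRegular q (snocParam z w))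
    (hβz : ∀ i, bracket (β * z i) ≠ 0) (hβw : bracket (β * w) ≠ 0) (hβw' : bracket (β / w) ≠ 0)
    (s : Config N) :
    bracket (β / w) * (-recursionFactor m q β z (q * w) * ampVec m q β z s) =
      bracket (β / w) * (openMonodromy q β z w).mulVec
        (singletVec (recursionFactor m q β z w⁻¹) (ampVec m q β z) 0) (Fin.cons 1 s) -
      bracket (q ^ 2 * β * w) * (openMonodromy q β z w).mulVec
        (singletVec (recursionFactor m q β z w⁻¹) (ampVec m q β z) 1) (Fin.cons 0 s) := by
  have hq := ne_zero_of_pow_three hq3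
  have hw : w ≠ 0 := by simpa using hz.ne_zero (Fin.last N)
  set l := 𝓝[≠] (q * w)⁻¹ with hl
  have hreg : ∀ᶠ v in l, IsRegular q (snocParam (snocParam z w) v) :=
    eventually_isRegular_snoc hq3 hz _
  have hβv : ∀ᶠ v in l, bracket (β * v) ≠ 0 := by
    filter_upwards [eventually_sq_mul_pow_ne (q * w)⁻¹ one_pos β, hreg] with v h1 h2
    have hv : v ≠ 0 := by simpa using h2.ne_zero (Fin.last (N + 1))
    rw [bracket_ne_zero_iff (mul_ne_zero hβ hv)]
    simpa using h1
  have hid : Tendsto (fun v : ℂ => v) l (𝓝 (q * w)⁻¹) := tendsto_id.mono_left nhdsWithin_le_nhds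
  have hinv : Tendsto (fun v : ℂ => v⁻¹) l (𝓝 (q * w)) := by
    have := hid.inv₀ (inv_ne_zero (mul_ne_zero hq hw))
    rwa [inv_inv] at this
  -- The monodromy is a fixed matrix, hence passes to the limit; eventually it turns the parameters
  -- `(w⁻¹, v)` into `(w, v)`.
  have hY : ∀ (a b : Fin 2), Tendsto (fun v => ampVec (m + 1) q β (snocParam (snocParam z w) v)
      (Fin.snoc (α := fun _ => Fin 2) (Fin.snoc (α := fun _ => Fin 2) s a) b)) l
      (𝓝 ((openMonodromy q β z w).mulVec
        (singletVec (recursionFactor m q β z w⁻¹) (ampVec m q β z) b) (Fin.cons a s))) := by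
    intro a b
    have hc : Continuous fun X : Config (N + 1) → ℂ => (openMonodromy q β z w).mulVec X :=
      Continuous.matrix_mulVec continuous_const continuous_id
    have h1 := tendsto_pi_nhds.1 ((hc.tendsto _).comp (tendsto_stageVec_last (m := m) hq1 hq3 hβ hz b))
      (Fin.cons a s)
    refine h1.congr' ?_
    filter_upwards [hreg, hβv] with v h2 h3
    rw [Function.comp_apply, openMonodromy_mulVec_stageVec hq1 hq3 hN h2 hβz hβw hβw' h3]
    simp only [stageVec, moveAux_last, stageParam, Fin.insertNth_last', Fin.cons_zero, Fin.tail_cons]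
  -- After reflection of `v`, the pair `(v⁻¹, w)` tends to `(q * w, w)`, again of ratio `q`, so
  -- fusion applies a second time.
  have hX : Tendsto (fun v : ℂ => ampVec (m + 1) q β (snocParam (snocParam z v⁻¹) w)
      (Fin.snoc (α := fun _ => Fin 2) (Fin.snoc (α := fun _ => Fin 2) s 1) 0)) l
      (𝓝 (recursionFactor m q β z (q * w) * ampVec m q β z s)) := by
    have := tendsto_ampVec_snoc_snoc (m := m) hq1 hq3 hβ z w hz (l := l) (u := fun v => v⁻¹)
      (v := fun _ => w) hinv tendsto_const_nhds ?_ s 1 0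
    · simpa [singlet] using this
    · filter_upwards [hreg] with v hv
      have := (isRegular_snoc_inv hq3 hv).comp_perm
        (Equiv.swap (Fin.last N).castSucc (Fin.last (N + 1)))
      rwa [snoc_snoc_comp_swap] at this
  have hcont : ∀ f : ℂ → ℂ, ContinuousAt f (q * w)⁻¹ → Tendsto f l (𝓝 (f (q * w)⁻¹)) :=
    fun f hf => hf.tendsto.mono_left nhdsWithin_le_nhds
  have hqw : (q * w) ≠ 0 := mul_ne_zero hq hw
  have c1 := hcont (fun v => bracket (q * v⁻¹ / w)) (by fun_prop (disch := simp [hq, hw]))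
  have c2 := hcont (fun v => bracket (w / v⁻¹)) (by fun_prop (disch := simp [hq, hw]))
  have c3 := hcont (fun v => bracket (q * β * v)) (by fun_prop (disch := simp [hq, hw, hβ]))
  have c4 := hcont (fun v => bracket (q * β / v)) (by fun_prop (disch := simp [hq, hw, hβ]))
  have e1 : bracket (q * (q * w)⁻¹⁻¹ / w) = -bracket q := by
    rw [← bracket_sq hq3]
    congr 1
    field_simp
  have e2 : bracket (w / (q * w)⁻¹⁻¹) = -bracket q := by
    rw [← bracket_inv]
    congr 1
    field_simp
  have e3 : bracket (q * β * (q * w)⁻¹) = bracket (β / w) := by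
    congr 1
    field_simp
  have e4 : bracket (q * β / (q * w)⁻¹) = bracket (q ^ 2 * β * w) := by
    congr 1
    field_simp
  simp only [e1, e2, e3, e4] at c1 c2 c3 c4
  have hL := (c3.mul (c1.mul hX))
  have hR := (((tendsto_const_nhds (x := bracket q)).mul (hY 1 0)).mul c3).add
    (c2.mul (c4.mul (hY 0 1)))
  have heq := tendsto_nhds_unique_of_eventuallyEq hL hR ?_
  · apply mul_left_cancel₀ hq1
    linear_combination heq
  -- For each regular `v`, the exchange of `w` and `v⁻¹` and the reflection of the last parameter
  -- link the vector at `(v⁻¹, w)` to two components at `(w, v)`.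
  · filter_upwards [hreg] with v hv
    have hadj : ((Fin.last N).castSucc : Fin (N + 2)).val + 1 = (Fin.last (N + 1)).val := by simp
    have h1 := ampVec_swap_of_ne (n := m + 1) (β := β) hq hq1 (isRegular_snoc_inv hq3 hv) hadj
      (s := Fin.snoc (α := fun _ => Fin 2) (Fin.snoc (α := fun _ => Fin 2) s 1) 0) (by simp)
    rw [snoc_snoc_comp_swap, snoc_snoc_comp_swap] at h1
    simp only [Fin.snoc_last, Fin.snoc_castSucc] at h1
    have h2 := ampVec_reflectLast_up (n := m + 1) (β := β) hq3 hv
      (s := Fin.snoc (α := fun _ => Fin 2) (Fin.snoc (α := fun _ => Fin 2) s 1) 0) (by simp)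
    have h3 := ampVec_reflectLast_down (n := m + 1) hq1 hq3 hβ (by omega) hv
      (s := Fin.snoc (α := fun _ => Fin 2) (Fin.snoc (α := fun _ => Fin 2) s 0) 1) (by simp)
    rw [h2] at h1
    linear_combination bracket (q * β * v) * h1 + bracket (w / v⁻¹) * h3

/-- The hypothesis means `β' = ±(β * q)⁻¹`, and the sign cancels in the ratio. The right K-matrix
entry becomes the relative weight of the two singlet components in
`openMonodromy_mulVec_singletVec`. -/
theorem KMatrix_bracket_ratio (hq3 : q ^ 3 = 1) (hβ : β' ^ 2 * β ^ 2 * q ^ 2 = 1) (hw : w ≠ 0) :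
    bracket (β' * (q * w)) / bracket (β' / (q * w)) =
      bracket (β / w) / bracket (q ^ 2 * β * w) := by
  have hq := ne_zero_of_pow_three hq3
  have hβ0 : β ≠ 0 := by rintro rfl; norm_num at hβ
  have h1 : (β' * β * q - 1) * (β' * β * q + 1) = 0 := by linear_combination hβ
  rcases mul_eq_zero.1 h1 with h | h
  · have hb : β' = (β * q)⁻¹ := by
      field_simp
      linear_combination h
    rw [show β' * (q * w) = (β / w)⁻¹ by rw [hb]; field_simp,
      show β' / (q * w) = (q ^ 2 * β * w)⁻¹ by rw [hb]; field_simp, bracket_inv, bracket_inv,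
      neg_div_neg_eq]
  · have hb : β' = -(β * q)⁻¹ := by
      field_simp
      linear_combination h
    rw [show β' * (q * w) = -(β / w)⁻¹ by rw [hb]; field_simp,
      show β' / (q * w) = -(q ^ 2 * β * w)⁻¹ by rw [hb]; field_simp, bracket_neg, bracket_neg,
      bracket_inv, bracket_inv, neg_neg, neg_neg]

theorem transferMatrix_mulVec_eq (ψ : Config N → ℂ) (s : Config N) :
    (transferMatrix q β β' z w).mulVec ψ s =
      (openMonodromy q β z w).mulVec (auxVec 0 ψ) (Fin.cons 0 s) +
      bracket (β' * (q * w)) / bracket (β' / (q * w)) *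
        (openMonodromy q β z w).mulVec (auxVec 1 ψ) (Fin.cons 1 s) := by
  rw [transferMatrix, partialTrace_mulVec, Fin.sum_univ_two]
  have h : ∀ X : Config (N + 1) → ℂ, ∀ S, (leg1 (KMatrix (q * w) β') 0
      * (List.ofFn fun i : Fin N => leg2 (RMatrix q (w / z i)) 0 i.succ).reverse.prod
      * leg1 (KMatrix w β) 0
      * (List.ofFn fun i : Fin N => leg2 (RMatrix q (w * z i)) 0 i.succ).prod).mulVec X S =
      ![1, bracket (β' * (q * w)) / bracket (β' / (q * w))] (S 0) *
        (openMonodromy q β z w).mulVec X S := fun X S => by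
    rw [← leg1_diagonal_mulVec, openMonodromy, Matrix.mulVec_mulVec, KMatrix]
    simp only [Matrix.mul_assoc]
  rw [h, h]
  simp

theorem recursionFactor_ne_zero (hz : IsRegular q (snocParam z w)) (hβw : bracket (β * w) ≠ 0) :
    recursionFactor m q β z w ≠ 0 := by
  have h1 : ∀ k : ℕ, (-1 : ℂ) ^ k ≠ 0 := fun k => pow_ne_zero k (by norm_num)
  refine mul_ne_zero (mul_ne_zero (mul_ne_zero (h1 _) (h1 _)) hβw)
    (prod_ne_zero_iff.2 fun i _ => mul_ne_zero ?_ ?_)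
  · simpa using hz.div_ne 1 (Fin.last N) i.castSucc (Fin.castSucc_lt_last i).ne'
  · simpa using hz.mul_ne 1 i.castSucc (Fin.last N)

/-- The two singlet components enter with exactly the weights of the trace over the auxiliary space.
Dividing by the nonzero fusion factor at `w⁻¹` leaves the ratio of fusion factors as eigenvalue. -/
theorem transferMatrix_mulVec_ampVec (hq1 : bracket q ≠ 0) (hq3 : q ^ 3 = 1)
    (hβ : β' ^ 2 * β ^ 2 * q ^ 2 = 1) (hN : N ≤ 2 * m + 1) (hm : 2 * m ≤ N)
    (hz : IsRegular q (snocParam z w)) (hβz : ∀ i, bracket (β * z i) ≠ 0)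
    (hβw : bracket (β * w) ≠ 0) (hβw' : bracket (β / w) ≠ 0)
    (hβw'' : bracket (q ^ 2 * β * w) ≠ 0) :
    (transferMatrix q β β' z w).mulVec (ampVec m q β z) =
      (-(bracket (q * β * w) / bracket (q ^ 2 * β * w))) • ampVec m q β z := by
  have hβ0 : β ≠ 0 := by rintro rfl; norm_num at hβ
  have hw : w ≠ 0 := by simpa using hz.ne_zero (Fin.last N)
  funext s
  have h := openMonodromy_mulVec_singletVec hq1 hq3 hβ0 hN hm hz hβz hβw hβw' s
  have hr := recursionFactor_ratio (m := m) (β := β) (z := z) (w := w) hq3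
  have hG : recursionFactor m q β z w⁻¹ ≠ 0 :=
    recursionFactor_ne_zero (isRegular_snoc_inv hq3 hz) (by rwa [← div_eq_mul_inv])
  rw [singletVec_zero, singletVec_one, Matrix.mulVec_smul, Matrix.mulVec_smul] at h
  simp only [Pi.smul_apply, smul_eq_mul] at h ⊢
  rw [transferMatrix_mulVec_eq, KMatrix_bracket_ratio hq3 hβ hw]
  generalize recursionFactor m q β z w⁻¹ = G at *
  generalize recursionFactor m q β z (q * w) = G' at *
  generalize bracket (q ^ 2 * β * w) = c at *
  generalize bracket (q * β * w) = d at *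
  generalize bracket (β / w) = e at *
  field_simp
  apply mul_left_cancel₀ hG
  linear_combination -h - ampVec m q β z s * hr

end Eigen
end SixVertex

namespace SixVertex

open Finset

/-! ### Iterated residues -/

section Residues

variable {N n : ℕ} {z : Fin N → ℂ}

/-- The partial fraction expansion, obtained by interpolating the constant polynomial `1` at the
nodes. -/
theorem prod_sub_inv_eq_sum (hN : 0 < N) (hz : Function.Injective z) {x : ℂ}
    (hx : ∀ j, x ≠ z j) :
    ∏ j, (x - z j)⁻¹ = ∑ j, Lagrange.nodalWeight univ z j * (x - z j)⁻¹ := by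
  have hne : (univ : Finset (Fin N)).Nonempty := ⟨⟨0, hN⟩, mem_univ _⟩
  have h := Lagrange.eval_interpolate_not_at_node (s := univ) (v := z) (1 : Fin N → ℂ)
    (x := x) fun i _ => hx i
  rw [Lagrange.interpolate_one hz.injOn hne, Polynomial.eval_one, Lagrange.eval_nodal] at h
  have h0 : ∏ j, (x - z j) ≠ 0 := prod_ne_zero_iff.2 fun j _ => sub_ne_zero.2 (hx j)
  rw [prod_inv_distrib, inv_eq_iff_eq_inv, ← one_mul (_)⁻¹, eq_mul_inv_iff_mul_eq₀]
  · simpa using h.symm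
  · intro h1
    simp only [Pi.one_apply, mul_one] at h
    rw [h1, mul_zero] at h
    exact one_ne_zero h

open scoped Classical in
-- After partial fractions, Cauchy's formula treats the nodes inside the circle, and the integrals
-- belonging to the nodes outside vanish.
theorem circleIntegral_prod_sub_inv_mul (hN : 0 < N) (hz : Function.Injective z) {c : ℂ} {R : ℝ}
    (hR : 0 < R) (hs : ∀ j, z j ∉ Metric.sphere c R) {g : ℂ → ℂ}
    (hg : DifferentiableOn ℂ g (Metric.closedBall c R)) :
    (∮ x in C(c, R), (∏ j, (x - z j)⁻¹) * g x) = 2 * Real.pi * Complex.I *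
      ∑ j, (if z j ∈ Metric.ball c R then Lagrange.nodalWeight univ z j else 0) * g (z j) := by
  have hne : ∀ x ∈ Metric.sphere c R, ∀ j, x ≠ z j := fun x hx j e => hs j (e ▸ hx)
  have hterm : ∀ j, ContinuousOn (fun x => Lagrange.nodalWeight univ z j * ((x - z j)⁻¹ * g x))
      (Metric.sphere c R) := fun j => by
    refine continuousOn_const.mul (ContinuousOn.mul (ContinuousOn.inv₀ (by fun_prop) fun x hx => ?_)
      (hg.continuousOn.mono Metric.sphere_subset_closedBall))
    exact sub_ne_zero.2 (hne x hx j)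
  have h1 : Set.EqOn (fun x => (∏ j, (x - z j)⁻¹) * g x)
      (fun x => ∑ j, Lagrange.nodalWeight univ z j * ((x - z j)⁻¹ * g x)) (Metric.sphere c R) :=
    fun x hx => by
      simp only [prod_sub_inv_eq_sum hN hz (hne x hx), sum_mul, mul_assoc]
  rw [circleIntegral.integral_congr hR.le h1, circleIntegral.integral_fun_sum fun j _ =>
    (hterm j).circleIntegrable hR.le, mul_sum]
  refine sum_congr rfl fun j _ => ?_
  rw [circleIntegral.integral_const_mul]
  split_ifs with h
  · have := hg.circleIntegral_sub_inv_smul h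
    simp only [smul_eq_mul] at this
    rw [this]
    ring
  · have hj : z j ∉ Metric.closedBall c R := fun h' => by
      rw [← Metric.ball_union_sphere] at h'
      exact h'.elim h (hs j)
    have hd : DifferentiableOn ℂ (fun x => (x - z j)⁻¹ * g x) (Metric.closedBall c R) := by
      refine DifferentiableOn.mul (DifferentiableOn.inv (by fun_prop) fun x hx e => ?_) hg
      rw [sub_eq_zero] at e
      exact hj (e ▸ hx)
    rw [(hd.mono Metric.closure_ball_subset_closedBall).diffContOnCl.circleIntegral_eq_zero hR.le]
    ring

theorem torusMap_mem_sphere {c : Fin n → ℂ} {R : Fin n → ℝ} (hR : ∀ l, 0 < R l) (θ : Fin n → ℝ)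
    (l : Fin n) : torusMap c R θ l ∈ Metric.sphere (c l) (R l) := by
  simp [torusMap, abs_of_pos (hR l)]

theorem continuous_torusMap (c : Fin n → ℂ) (R : Fin n → ℝ) : Continuous (torusMap c R) := by
  unfold torusMap
  fun_prop

theorem torusIntegral_congr {c : Fin n → ℂ} {R : Fin n → ℝ} (hR : ∀ l, 0 < R l)
    {f g : (Fin n → ℂ) → ℂ} (h : ∀ w, (∀ l, w l ∈ Metric.sphere (c l) (R l)) → f w = g w) :
    torusIntegral f c R = torusIntegral g c R := by
  unfold torusIntegral
  congr 1
  funext θ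
  rw [h _ (torusMap_mem_sphere hR θ)]

open scoped Classical in
-- Induction on the number of variables: integrating out all but the first leaves an integrand of
-- the same shape in that variable.
theorem torusIntegral_prod_sub_inv_mul (hN : 0 < N) (hz : Function.Injective z) {c : Fin n → ℂ}
    {R : Fin n → ℝ} (hR : ∀ l, 0 < R l) (hs : ∀ l j, z j ∉ Metric.sphere (c l) (R l))
    {G : (Fin n → ℂ) → ℂ}
    (hG : ∀ w, (∀ l, w l ∈ Metric.closedBall (c l) (R l)) → DifferentiableAt ℂ G w) :
    torusIntegral (fun w => (∏ l, ∏ j, (w l - z j)⁻¹) * G w) c R =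
      (2 * Real.pi * Complex.I) ^ n * ∑ σ : Fin n → Fin N,
        (∏ l, if z (σ l) ∈ Metric.ball (c l) (R l) then Lagrange.nodalWeight univ z (σ l) else 0) *
          G (z ∘ σ) := by
  induction n with
  | zero =>
    rw [torusIntegral_dim0]
    simp only [univ_eq_empty, prod_empty, one_mul, pow_zero, univ_unique, sum_singleton]
    congr 1
    exact Subsingleton.elim _ _
  | succ n ih =>
    have hcont : Continuous fun θ => (∏ l, ∏ j, (torusMap c R θ l - z j)⁻¹) * G (torusMap c R θ) := by
      have hT := continuous_torusMap c R
      refine Continuous.mul (continuous_finsetProd _ fun l _ => continuous_finsetProd _ fun j _ =>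
        Continuous.inv₀ (((continuous_apply l).comp hT).sub continuous_const) fun θ e => ?_)
        (continuous_iff_continuousAt.2 fun θ => ?_)
      · have := torusMap_mem_sphere (c := c) hR θ l
        rw [sub_eq_zero] at e
        exact hs l j (e ▸ this)
      · exact ContinuousAt.comp (hG _ fun l => Metric.sphere_subset_closedBall
          (torusMap_mem_sphere hR θ l)).continuousAt hT.continuousAt
    have hint : TorusIntegrable (fun w => (∏ l, ∏ j, (w l - z j)⁻¹) * G w) c R :=
      hcont.integrableOn_Icc
    rw [torusIntegral_succ hint]
    have hmem : ∀ x ∈ Metric.closedBall (c 0) (R 0), ∀ y : Fin n → ℂ,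
        (∀ l, y l ∈ Metric.closedBall (c l.succ) (R l.succ)) →
        ∀ l, (Fin.cons x y : Fin (n + 1) → ℂ) l ∈ Metric.closedBall (c l) (R l) := by
      intro x hx y hy l
      induction l using Fin.cases with
      | zero => simpa using hx
      | succ l => simpa using hy l
    have hcons1 : ∀ x, Differentiable ℂ fun y : Fin n → ℂ => (Fin.cons x y : Fin (n + 1) → ℂ) :=
      fun x => differentiable_pi.2 fun l => by
        induction l using Fin.cases with
        | zero => simp
        | succ l => simpa using differentiable_apply l
    have hcons2 : ∀ y : Fin n → ℂ, Differentiable ℂ fun x : ℂ => (Fin.cons x y : Fin (n + 1) → ℂ) :=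
      fun y => differentiable_pi.2 fun l => by
        induction l using Fin.cases with
        | zero => simp
        | succ l => simp
    have h1 : Set.EqOn (fun x => torusIntegral (fun y => (∏ l, ∏ j,
        ((Fin.cons x y : Fin (n + 1) → ℂ) l - z j)⁻¹) * G (Fin.cons x y)) (c ∘ Fin.succ)
          (R ∘ Fin.succ))
        (fun x => (∏ j, (x - z j)⁻¹) * ((2 * Real.pi * Complex.I) ^ n * ∑ σ : Fin n → Fin N,
        (∏ l, if z (σ l) ∈ Metric.ball (c l.succ) (R l.succ) then
          Lagrange.nodalWeight univ z (σ l) else 0) *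
          G (Fin.cons x (z ∘ σ)))) (Metric.sphere (c 0) (R 0)) := by
      intro x hx
      have := ih (c := c ∘ Fin.succ) (R := R ∘ Fin.succ) (fun l => hR _) (fun l j => hs _ j)
        (G := fun y => G (Fin.cons x y)) fun y hy => by
          exact (hG _ (hmem x (Metric.sphere_subset_closedBall hx) y hy)).comp y (hcons1 x y)
      simp only [Fin.prod_univ_succ, Fin.cons_zero, Fin.cons_succ, mul_assoc]
      rw [torusIntegral_const_mul, this]
      simp only [Function.comp_apply, mul_assoc]
    rw [circleIntegral.integral_congr (hR 0).le h1, circleIntegral_prod_sub_inv_mul hN hz (hR 0)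
      (hs 0)]
    · rw [pow_succ', ← (Fin.consEquiv fun _ : Fin (n + 1) => Fin N).sum_comp,
        Fintype.sum_prod_type]
      simp only [mul_sum]
      refine sum_congr rfl fun k _ => sum_congr rfl fun σ _ => ?_
      have hc : z ∘ (Fin.consEquiv fun _ : Fin (n + 1) => Fin N) (k, σ) = Fin.cons (z k) (z ∘ σ) := by
        funext l
        induction l using Fin.cases <;> simp [Fin.consEquiv]
      rw [hc, Fin.prod_univ_succ]
      simp only [Fin.consEquiv, Equiv.coe_fn_mk, Fin.cons_zero, Fin.cons_succ]
      ring
    · apply DifferentiableOn.const_mul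
      refine DifferentiableOn.fun_sum (u := univ) (A := fun (σ : Fin n → Fin N) x =>
        (∏ l, if z (σ l) ∈ Metric.ball (c l.succ) (R l.succ) then
          Lagrange.nodalWeight univ z (σ l) else 0) * G (Fin.cons x (z ∘ σ))) fun σ _ => ?_
      by_cases hσ : ∀ l, z (σ l) ∈ Metric.ball (c l.succ) (R l.succ)
      · refine DifferentiableOn.const_mul (𝔸 := ℂ) (fun x hx => ?_) _
        exact ((hG _ (hmem x hx _ fun l => Metric.ball_subset_closedBall (hσ l))).comp x
          (hcons2 _ x)).differentiableWithinAt
      -- Some node of the tuple lies outside its disc, where `G` need not be differentiable; but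
      -- then the weight is zero and the term is constant.
      · push Not at hσ
        obtain ⟨l, hl⟩ := hσ
        rw [prod_eq_zero (mem_univ l) (if_neg hl)]
        simp

end Residues
end SixVertex

namespace SixVertex

open Finset

/-! ### Evaluation of the contour integrals by residues -/

section Contour

variable {N n : ℕ} {q β : ℂ} {z : Fin N → ℂ} {Γ : Contour}

theorem Contour.Surrounds.notMem_sphere (hΓ : Γ.Surrounds q z) (k : Fin Γ.m) (j : Fin N) :
    z j ∉ Metric.sphere (Γ.center k) (Γ.radius k) := fun h => by
  obtain ⟨l, hl⟩ := hΓ.inside j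
  by_cases hkl : k = l
  · subst hkl
    rw [Metric.mem_sphere] at h
    rw [Metric.mem_ball, h] at hl
    exact lt_irrefl _ hl
  · exact Set.disjoint_left.1 (hΓ.disjoint k l hkl) (Metric.sphere_subset_closedBall h)
      (Metric.ball_subset_closedBall hl)

/-- Every node lies in exactly one of the disjoint discs, so the sum over the choices of circles
removes the indicator functions. -/
theorem Contour.Surrounds.multiIntegral_eq (hΓ : Γ.Surrounds q z) (hN : 0 < N)
    (hz : Function.Injective z) {G : (Fin n → ℂ) → ℂ}
    (hG : ∀ w, (∀ l, ∃ k, w l ∈ Metric.closedBall (Γ.center k) (Γ.radius k)) →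
      DifferentiableAt ℂ G w) :
    Γ.multiIntegral (fun w => (∏ l, ∏ j, (w l - z j)⁻¹) * G w) =
      (2 * Real.pi * Complex.I) ^ n * ∑ σ : Fin n → Fin N,
        (∏ l, Lagrange.nodalWeight univ z (σ l)) * G (z ∘ σ) := by
  classical
  unfold Contour.multiIntegral
  rw [sum_congr rfl fun κ _ => torusIntegral_prod_sub_inv_mul hN hz (fun l => hΓ.radius_pos (κ l))
    (fun l j => hΓ.notMem_sphere (κ l) j) fun w hw => hG w fun l => ⟨κ l, hw l⟩]
  rw [← mul_sum, sum_comm]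
  congr 1
  refine sum_congr rfl fun σ _ => ?_
  rw [← sum_mul]
  congr 1
  have h := prod_univ_sum (fun _ : Fin n => (univ : Finset (Fin Γ.m))) fun l k =>
    if z (σ l) ∈ Metric.ball (Γ.center k) (Γ.radius k) then
      Lagrange.nodalWeight univ z (σ l) else 0
  rw [Fintype.piFinset_univ] at h
  rw [← h]
  refine prod_congr rfl fun l _ => ?_
  obtain ⟨k, hk⟩ := hΓ.inside (σ l)
  rw [sum_eq_single k, if_pos hk]
  · intro k' _ hk'
    rw [if_neg]
    exact fun h => Set.disjoint_left.1 (hΓ.disjoint k' k hk') (Metric.ball_subset_closedBall h)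
      (Metric.ball_subset_closedBall hk)
  · simp

/-- The part of the integrand that is regular inside the contours. -/
noncomputable def regularKernel (q β : ℂ) (z : Fin N → ℂ) (a : Fin n → Fin N) (w : Fin n → ℂ) : ℂ :=
  pairProd (fun i j => pairFactor q (w i) (w j)) *
    ∏ l, (oneFactor q β z (w l) * siteFactor q z (a l) (w l))

theorem prod_Ici_self_mul (f : Fin n → Fin n → ℂ) :
    ∏ i, ∏ j ∈ Ici i, f i j = (∏ i, f i i) * pairProd f := by
  simp only [prod_Ici_eq, prod_mul_distrib, pairProd]

theorem prod_Iic_mul_prod_Ioi (a : Fin N) (f : Fin N → ℂ) :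
    (∏ j ∈ Iic a, f j) * ∏ j ∈ Ioi a, f j = ∏ j, f j := by
  rw [← prod_union]
  · congr 1
    ext j
    simpa using le_or_gt j a
  · rw [disjoint_left]
    intro j h1 h2
    exact absurd (mem_Iic.1 h1) (not_le.2 (mem_Ioi.1 h2))

/-- The product over the sites up to `a l` in the denominator is completed to all sites; the added
brackets become the numerator of `siteFactor`. All poles inside the contours are thereby in one
symmetric product. -/
theorem Xi_eq (a : Fin n → Fin N) {w : Fin n → ℂ} (hw : ∀ l j, bracket (z j / w l) ≠ 0) :
    Xi q β z a w = regularKernel q β z a w * ∏ l, ∏ j, (bracket (z j / w l))⁻¹ := by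
  have h1 : ∀ l, ((∏ j ∈ Iic (a l), bracket (z j / w l)))⁻¹ =
      (∏ j ∈ Ioi (a l), bracket (z j / w l)) * ∏ j, (bracket (z j / w l))⁻¹ := fun l => by
    have h2 : ∏ j ∈ Ioi (a l), bracket (z j / w l) ≠ 0 := prod_ne_zero_iff.2 fun j _ => hw l j
    rw [prod_inv_distrib, ← prod_Iic_mul_prod_Ioi (a l), mul_inv]
    field_simp
  unfold Xi regularKernel
  rw [prod_Ici_self_mul]
  change (pairProd (fun i j => bracket (q * w j / w i) * bracket (w i / w j) *
    bracket (q * w i * w j)) * (_ * pairProd _) * _) / _ = _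
  have h3 : pairProd (fun i j => pairFactor q (w i) (w j)) =
      pairProd (fun i j => bracket (q * w j / w i) * bracket (w i / w j) *
        bracket (q * w i * w j)) * pairProd fun i j => bracket (q ^ 2 * w i * w j) := by
    rw [← pairProd_mul]
    rfl
  rw [h3, div_eq_mul_inv, ← prod_inv_distrib]
  simp only [mul_inv, h1, oneFactor, siteFactor, prod_mul_distrib, prod_div_distrib,
    prod_inv_distrib]
  ring

/-- Separates the pole at `w = x` from the one at `w = -x`, which the contours exclude. -/
theorem inv_bracket_div {x w : ℂ} (hx : x ≠ 0) (hw : w ≠ 0) :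
    (bracket (x / w))⁻¹ = (w - x)⁻¹ * (-(x * w) * (w + x)⁻¹) := by
  have : bracket (x / w) = (w - x) * (w + x) * (-(x * w))⁻¹ := by
    unfold bracket
    field_simp
    ring
  rw [this, mul_inv, mul_inv, inv_inv]
  ring

theorem _root_.DifferentiableAt.bracket {E : Type*} [NormedAddCommGroup E] [NormedSpace ℂ E]
    {f : E → ℂ} {x : E} (hf : DifferentiableAt ℂ f x) (h0 : f x ≠ 0) :
    DifferentiableAt ℂ (fun y => bracket (f y)) x :=
  hf.sub (hf.inv h0)

attribute [fun_prop] DifferentiableAt.bracket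

/-- The conditions on a point `u` inside the contours. -/
theorem Contour.Surrounds.bracket_ne (hΓ : Γ.Surrounds q z) (hq : q ≠ 0) (hz : ∀ j, z j ≠ 0)
    {k : Fin Γ.m} {u : ℂ} (hu : u ∈ Metric.closedBall (Γ.center k) (Γ.radius k)) :
    u ≠ 0 ∧ ∀ j, u + z j ≠ 0 ∧ bracket (q * z j / u) ≠ 0 ∧ bracket (q ^ 2 * u * z j) ≠ 0 := by
  obtain ⟨h0, h⟩ := hΓ.outside k u hu
  refine ⟨h0, fun j => ?_⟩
  obtain ⟨h1, h2, h3, h4, h5⟩ := h j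
  have hzj := hz j
  refine ⟨fun e => h1 (eq_neg_of_add_eq_zero_left e), ?_, ?_⟩
  · rw [bracket_ne_zero_iff (div_ne_zero (mul_ne_zero hq hzj) h0), sq_ne_one_iff, ne_eq, ne_eq,
      div_eq_one_iff_eq h0, div_eq_iff h0]
    exact ⟨fun e => h2 e.symm, fun e => h3 (by rw [e]; ring)⟩
  · rw [bracket_ne_zero_iff (mul_ne_zero (mul_ne_zero (pow_ne_zero 2 hq) h0) hzj), sq_ne_one_iff]
    refine ⟨fun e => h4 ?_, fun e => h5 ?_⟩
    · rw [← mul_inv]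
      exact eq_inv_of_mul_eq_one_left (by rw [← e]; ring)
    · rw [← mul_inv, ← neg_eq_iff_eq_neg]
      exact eq_inv_of_mul_eq_one_left (by rw [← neg_eq_iff_eq_neg.2 e]; ring)

theorem differentiableAt_regularKernel (hq : q ≠ 0) (hβ : β ≠ 0) (hz : ∀ j, z j ≠ 0)
    (a : Fin n → Fin N) {w : Fin n → ℂ} (hw : ∀ l, w l ≠ 0)
    (h1 : ∀ l j, bracket (q * z j / w l) ≠ 0) (h2 : ∀ l j, bracket (q ^ 2 * w l * z j) ≠ 0) :
    DifferentiableAt ℂ (regularKernel q β z a) w := by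
  unfold regularKernel pairProd pairFactor oneFactor siteFactor
  fun_prop (disch := simp [hq, hβ, hz, hw, h1, h2, prod_eq_zero_iff])

theorem Contour.Surrounds.multiIntegral_congr (hΓ : Γ.Surrounds q z) {f g : (Fin n → ℂ) → ℂ}
    (h : ∀ w, (∀ l, ∃ k, w l ∈ Metric.sphere (Γ.center k) (Γ.radius k)) → f w = g w) :
    Γ.multiIntegral f = Γ.multiIntegral g :=
  sum_congr rfl fun κ _ => torusIntegral_congr (fun l => hΓ.radius_pos (κ l)) fun w hw =>
    h w fun l => ⟨κ l, hw l⟩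

/-- The factor `j = k` equals `-z k / 2`, which with `2πi` and `1 / (πi z k)` gives `-1`; these
signs are absorbed by `(-[q]) ^ n`. -/
theorem nodeWeight_eq_nodalWeight (hz : ∀ j, z j ≠ 0) (k : Fin N) :
    2 * Real.pi * Complex.I * (Lagrange.nodalWeight univ z k * (1 / (Real.pi * Complex.I * z k) *
      ∏ j, (-(z j * z k) * (z k + z j)⁻¹))) = -nodeWeight z k := by
  have hk := hz k
  have h1 : nodeWeight z k = Lagrange.nodalWeight univ z k *
      ∏ j ∈ univ.erase k, (-(z j * z k) * (z k + z j)⁻¹) := by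
    rw [nodeWeight, Lagrange.nodalWeight, ← prod_inv_distrib, ← prod_mul_distrib]
    exact prod_congr rfl fun j _ => inv_bracket_div (hz j) hk
  rw [h1, ← mul_prod_erase univ _ (mem_univ k)]
  have hpi : (Real.pi : ℂ) ≠ 0 := by exact_mod_cast Real.pi_ne_zero
  have hI := Complex.I_ne_zero
  rw [← two_mul]
  field_simp

/-- Injectivity of `z` makes the poles inside the contours simple; the remaining kernel is
holomorphic on the closed discs by the conditions on the contours. -/
theorem Contour.Surrounds.psiComponent_eq_amp (hΓ : Γ.Surrounds q z) (hN : 0 < N) (hq : q ≠ 0)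
    (hβ : β ≠ 0) (hz : ∀ j, z j ≠ 0) (hinj : Function.Injective z) (a : Fin n → Fin N) :
    psiComponent q β z Γ a = amp q β z a := by
  have hcongr : Γ.multiIntegral (fun w => (∏ l, 1 / (Real.pi * Complex.I * w l)) * Xi q β z a w) =
      Γ.multiIntegral fun w => (∏ l, ∏ j, (w l - z j)⁻¹) *
        ((∏ l, 1 / (Real.pi * Complex.I * w l)) * regularKernel q β z a w *
          ∏ l, ∏ j, (-(z j * w l) * (w l + z j)⁻¹)) := by
    refine hΓ.multiIntegral_congr fun w hw => ?_
    have hw0 : ∀ l, w l ≠ 0 := fun l => by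
      obtain ⟨k, hk⟩ := hw l
      exact (hΓ.bracket_ne hq hz (Metric.sphere_subset_closedBall hk)).1
    have hinv : ∀ l j, (bracket (z j / w l))⁻¹ = (w l - z j)⁻¹ * (-(z j * w l) * (w l + z j)⁻¹) :=
      fun l j => inv_bracket_div (hz j) (hw0 l)
    rw [Xi_eq a fun l j e => ?_]
    · simp only [hinv, prod_mul_distrib]
      ring
    · obtain ⟨k, hk⟩ := hw l
      have h1 := ((hΓ.bracket_ne hq hz (Metric.sphere_subset_closedBall hk)).2 j).1
      have h2 : w l - z j ≠ 0 := fun e => hΓ.notMem_sphere k j (sub_eq_zero.1 e ▸ hk)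
      have h3 := hinv l j
      rw [e, inv_zero, eq_comm] at h3
      simp [h1, h2, hz j, hw0 l] at h3
  have hpref : (∏ i, ∏ j ∈ Ioi i, bracket (q * z j / z i) * bracket (q ^ 2 * z i * z j)) =
      prefactor q z := rfl
  rw [psiComponent, hcongr, hΓ.multiIntegral_eq hN hinj, hpref, amp, nodeSum]
  · rw [mul_sum, mul_sum, mul_sum]
    refine sum_congr rfl fun σ _ => ?_
    have h1 := prod_congr (rfl : (univ : Finset (Fin n)) = univ)
      fun l _ => nodeWeight_eq_nodalWeight hz (σ l)
    have h2 : ∏ l, -nodeWeight z (σ l) = (-1) ^ n * ∏ l, nodeWeight z (σ l) := by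
      rw [prod_neg]
      simp
    rw [h2] at h1
    have h3 : (-bracket q) ^ n = (-1) ^ n * bracket q ^ n := by rw [← mul_pow]; ring
    have h4 : ((-1 : ℂ) ^ n) * (-1) ^ n = 1 := by rw [← mul_pow]; norm_num
    rw [h3]
    change _ = bracket q ^ n * prefactor q z * (_ * regularKernel q β z a (z ∘ σ))
    simp only [Function.comp_apply, prod_mul_distrib, prod_const, card_univ, Fintype.card_fin,
      mul_pow] at h1 ⊢
    linear_combination (-1) ^ n * bracket q ^ n * prefactor q z * regularKernel q β z a (z ∘ σ) * h1
      + bracket q ^ n * prefactor q z * regularKernel q β z a (z ∘ σ) *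
        (∏ l, nodeWeight z (σ l)) * h4
  · intro w hw
    have h0 : ∀ l, w l ≠ 0 := fun l => by
      obtain ⟨k, hk⟩ := hw l
      exact (hΓ.bracket_ne hq hz hk).1
    have h1 : ∀ l j, w l + z j ≠ 0 ∧ bracket (q * z j / w l) ≠ 0 ∧
        bracket (q ^ 2 * w l * z j) ≠ 0 := fun l j => by
      obtain ⟨k, hk⟩ := hw l
      exact (hΓ.bracket_ne hq hz hk).2 j
    have h2 := differentiableAt_regularKernel hq hβ hz a h0 (fun l j => (h1 l j).2.1)
      fun l j => (h1 l j).2.2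
    have h3 := fun l j => (h1 l j).1
    fun_prop (disch := simp [h0, h3, Real.pi_ne_zero])

/-- For distinct parameters the vector is given by the sum over residues. -/
theorem Contour.Surrounds.psi_eq_ampVec (hΓ : Γ.Surrounds q z) (hN : 0 < N) (hq : q ≠ 0)
    (hβ : β ≠ 0) (hz : ∀ j, z j ≠ 0) (hinj : Function.Injective z) :
    psi q β z Γ = ampVec (N / 2) q β z := by
  funext s
  unfold psi ampVec
  split_ifs
  · exact hΓ.psiComponent_eq_amp hN hq hβ hz hinj _
  · rfl

end Contour
end SixVertex

namespace SixVertex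

open Finset Filter Topology

/-! ### Continuity in the parameters for fixed contours -/

section ContourContinuity

variable {N n : ℕ} {q β β' : ℂ} {z : Fin N → ℂ} {Γ : Contour}

theorem Contour.Surrounds.ne_zero (hΓ : Γ.Surrounds q z) (j : Fin N) : z j ≠ 0 := by
  obtain ⟨k, hk⟩ := hΓ.inside j
  exact (hΓ.outside k _ (Metric.ball_subset_closedBall hk)).1

/-- The points to be enclosed lie in open discs and those to be avoided off finitely many closed
ones, so the same circles serve all nearby parameters. -/
theorem Contour.Surrounds.eventually (hΓ : Γ.Surrounds q z) :
    ∀ᶠ y in 𝓝 z, Γ.Surrounds q y := by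
  have hin : ∀ j, ∀ᶠ y in 𝓝 z, ∃ k, y j ∈ Metric.ball (Γ.center k) (Γ.radius k) := fun j => by
    obtain ⟨k, hk⟩ := hΓ.inside j
    filter_upwards [(continuous_apply j).continuousAt.eventually (Metric.isOpen_ball.mem_nhds hk)]
      with y hy using ⟨k, hy⟩
  have hout : ∀ (f : ℂ → ℂ) (j : Fin N) (k : Fin Γ.m), ContinuousAt f (z j) →
      (∀ w ∈ Metric.closedBall (Γ.center k) (Γ.radius k), w ≠ f (z j)) →
      ∀ᶠ y in 𝓝 z, ∀ w ∈ Metric.closedBall (Γ.center k) (Γ.radius k), w ≠ f (y j) := by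
    intro f j k hf h
    have h1 : f (z j) ∈ (Metric.closedBall (Γ.center k) (Γ.radius k))ᶜ := fun h' => h _ h' rfl
    have h2 : ContinuousAt (fun y : Fin N → ℂ => f (y j)) z :=
      ContinuousAt.comp (f := fun y : Fin N → ℂ => y j) hf (continuous_apply j).continuousAt
    filter_upwards [h2.eventually (Metric.isClosed_closedBall.isOpen_compl.mem_nhds h1)] with y hy w hw e
    exact hy (e ▸ hw)
  have hout' : ∀ k j, ∀ᶠ y in 𝓝 z, ∀ w ∈ Metric.closedBall (Γ.center k) (Γ.radius k),
      w ≠ -y j ∧ w ≠ q * y j ∧ w ≠ -(q * y j) ∧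
      w ≠ (q ^ 2)⁻¹ * (y j)⁻¹ ∧ w ≠ -((q ^ 2)⁻¹ * (y j)⁻¹) := by
    intro k j
    have h := fun w hw => (hΓ.outside k w hw).2 j
    have hj := hΓ.ne_zero j
    filter_upwards [hout (fun x => -x) j k (by fun_prop) fun w hw => (h w hw).1,
      hout (fun x => q * x) j k (by fun_prop) fun w hw => (h w hw).2.1,
      hout (fun x => -(q * x)) j k (by fun_prop) fun w hw => (h w hw).2.2.1,
      hout (fun x => (q ^ 2)⁻¹ * x⁻¹) j k (by fun_prop (disch := exact hj))
        fun w hw => (h w hw).2.2.2.1,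
      hout (fun x => -((q ^ 2)⁻¹ * x⁻¹)) j k (by fun_prop (disch := exact hj))
        fun w hw => (h w hw).2.2.2.2] with y h1 h2 h3 h4 h5 w hw
    exact ⟨h1 w hw, h2 w hw, h3 w hw, h4 w hw, h5 w hw⟩
  filter_upwards [eventually_all.2 hin, eventually_all.2 fun k => eventually_all.2 (hout' k)]
    with y h1 h2
  exact ⟨hΓ.radius_pos, hΓ.disjoint, h1, fun k w hw => ⟨(hΓ.outside k w hw).1,
    fun j => h2 k j w hw⟩⟩

theorem continuousAt_Xi {X : Type*} [TopologicalSpace X] {x₀ : X} (hq : q ≠ 0) (hβ : β ≠ 0)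
    {y : X → Fin N → ℂ} {w : X → Fin n → ℂ} (hy : ContinuousAt y x₀) (hw : ContinuousAt w x₀)
    (hy0 : ∀ j, y x₀ j ≠ 0) (hw0 : ∀ l, w x₀ l ≠ 0) (h1 : ∀ l j, bracket (y x₀ j / w x₀ l) ≠ 0)
    (h2 : ∀ l j, bracket (q * y x₀ j / w x₀ l) ≠ 0)
    (h3 : ∀ l j, bracket (q ^ 2 * w x₀ l * y x₀ j) ≠ 0) (a : Fin n → Fin N) :
    ContinuousAt (fun x => Xi q β (y x) a (w x)) x₀ := by
  have hy' := continuousAt_pi.1 hy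
  have hw' := continuousAt_pi.1 hw
  unfold Xi
  fun_prop (disch := simp [hq, hβ, hy0, hw0, h1, h2, h3, prod_eq_zero_iff])

theorem continuousAt_prefactor {X : Type*} [TopologicalSpace X] {x₀ : X} (hq : q ≠ 0)
    {y : X → Fin N → ℂ} (hy : ContinuousAt y x₀) (hy0 : ∀ j, y x₀ j ≠ 0) :
    ContinuousAt (fun x => prefactor q (y x)) x₀ := by
  have hy' := continuousAt_pi.1 hy
  unfold prefactor pairProd
  fun_prop (disch := simp [hq, hy0])

/-- On the circles all denominators are nonzero, so the integrand is jointly continuous in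
parameters and angles, and the domain of integration is compact. Coinciding parameters cause no
difficulty, unlike in the residue sum. -/
theorem continuousAt_psiComponent (hq : q ≠ 0) (hβ : β ≠ 0) (hΓ : Γ.Surrounds q z)
    (a : Fin n → Fin N) : ContinuousAt (fun y => psiComponent q β y Γ a) z := by
  have hopen : IsOpen {y : Fin N → ℂ | Γ.Surrounds q y} :=
    isOpen_iff_mem_nhds.2 fun y hy => Contour.Surrounds.eventually hy
  have : LocallyCompactSpace {y : Fin N → ℂ | Γ.Surrounds q y} := hopen.locallyCompactSpace
  suffices h : Continuous fun y : {y : Fin N → ℂ | Γ.Surrounds q y} => psiComponent q β y.1 Γ a from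
    (continuousOn_iff_continuous_domRestrict.2 h).continuousAt (hopen.mem_nhds hΓ)
  unfold psiComponent Contour.multiIntegral torusIntegral
  refine Continuous.mul (continuous_const.mul ?_) (continuous_finsetSum _ fun κ _ => ?_)
  · refine continuous_iff_continuousAt.2 fun y => ?_
    exact continuousAt_prefactor hq continuous_subtype_val.continuousAt y.2.ne_zero
  · refine continuous_parametric_integral_of_continuous
      (f := fun (y : {y : Fin N → ℂ | Γ.Surrounds q y}) θ => _) ?_ isCompact_Icc
    refine continuous_iff_continuousAt.2 fun p => ?_
    have hsph := torusMap_mem_sphere (c := fun l => Γ.center (κ l)) (R := fun l => Γ.radius (κ l))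
      (fun l => p.1.2.radius_pos (κ l)) p.2
    have hT := continuous_torusMap (fun l => Γ.center (κ l)) fun l => Γ.radius (κ l)
    have hb := fun l => p.1.2.bracket_ne hq p.1.2.ne_zero (Metric.sphere_subset_closedBall (hsph l))
    have hw0 := fun l => (hb l).1
    have h1 : ∀ l j, bracket (p.1.1 j / torusMap (fun l => Γ.center (κ l))
        (fun l => Γ.radius (κ l)) p.2 l) ≠ 0 := fun l j e => by
      have h := inv_bracket_div (p.1.2.ne_zero j) (hw0 l)
      have h2 := ((hb l).2 j).1
      have h3 : torusMap (fun l => Γ.center (κ l)) (fun l => Γ.radius (κ l)) p.2 l - p.1.1 j ≠ 0 :=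
        sub_ne_zero.2 fun e => p.1.2.notMem_sphere (κ l) j (e ▸ hsph l)
      rw [e, inv_zero, eq_comm] at h
      simp [h2, h3, p.1.2.ne_zero j, hw0 l] at h
    have hXi := continuousAt_Xi (β := β) (x₀ := p) (y := fun p => p.1.1) (w := fun p => torusMap _ _ p.2)
      hq hβ (continuous_subtype_val.comp continuous_fst).continuousAt
      (hT.comp continuous_snd).continuousAt p.1.2.ne_zero hw0 h1 (fun l j => ((hb l).2 j).2.1)
      (fun l j => ((hb l).2 j).2.2) a
    have hw : ContinuousAt (fun p : {y : Fin N → ℂ | Γ.Surrounds q y} × (Fin n → ℝ) =>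
      torusMap (fun l => Γ.center (κ l)) (fun l => Γ.radius (κ l)) p.2) p :=
      (hT.comp continuous_snd).continuousAt
    refine ContinuousAt.mul (by fun_prop) (ContinuousAt.mul ?_ hXi)
    fun_prop (disch := simp [hw0, Real.pi_ne_zero])

theorem continuousAt_psi (hq : q ≠ 0) (hβ : β ≠ 0) (hΓ : Γ.Surrounds q z) :
    ContinuousAt (fun y => psi q β y Γ) z := by
  refine continuousAt_pi.2 fun s => ?_
  unfold psi
  split_ifs
  · exact continuousAt_psiComponent hq hβ hΓ _
  · exact continuousAt_const

end ContourContinuity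

/-! ### Continuity of the transfer matrix -/

section TransferContinuity

variable {X : Type*} [TopologicalSpace X] {x₀ : X} {N M : ℕ} {q β β' : ℂ}

theorem continuousAt_leg2_RMatrix (hq : q ≠ 0) {r : X → ℂ} (hr : ContinuousAt r x₀)
    (h0 : r x₀ ≠ 0) (h1 : bracket (q / r x₀) ≠ 0) (i j : Fin M) :
    ContinuousAt (fun x => leg2 (RMatrix q (r x)) i j) x₀ := by
  refine continuousAt_pi.2 fun s => continuousAt_pi.2 fun t => ?_
  simp only [leg2, RMatrix, Matrix.of_apply]
  split_ifs <;> fun_prop (disch := simp [hq, h0])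

theorem continuousAt_leg1_KMatrix {w : X → ℂ} (hw : ContinuousAt w x₀) (h0 : w x₀ ≠ 0)
    (hβ : β ≠ 0) (h1 : bracket (β / w x₀) ≠ 0) (i : Fin M) :
    ContinuousAt (fun x => leg1 (KMatrix (w x) β) i) x₀ := by
  refine continuousAt_pi.2 fun s => continuousAt_pi.2 fun t => ?_
  simp only [leg1, KMatrix, Matrix.of_apply, Matrix.diagonal_apply]
  split_ifs
  · generalize s i = k
    fin_cases k
    · simpa using continuousAt_const
    · simp only [Fin.mk_one, Matrix.cons_val_one, Matrix.cons_val_fin_one]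
      fun_prop (disch := simp [hβ, h0])
  · exact continuousAt_const
  · exact continuousAt_const

theorem continuousAt_transferMatrix (hq : q ≠ 0) (hβ : β ≠ 0) (hβ' : β' ≠ 0) {z : X → Fin N → ℂ}
    {w : X → ℂ} (hz : ContinuousAt z x₀) (hw : ContinuousAt w x₀) (hz0 : ∀ j, z x₀ j ≠ 0)
    (hw0 : w x₀ ≠ 0) (h1 : bracket (β / w x₀) ≠ 0) (h2 : bracket (β' / (q * w x₀)) ≠ 0)
    (h3 : ∀ j, bracket (q * z x₀ j / w x₀) ≠ 0) (h4 : ∀ j, bracket (q / (z x₀ j * w x₀)) ≠ 0) :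
    ContinuousAt (fun x => transferMatrix q β β' (z x) (w x)) x₀ := by
  have hpt : ∀ A : X → Matrix (Config (N + 1)) (Config (N + 1)) ℂ, ContinuousAt A x₀ →
      ContinuousAt (fun x => partialTrace (A x)) x₀ := fun A hA => by
    refine continuousAt_pi.2 fun s => continuousAt_pi.2 fun t => ?_
    simp only [partialTrace, Matrix.of_apply]
    exact tendsto_finsetSum _ fun a _ =>
      (continuousAt_pi.1 ((continuousAt_pi.1 hA) _)) _
  have hR1 : ∀ i : Fin N, ContinuousAt (fun x => leg2 (RMatrix q (w x / z x i)) 0 i.succ) x₀ :=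
    fun i => by
      have hi := hz0 i
      refine continuousAt_leg2_RMatrix (r := fun x => w x / z x i) hq
        (hw.div (continuousAt_pi.1 hz i) hi) (div_ne_zero hw0 hi) ?_ _ _
      rw [div_div_eq_mul_div]
      exact h3 i
  have hR2 : ∀ i : Fin N, ContinuousAt (fun x => leg2 (RMatrix q (w x * z x i)) 0 i.succ) x₀ :=
    fun i => by
      refine continuousAt_leg2_RMatrix (r := fun x => w x * z x i) hq
        (hw.mul (continuousAt_pi.1 hz i)) (mul_ne_zero hw0 (hz0 i)) ?_ _ _
      rw [mul_comm]
      exact h4 i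
  unfold transferMatrix
  refine hpt _ (((ContinuousAt.mul ?_ ?_).mul ?_).mul ?_)
  · exact continuousAt_leg1_KMatrix (w := fun x => q * w x) (continuousAt_const.mul hw) (mul_ne_zero hq hw0) hβ' h2 _
  · simp only [List.ofFn_eq_map, ← List.map_reverse]
    exact tendsto_list_prod _ fun i _ => hR1 i
  · exact continuousAt_leg1_KMatrix hw hw0 hβ h1 _
  · simp only [List.ofFn_eq_map]
    exact tendsto_list_prod _ fun i _ => hR2 i

end TransferContinuity
end SixVertex

namespace SixVertex

open Finset Filter Topology

/-! ### Removal of the genericity assumptions -/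

theorem tendsto_mulVec {α ι : Type*} [Fintype ι] {l : Filter α} {A : α → Matrix ι ι ℂ}
    {A₀ : Matrix ι ι ℂ} {x : α → ι → ℂ} {x₀ : ι → ℂ} (hA : Tendsto A l (𝓝 A₀))
    (hx : Tendsto x l (𝓝 x₀)) : Tendsto (fun t => (A t).mulVec (x t)) l (𝓝 (A₀.mulVec x₀)) :=
  tendsto_pi_nhds.2 fun i => tendsto_finsetSum _ fun j _ =>
    (tendsto_pi_nhds.1 (tendsto_pi_nhds.1 hA i) j).mul (tendsto_pi_nhds.1 hx j)

section Deformation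

variable {N : ℕ} {q β β' : ℂ} {z : Fin N → ℂ} {w : ℂ} {Γ : Contour}

/-- A deformation of the parameters along which coincidences are removed. -/
noncomputable def deform (z : Fin N → ℂ) (t : ℂ) : Fin N → ℂ := fun j => z j * t ^ (j.val + 1)

theorem deform_one (z : Fin N → ℂ) : deform z 1 = z := by
  funext j
  simp [deform]

theorem continuous_deform (z : Fin N → ℂ) : Continuous (deform z) := by
  unfold deform
  fun_prop

/-- The spectral parameter is deformed as one more inhomogeneity, so that one regularity statement
covers both. -/
theorem snoc_deform (z : Fin N → ℂ) (w t : ℂ) :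
    snocParam (deform z t) (w * t ^ (N + 1)) = deform (snocParam z w) t := by
  funext j
  induction j using Fin.lastCases <;> simp [deform]

/-- Distinct positive exponents make each product and each ratio of different parameters a
nonconstant power of `t`, so each condition fails only finitely often. -/
theorem eventually_isRegular_deform (hq3 : q ^ 3 = 1) (hz : ∀ j, z j ≠ 0) :
    ∀ᶠ t in 𝓝[≠] 1, IsRegular q (deform z t) := by
  have h0 : ∀ᶠ t : ℂ in 𝓝[≠] 1, t ≠ 0 := by simpa using eventually_pow_ne 1 one_pos 0
  have h1 : ∀ᶠ t : ℂ in 𝓝[≠] 1, ∀ k : Fin 3, ∀ i j : Fin N,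
      (q ^ (k : ℕ) * z i * z j * t ^ (i.val + 1 + (j.val + 1))) ^ 2 ≠ 1 :=
    eventually_all.2 fun k => eventually_all.2 fun i => eventually_all.2 fun j =>
      eventually_sq_mul_pow_ne 1 (by omega) _
  have h2 : ∀ᶠ t : ℂ in 𝓝[≠] 1, ∀ k : Fin 3, ∀ i j : Fin N, j < i →
      (q ^ (k : ℕ) * z i / z j * t ^ (i.val - j.val)) ^ 2 ≠ 1 := by
    refine eventually_all.2 fun k => eventually_all.2 fun i => eventually_all.2 fun j => ?_
    by_cases h : j < i
    · filter_upwards [eventually_sq_mul_pow_ne 1 (show 0 < i.val - j.val by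
        rw [Fin.lt_def] at h; omega) (q ^ (k : ℕ) * z i / z j)] with t ht using fun _ => ht
    · exact Eventually.of_forall fun t h' => absurd h' h
  have h3 : ∀ᶠ t : ℂ in 𝓝[≠] 1, ∀ k : Fin 3, ∀ i j : Fin N, i < j →
      ((q ^ (k : ℕ) * z i / z j)⁻¹ * t ^ (j.val - i.val)) ^ 2 ≠ 1 := by
    refine eventually_all.2 fun k => eventually_all.2 fun i => eventually_all.2 fun j => ?_
    by_cases h : i < j
    · filter_upwards [eventually_sq_mul_pow_ne 1 (show 0 < j.val - i.val by
        rw [Fin.lt_def] at h; omega) (q ^ (k : ℕ) * z i / z j)⁻¹] with t ht using fun _ => ht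
    · exact Eventually.of_forall fun t h' => absurd h' h
  filter_upwards [h0, h1, h2, h3] with t h0 h1 h2 h3
  refine isRegular_of_sq_ne hq3 (fun j => mul_ne_zero (hz j) (pow_ne_zero _ h0)) (fun k i j h => ?_)
    fun k i j hij h => ?_
  · apply h1 k i j
    rw [← h, deform, deform]
    ring
  · rcases lt_or_gt_of_ne hij with hlt | hlt
    · apply h3 k i j hlt
      rw [← inv_inj, inv_one, ← h, deform, deform]
      have hp : t ^ (j.val + 1) = t ^ (j.val - i.val) * t ^ (i.val + 1) := by
        rw [← pow_add]
        congr 1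
        rw [Fin.lt_def] at hlt
        omega
      rw [hp, ← inv_pow]
      congr 1
      have := hz j
      field_simp
    · apply h2 k i j hlt
      rw [← h, deform, deform]
      have hp : t ^ (i.val + 1) = t ^ (i.val - j.val) * t ^ (j.val + 1) := by
        rw [← pow_add]
        congr 1
        rw [Fin.lt_def] at hlt
        omega
      rw [hp]
      congr 1
      have := hz j
      field_simp

theorem IsRegular.injective (hz : IsRegular q z) : Function.Injective z := fun i j h => by
  by_contra hij
  have := hz.div_ne 0 i j hij
  rw [h, pow_zero, one_mul, div_self (hz.ne_zero j)] at this
  exact this bracket_one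

theorem continuousAt_deform (z : Fin N → ℂ) : Tendsto (deform z) (𝓝 1) (𝓝 z) := by
  have := (continuous_deform z).tendsto 1
  rwa [deform_one] at this

theorem eventually_psi_deform (hq3 : q ^ 3 = 1) (hβ : β ≠ 0) (hN : 0 < N) (hΓ : Γ.Surrounds q z) :
    ∀ᶠ t in 𝓝[≠] 1, psi q β (deform z t) Γ = ampVec (N / 2) q β (deform z t) := by
  filter_upwards [eventually_isRegular_deform hq3 hΓ.ne_zero,
    ((continuousAt_deform z).mono_left nhdsWithin_le_nhds).eventually hΓ.eventually] with t h1 h2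
  exact h2.psi_eq_ampVec hN (ne_zero_of_pow_three hq3) hβ h1.ne_zero h1.injective

theorem tendsto_psi_deform (hq : q ≠ 0) (hβ : β ≠ 0) (hΓ : Γ.Surrounds q z) :
    Tendsto (fun t => psi q β (deform z t) Γ) (𝓝[≠] 1) (𝓝 (psi q β z Γ)) :=
  (continuousAt_psi hq hβ hΓ).tendsto.comp ((continuousAt_deform z).mono_left nhdsWithin_le_nhds)

/-- Both sides are continuous at `t = 1` along the deformation, and they agree for `t` near but
different from `1`, where the contour vector is the residue sum. -/
theorem transferMatrix_mulVec_psi (hq1 : bracket q ≠ 0) (hq3 : q ^ 3 = 1)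
    (hβ : β' ^ 2 * β ^ 2 * q ^ 2 = 1) (hN : 0 < N) (hΓ : Γ.Surrounds q z) (hw : w ≠ 0)
    (h1 : bracket (β / w) ≠ 0) (h2 : bracket (q ^ 2 * β * w) ≠ 0)
    (h3 : ∀ j, bracket (q * z j / w) ≠ 0) (h4 : ∀ j, bracket (q / (z j * w)) ≠ 0) :
    (transferMatrix q β β' z w).mulVec (psi q β z Γ) =
      (-(bracket (q * β * w) / bracket (q ^ 2 * β * w))) • psi q β z Γ := by
  have hq := ne_zero_of_pow_three hq3
  have hβ0 : β ≠ 0 := by rintro rfl; norm_num at hβ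
  have hβ'0 : β' ≠ 0 := by rintro rfl; norm_num at hβ
  have hz0 := hΓ.ne_zero
  -- By the relation between `β` and `β'`, this is equivalent to the nonvanishing of `[q²βw]`.
  have hβ'w : bracket (β' / (q * w)) ≠ 0 := by
    have hqw := mul_ne_zero hq hw
    rw [bracket_ne_zero_iff (div_ne_zero hβ'0 hqw)]
    rw [bracket_ne_zero_iff (mul_ne_zero (mul_ne_zero (pow_ne_zero 2 hq) hβ0) hw)] at h2
    intro h
    apply h2
    rw [div_pow, div_eq_one_iff_eq (pow_ne_zero 2 hqw)] at h
    rw [h] at hβ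
    rw [← hβ]
    ring
  set W : ℂ → ℂ := fun t => w * t ^ (N + 1) with hW
  have hWc : ContinuousAt W 1 := by fun_prop
  have hW1 : W 1 = w := by simp [hW]
  have hWt : Tendsto W (𝓝[≠] 1) (𝓝 w) := by
    have := hWc.tendsto.mono_left (nhdsWithin_le_nhds (s := {1}ᶜ))
    rwa [hW1] at this
  have hc1 : Tendsto (fun t => bracket (β / W t)) (𝓝[≠] 1) (𝓝 (bracket (β / w))) :=
    (ContinuousAt.tendsto (f := fun x => bracket (β / x)) (x := w)
      (by fun_prop (disch := simp [hβ0, hw]))).comp hWt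
  have hc2 : Tendsto (fun t => bracket (q ^ 2 * β * W t)) (𝓝[≠] 1) (𝓝 (bracket (q ^ 2 * β * w))) :=
    (ContinuousAt.tendsto (f := fun x => bracket (q ^ 2 * β * x)) (x := w)
      (by fun_prop (disch := simp [hβ0, hw, hq]))).comp hWt
  have hc3 : Tendsto (fun t => bracket (q * β * W t)) (𝓝[≠] 1) (𝓝 (bracket (q * β * w))) :=
    (ContinuousAt.tendsto (f := fun x => bracket (q * β * x)) (x := w)
      (by fun_prop (disch := simp [hβ0, hw, hq]))).comp hWt
  have hT : Tendsto (fun t => transferMatrix q β β' (deform z t) (W t)) (𝓝[≠] 1)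
      (𝓝 (transferMatrix q β β' z w)) := by
    have := continuousAt_transferMatrix (x₀ := (1 : ℂ)) hq hβ0 hβ'0
      (continuous_deform z).continuousAt hWc (by simpa only [deform_one] using hz0)
      (by rwa [hW1]) (by rwa [hW1]) (by rwa [hW1]) (by simpa only [deform_one, hW1] using h3)
      (by simpa only [deform_one, hW1] using h4)
    have := this.tendsto.mono_left (nhdsWithin_le_nhds (s := {1}ᶜ))
    simpa only [deform_one, hW1] using this
  have hpsi := tendsto_psi_deform hq hβ0 hΓ
  have hL : Tendsto (fun t => (transferMatrix q β β' (deform z t) (W t)).mulVec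
      (psi q β (deform z t) Γ)) (𝓝[≠] 1) (𝓝 ((transferMatrix q β β' z w).mulVec (psi q β z Γ))) := by
    exact tendsto_mulVec hT hpsi
  have hR := (hc3.div hc2 h2).neg.smul hpsi
  refine tendsto_nhds_unique_of_eventuallyEq hL hR ?_
  have hsn : ∀ j, snocParam z w j ≠ 0 := fun j => by
    induction j using Fin.lastCases with
    | last => simpa using hw
    | cast j => simpa using hz0 j
  -- The extra conditions `[βz_i] ≠ 0` and `[βw] ≠ 0` of the regular case are not assumed; the
  -- deformation achieves them as well.
  have hβz : ∀ᶠ t in 𝓝[≠] 1, ∀ i, (β * snocParam z w i * t ^ (i.val + 1)) ^ 2 ≠ 1 :=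
    eventually_all.2 fun i => eventually_sq_mul_pow_ne 1 (Nat.succ_pos _) _
  filter_upwards [eventually_isRegular_deform hq3 hsn, hβz, hc1.eventually_ne h1,
    hc2.eventually_ne h2, eventually_psi_deform hq3 hβ0 hN hΓ] with t e1 e2 e3 e4 e5
  have hb : ∀ i, bracket (β * deform (snocParam z w) t i) ≠ 0 := fun i => by
    rw [bracket_ne_zero_iff (mul_ne_zero hβ0 (e1.ne_zero i)), deform, ← mul_assoc]
    exact e2 i
  rw [← snoc_deform] at e1 hb
  rw [e5]
  exact transferMatrix_mulVec_ampVec hq1 hq3 hβ (by omega) (by omega) e1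
    (fun i => by simpa using hb i.castSucc) (by simpa using hb (Fin.last N)) e3 e4

end Deformation

/-! ### Nonvanishing of the vector -/

section Nonvanishing

variable {N : ℕ} {q β : ℂ} {z : Fin N → ℂ} {Γ : Contour}

/-- Genericity excludes zeros of `[q z_j / z_i]` and `[q² z_i z_j]`; the other two kinds of brackets
are the extra assumptions. No bracket `[z_i / z_j]` occurs, so parameters may coincide. -/
theorem leftProduct_ne_zero (hq : q ≠ 0) (hz : IsGeneric q z)
    (hβz : ∀ j, bracket (β * z j) ≠ 0) (hqz : ∀ i j, i ≠ j → bracket (q * z i * z j) ≠ 0) (n : ℕ) :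
    leftProduct q β z n ≠ 0 := by
  have hz0 : ∀ i, z i ≠ 0 := fun i => (hz i).1
  have h1 : ∀ i j, bracket (q * z j / z i) ≠ 0 := fun i j => by
    obtain ⟨-, h2, h3, -⟩ := (hz i).2 j
    rw [bracket_ne_zero_iff (div_ne_zero (mul_ne_zero hq (hz0 j)) (hz0 i)), sq_ne_one_iff, ne_eq,
      ne_eq, div_eq_one_iff_eq (hz0 i), div_eq_iff (hz0 i)]
    exact ⟨fun e => h2 e.symm, fun e => h3 (by rw [e]; ring)⟩
  have h2 : ∀ i j, bracket (q ^ 2 * z i * z j) ≠ 0 := fun i j => by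
    obtain ⟨-, -, -, h4, h5⟩ := (hz i).2 j
    rw [bracket_ne_zero_iff (mul_ne_zero (mul_ne_zero (pow_ne_zero 2 hq) (hz0 i)) (hz0 j)),
      sq_ne_one_iff]
    refine ⟨fun e => h4 ?_, fun e => h5 ?_⟩
    · rw [← mul_inv]
      exact eq_inv_of_mul_eq_one_left (by rw [← e]; ring)
    · rw [← mul_inv, ← neg_eq_iff_eq_neg]
      exact eq_inv_of_mul_eq_one_left (by rw [← neg_eq_iff_eq_neg.2 e]; ring)
  unfold leftProduct pairProd
  refine mul_ne_zero (prod_ne_zero_iff.2 fun i _ => ?_) (prod_ne_zero_iff.2 fun i _ =>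
    prod_ne_zero_iff.2 fun j hj => ?_)
  · split_ifs
    · exact hβz i
    · exact one_ne_zero
  · have hij : i ≠ j := (mem_Ioi.1 hj).ne
    dsimp only
    split_ifs
    · exact mul_ne_zero (h1 i j) (hqz i j hij)
    · exact one_ne_zero
    · exact mul_ne_zero (h1 i j) (h2 i j)

theorem continuousAt_leftProduct (hq : q ≠ 0) (hβ : β ≠ 0) (hz : ∀ j, z j ≠ 0) (n : ℕ) :
    ContinuousAt (fun y : Fin N → ℂ => leftProduct q β y n) z := by
  have hy : ∀ j, ContinuousAt (fun y : Fin N → ℂ => y j) z := fun j =>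
    (continuous_apply j).continuousAt
  unfold leftProduct pairProd
  refine (tendsto_finsetProd _ fun i _ => ?_).mul (tendsto_finsetProd _ fun i _ =>
    tendsto_finsetProd _ fun j _ => ?_)
  · split_ifs
    · exact ContinuousAt.bracket (continuousAt_const.mul (hy i)) (mul_ne_zero hβ (hz i))
    · exact tendsto_const_nhds
  · have h1 : ContinuousAt (fun y : Fin N → ℂ => bracket (q * y j / y i)) z := by
      fun_prop (disch := simp [hq, hz])
    have h2 : ContinuousAt (fun y : Fin N → ℂ => bracket (q * y i * y j)) z := by
      fun_prop (disch := simp [hq, hz])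
    have h3 : ContinuousAt (fun y : Fin N → ℂ => bracket (q ^ 2 * y i * y j)) z := by
      fun_prop (disch := simp [hq, hz])
    dsimp only
    split_ifs
    · exact h1.mul h2
    · exact tendsto_const_nhds
    · exact h1.mul h3

/-- One component suffices: with the down spins at the first `N / 2` sites it equals `leftProduct`,
for regular parameters by `amp_castLE` and in general by continuity. -/
theorem psi_ne_zero (hq1 : bracket q ≠ 0) (hq3 : q ^ 3 = 1) (hβ : β ≠ 0) (hN : 0 < N)
    (hz : IsGeneric q z) (hΓ : Γ.Surrounds q z) (hβz : ∀ j, bracket (β * z j) ≠ 0)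
    (hqz : ∀ i j, i ≠ j → bracket (q * z i * z j) ≠ 0) : psi q β z Γ ≠ 0 := by
  have hq := ne_zero_of_pow_three hq3
  set s : Config N := fun i => if i.val < N / 2 then 1 else 0 with hs
  have hle : N / 2 ≤ N := Nat.div_le_self _ _
  have hsites : IsSites (Fin.castLE hle) s := by
    refine ⟨Fin.strictMono_castLE hle, fun i => ?_⟩
    simp only [hs]
    constructor
    · intro h
      have hi : i.val < N / 2 := by
        by_contra hc
        rw [if_neg hc] at h
        exact absurd h (by decide)
      exact ⟨⟨i.val, hi⟩, rfl⟩
    · rintro ⟨l, rfl⟩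
      simp
  have h1 : Tendsto (fun t => psi q β (deform z t) Γ s) (𝓝[≠] 1) (𝓝 (psi q β z Γ s)) :=
    tendsto_pi_nhds.1 (tendsto_psi_deform hq hβ hΓ) s
  have h2 : Tendsto (fun t => leftProduct q β (deform z t) (N / 2)) (𝓝[≠] 1)
      (𝓝 (leftProduct q β z (N / 2))) :=
    (continuousAt_leftProduct hq hβ hΓ.ne_zero (N / 2)).tendsto.comp
      ((continuousAt_deform z).mono_left nhdsWithin_le_nhds)
  have h3 : psi q β z Γ s = leftProduct q β z (N / 2) := by
    refine tendsto_nhds_unique_of_eventuallyEq h1 h2 ?_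
    filter_upwards [eventually_psi_deform hq3 hβ hN hΓ, eventually_isRegular_deform hq3 hΓ.ne_zero]
      with t e1 e2
    rw [e1, ampVec_of_isSites hsites, amp_castLE hq1 e2 hle]
  intro h0
  rw [h0] at h3
  exact leftProduct_ne_zero hq hz hβz hqz (N / 2) h3.symm

end Nonvanishing

/-! ### Cube roots of unity and conclusion -/

theorem pow_three_eq_one_of_eq {q : ℂ} (hq : q = Complex.exp (2 * Real.pi * Complex.I / 3) ∨
    q = Complex.exp (-(2 * Real.pi * Complex.I / 3))) : q ^ 3 = 1 ∧ q ≠ 1 := by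
  have hprim := Complex.isPrimitiveRoot_exp 3 (by norm_num)
  have hprim' : IsPrimitiveRoot (Complex.exp (2 * Real.pi * Complex.I / 3)) 3 := by
    simpa using hprim
  rcases hq with rfl | rfl
  · exact ⟨hprim'.pow_eq_one, hprim'.ne_one (by norm_num)⟩
  · rw [Complex.exp_neg]
    exact ⟨hprim'.inv.pow_eq_one, hprim'.inv.ne_one (by norm_num)⟩

theorem bracket_ne_zero_of_pow_three {q : ℂ} (hq3 : q ^ 3 = 1) (hq : q ≠ 1) : bracket q ≠ 0 := by
  rw [bracket_ne_zero_iff (ne_zero_of_pow_three hq3)]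
  intro h
  apply hq
  rw [pow_succ, h, one_mul] at hq3
  exact hq3

end SixVertex

theorem mainTheorem6 (N : ℕ) (hN : 1 ≤ N) (q β β' : ℂ)
    (hq : q = Complex.exp (2 * Real.pi * Complex.I / 3) ∨
      q = Complex.exp (-(2 * Real.pi * Complex.I / 3)))
    (hβ : β' ^ 2 * β ^ 2 * q ^ 2 = 1)
    (z : Fin N → ℂ) (hz : SixVertex.IsGeneric q z)
    (Γ : SixVertex.Contour) (hΓ : Γ.Surrounds q z) :
    (∀ w : ℂ, w ≠ 0 → SixVertex.bracket (β / w) ≠ 0 → SixVertex.bracket (q ^ 2 * β * w) ≠ 0 →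
        (∀ j, SixVertex.bracket (q * z j / w) ≠ 0 ∧ SixVertex.bracket (q / (z j * w)) ≠ 0) →
        (SixVertex.transferMatrix q β β' z w).mulVec (SixVertex.psi q β z Γ) =
          (-(SixVertex.bracket (q * β * w) / SixVertex.bracket (q ^ 2 * β * w))) •
            SixVertex.psi q β z Γ) ∧
      ((∀ j, SixVertex.bracket (β * z j) ≠ 0) →
        (∀ i j, i ≠ j → SixVertex.bracket (q * z i * z j) ≠ 0) →
        SixVertex.psi q β z Γ ≠ 0) := by
  obtain ⟨hq3, hq1⟩ := SixVertex.pow_three_eq_one_of_eq hq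
  have hbq := SixVertex.bracket_ne_zero_of_pow_three hq3 hq1
  have hβ0 : β ≠ 0 := by rintro rfl; norm_num at hβ
  exact ⟨fun w hw h1 h2 h3 => SixVertex.transferMatrix_mulVec_psi hbq hq3 hβ hN hΓ hw h1 h2
    (fun j => (h3 j).1) fun j => (h3 j).2,
    fun h1 h2 => SixVertex.psi_ne_zero hbq hq3 hβ0 hN hz hΓ h1 h2⟩
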